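/- **Proposition (Gel'fand–Shilov type classes).** Let $dA$ be Lebesgue measure on $\mathbb C$ and $d\mu(z)=e^{-\pi|z|^2}\,dA(z)$. For $j\in\mathbb N_0$ put $\Phi_{j,j}(z)=\sum_{k=0}^{j}\binom jk\frac{(-\pi|z|^2)^k}{k!}$ and let $$K^j(\zeta,z)=e^{\pi\overline z\zeta}\,\Phi_{j,j}(\zeta-z),\qquad (P^j\sigma)(\zeta)=\int_{\mathbb C}\sigma(z)K^j(\zeta,z)\,d\mu(z).$$ ($K^j$ is the reproducing kernel of the true polyanalytic Fock space of order $j$, and $P^j$ on $L^2(\mathbb C,d\mu)$ is the orthogonal projection onto it.) Let $\mathcal D$ be the space of functions $\sigma:\mathbb C\to\mathbb C$ for which all these integrals ($j\in\mathbb N_0$, $\zeta\in\mathbb C$) converge absolutely. Fix $n\in\mathbb N_0$ and $\frac12\le\alpha\le1$. For $a\in\mathbb R$ and $1\le p\le\infty$ let $$\mathcal W^{p,n}_{a,\alpha}=\Bigl\{\sigma\in\mathcal D:\ e^{a|\cdot|^{1/\alpha}}e^{-\frac\pi2|\cdot|^2}P^j\sigma\in L^p(\mathbb C)\ \text{ for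 } 0\le j\le n\Bigr\},$$ $$\|\sigma\|_{\mathcal W^{p,n}_{a,\alpha}}=\sum_{j=0}^n\bigl\|e^{a|\cdot|^{1/\alpha}}e^{-\frac\pi2|\cdot|^2}P^j\sigma\bigr\|_{L^p(\mathbb C)}.$$ Fix any $1\le q\le\infty$. Let $\mathcal G^{(\alpha)}_n$ be the space of $\sigma$ that lie in $\mathcal W^{q,n}_{a,\alpha}$ for every $a>0$, with the projective limit topology, and let $\mathcal G^{\{\alpha\}}_n$ be the space of $\sigma$ that lie in $\mathcal W^{q,n}_{a,\alpha}$ for some $a>0$, with the locally convex inductive limit topology. Let $\mathcal G^{(\alpha)'}_n$ and $\mathcal G^{\{\alpha\}'}_n$ be their topological duals. A function $F\in\mathcal D$ is said to represent a linear functional $u$ on one of these spaces if, for every $\sigma$ in the space, $$u(\sigma)=\sum_{j=0}^n\int_{\mathbb C}(P^j\sigma)\,\overline{P^jF}\,d\mu ,$$ all integrals being absolutely convergent. Then for every $1\le p\le\infty$ (independently of $q$): 1. $\displaystyle \mathcal G^{(\alpha)}_n=\bigcap_{a>0}\mathcal W^{p,n}_{a,\alpha}$ and $\displaystyle \mathcal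 G^{\{\alpha\}}_n=\bigcup_{a>0}\mathcal W^{p,n}_{a,\alpha}$. 2. $\displaystyle \mathcal G^{(\alpha)'}_n=\bigcup_{a>0}\mathcal W^{p,n}_{-a,\alpha}$ in the following sense. Every $F\in\bigcup_{a>0}\mathcal W^{p,n}_{-a,\alpha}$ represents an element of $\mathcal G^{(\alpha)'}_n$. Every $u\in\mathcal G^{(\alpha)'}_n$ is represented by some $F\in\bigcup_{a>0}\mathcal W^{p,n}_{-a,\alpha}$, which can be chosen polyanalytic of order $n+1$ (smooth with $\partial_{\overline z}^{\,n+1}F=0$). If $\alpha>\frac12$, then any two functions in this union that represent the same functional have the same components $P^0F,\dots,P^nF$, and they are equal if both are polyanalytic of order $n+1$. 3. $\displaystyle \mathcal G^{\{\alpha\}'}_n=\bigcap_{a>0}\mathcal W^{p,n}_{-a,\alpha}$ in the same sense, with $\mathcal G^{\{\alpha\}'}_n$ and $\bigcap_{a>0}\mathcal W^{p,n}_{-a,\alpha}$ in place of $\mathcal G^{(\alpha)'}_n$ and $\bigcup_{a>0}\mathcal W^{p,n}_{-a,\alpha}$; here the uniqueness holds for all $\frac12\le\alpha\le1$. -/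

import Mathlib

open MeasureTheory
open scoped ENNReal Topology ComplexConjugate ContDiff

noncomputable section

namespace PolyFock

/-- The Gaussian density `e^{-π|z|²}` of `dμ` with respect to Lebesgue measure on `ℂ`. -/
def gauss (z : ℂ) : ℂ := (Real.exp (-(Real.pi * ‖z‖ ^ 2)) : ℝ)

/-- The diagonal polynomial `Φ_{j,j}(z) = ∑_k (j choose k) (-π|z|²)^k / k!`,
that is, the Laguerre polynomial `L_j` evaluated at `π|z|²`. -/
def diagPhi (j : ℕ) (z : ℂ) : ℂ :=
  ∑ k ∈ Finset.range (j + 1),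
    (j.choose k : ℂ) * ((-(Real.pi * ‖z‖ ^ 2) : ℝ) : ℂ) ^ k / (k.factorial : ℂ)

/-- The reproducing kernel `K^j(ζ, z) = e^{π z̄ ζ} Φ_{j,j}(ζ - z)` of the true polyanalytic
Fock space of order `j`. -/
def kernel (j : ℕ) (ζ z : ℂ) : ℂ :=
  Complex.exp ((Real.pi : ℂ) * conj z * ζ) * diagPhi j (ζ - z)

/-- The projection `P^j` onto the true polyanalytic Fock space of order `j`, as the integral
operator `(P^j σ)(ζ) = ∫ σ(z) K^j(ζ, z) dμ(z)`. On `L²(ℂ, dμ)` this is the orthogonal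
projection. -/
def proj (j : ℕ) (σ : ℂ → ℂ) (ζ : ℂ) : ℂ :=
  ∫ z, σ z * kernel j ζ z * gauss z

/-- `σ` lies in the common domain of all the `P^j`: every integral `(P^j σ)(ζ)` converges
absolutely. All of `L²(ℂ, dμ)` and all of `L^∞(ℂ)` satisfy this. -/
def InDomain (σ : ℂ → ℂ) : Prop :=
  ∀ (j : ℕ) (ζ : ℂ), Integrable (fun z => σ z * kernel j ζ z * gauss z)

/-- The weight `e^{a|z|^{1/α}} e^{-(π/2)|z|²}`. -/
def weight (a α : ℝ) (z : ℂ) : ℂ :=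
  (Real.exp (a * ‖z‖ ^ (1 / α)) * Real.exp (-(Real.pi / 2 * ‖z‖ ^ 2)) : ℝ)

/-- `e^{a|·|^{1/α}} e^{-(π/2)|·|²} P^j σ`. -/
def weighted (a α : ℝ) (j : ℕ) (σ : ℂ → ℂ) (z : ℂ) : ℂ :=
  weight a α z * proj j σ z

lemma proj_add (j : ℕ) {σ τ : ℂ → ℂ} (hσ : InDomain σ) (hτ : InDomain τ) :
    proj j (σ + τ) = proj j σ + proj j τ := by
  funext ζ
  simp only [proj, Pi.add_apply]
  rw [← integral_add (hσ j ζ) (hτ j ζ)]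
  congr 1
  funext z
  ring

lemma proj_smul (j : ℕ) (c : ℂ) (σ : ℂ → ℂ) : proj j (c • σ) = c • proj j σ := by
  funext ζ
  simp only [proj, Pi.smul_apply, smul_eq_mul]
  rw [← integral_const_mul]
  congr 1
  funext z
  ring

lemma weighted_add (a α : ℝ) (j : ℕ) {σ τ : ℂ → ℂ} (hσ : InDomain σ) (hτ : InDomain τ) :
    weighted a α j (σ + τ) = weighted a α j σ + weighted a α j τ := by
  funext z
  simp only [weighted, proj_add j hσ hτ, Pi.add_apply]
  ring

lemma weighted_smul (a α : ℝ) (j : ℕ) (c : ℂ) (σ : ℂ → ℂ) :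
    weighted a α j (c • σ) = c • weighted a α j σ := by
  funext z
  simp only [weighted, proj_smul, Pi.smul_apply, smul_eq_mul]
  ring

/-- The space `W^{p,n}_{a,α}`; the parameter `a` may be any real number, and both signs occur. -/
def W (p : ℝ≥0∞) (n : ℕ) (a α : ℝ) : Submodule ℂ (ℂ → ℂ) where
  carrier := {σ | InDomain σ ∧ ∀ j ≤ n, MemLp (weighted a α j σ) p}
  zero_mem' := by
    refine ⟨fun j ζ => by simp, fun j _ => ?_⟩
    have h : weighted a α j 0 = 0 := by
      funext z
      simp [weighted, proj]
    rw [h]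
    exact MemLp.zero
  add_mem' := by
    rintro σ τ ⟨hσ, hσ'⟩ ⟨hτ, hτ'⟩
    refine ⟨fun j ζ => ?_, fun j hj => ?_⟩
    · refine ((hσ j ζ).add (hτ j ζ)).congr (Filter.Eventually.of_forall fun z => ?_)
      simp only [Pi.add_apply]
      ring
    · rw [weighted_add a α j hσ hτ]
      exact (hσ' j hj).add (hτ' j hj)
  smul_mem' := by
    rintro c σ ⟨hσ, hσ'⟩
    refine ⟨fun j ζ => ?_, fun j hj => ?_⟩
    · refine ((hσ j ζ).const_mul c).congr (Filter.Eventually.of_forall fun z => ?_)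
      simp only [Pi.smul_apply, smul_eq_mul]
      ring
    · rw [weighted_smul]
      exact (hσ' j hj).const_smul c

lemma W_anti (p : ℝ≥0∞) (n : ℕ) (α : ℝ) {a b : ℝ} (hab : a ≤ b) : W p n b α ≤ W p n a α := by
  rintro σ ⟨hσ, h⟩
  refine ⟨hσ, fun j hj => ?_⟩
  have key : weighted a α j σ =
      fun z => ((Real.exp ((a - b) * ‖z‖ ^ (1 / α)) : ℝ) : ℂ) * weighted b α j σ z := by
    funext z
    simp only [weighted, weight]
    rw [← mul_assoc, ← Complex.ofReal_mul, ← mul_assoc, ← Real.exp_add, ← Real.exp_add,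
      ← Real.exp_add, sub_mul, sub_add_cancel]
  refine (h j hj).mono ?_ (Filter.Eventually.of_forall fun z => ?_)
  · rw [key]
    refine AEStronglyMeasurable.mul ?_ (h j hj).1
    exact (by fun_prop : Measurable
      fun z : ℂ => ((Real.exp ((a - b) * ‖z‖ ^ (1 / α)) : ℝ) : ℂ)).aestronglyMeasurable
  · rw [key]
    simp only [norm_mul, Complex.norm_real, Real.norm_eq_abs, Real.abs_exp]
    refine mul_le_of_le_one_left (norm_nonneg _) (Real.exp_le_one_iff.mpr ?_)
    exact mul_nonpos_of_nonpos_of_nonneg (by linarith) (by positivity)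

/-- The (semi)norm `∑_{j ≤ n} ‖e^{a|·|^{1/α}} e^{-(π/2)|·|²} P^j σ‖_{L^p}` on `W^{p,n}_{a,α}`. -/
def wSeminorm (p : ℝ≥0∞) [hp : Fact (1 ≤ p)] (n : ℕ) (a α : ℝ) : Seminorm ℂ (W p n a α) :=
  Seminorm.of
    (fun σ => ∑ j ∈ Finset.range (n + 1), (eLpNorm (weighted a α j σ.1) p volume).toReal)
    (by
      intro σ τ
      rw [← Finset.sum_add_distrib]
      refine Finset.sum_le_sum fun j hj => ?_
      have hj' : j ≤ n := Nat.lt_succ_iff.mp (Finset.mem_range.mp hj)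
      have h1 := σ.2.2 j hj'
      have h2 := τ.2.2 j hj'
      rw [Submodule.coe_add, weighted_add a α j σ.2.1 τ.2.1,
        ← ENNReal.toReal_add h1.2.ne h2.2.ne]
      exact ENNReal.toReal_mono (ENNReal.add_ne_top.mpr ⟨h1.2.ne, h2.2.ne⟩)
        (eLpNorm_add_le h1.1 h2.1 hp.out))
    (by
      intro c σ
      rw [Finset.mul_sum]
      refine Finset.sum_congr rfl fun j _ => ?_
      rw [Submodule.coe_smul, weighted_smul, eLpNorm_const_smul, ENNReal.toReal_mul]
      simp)

/-- The topology of `W^{p,n}_{a,α}`, given by its seminorm. -/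
abbrev wTopology (p : ℝ≥0∞) [Fact (1 ≤ p)] (n : ℕ) (a α : ℝ) : TopologicalSpace (W p n a α) :=
  SeminormFamily.moduleFilterBasis (𝕜 := ℂ) (fun _ : Unit => wSeminorm p n a α) |>.topology

/-- The space `G^{(α)}_n`, formed with the integrability exponent `q`:
`σ` belongs to `W^{q,n}_{a,α}` for every `a > 0`. -/
def GBeurling (q : ℝ≥0∞) (n : ℕ) (α : ℝ) : Submodule ℂ (ℂ → ℂ) where
  carrier := {σ | ∀ a : ℝ, 0 < a → σ ∈ W q n a α}
  zero_mem' := fun _ _ => Submodule.zero_mem _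
  add_mem' := fun hσ hτ a ha => Submodule.add_mem _ (hσ a ha) (hτ a ha)
  smul_mem' := fun c _ hσ a ha => Submodule.smul_mem _ c (hσ a ha)

/-- The space `G^{{α}}_n`, formed with the integrability exponent `q`:
`σ` belongs to `W^{q,n}_{a,α}` for some `a > 0`. -/
def GRoumieu (q : ℝ≥0∞) (n : ℕ) (α : ℝ) : Submodule ℂ (ℂ → ℂ) where
  carrier := {σ | ∃ a : ℝ, 0 < a ∧ σ ∈ W q n a α}
  zero_mem' := ⟨1, one_pos, Submodule.zero_mem _⟩
  add_mem' := by
    rintro σ τ ⟨a, ha, hσ⟩ ⟨b, hb, hτ⟩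
    exact ⟨min a b, lt_min ha hb, Submodule.add_mem _
      (W_anti q n α (min_le_left a b) hσ) (W_anti q n α (min_le_right a b) hτ)⟩
  smul_mem' := by
    rintro c σ ⟨a, ha, hσ⟩
    exact ⟨a, ha, Submodule.smul_mem _ c hσ⟩

lemma GBeurling_le (q : ℝ≥0∞) (n : ℕ) (α : ℝ) {a : ℝ} (ha : 0 < a) :
    GBeurling q n α ≤ W q n a α := fun _ hσ => hσ a ha

lemma le_GRoumieu (q : ℝ≥0∞) (n : ℕ) (α : ℝ) {a : ℝ} (ha : 0 < a) :
    W q n a α ≤ GRoumieu q n α := fun _ hσ => ⟨a, ha, hσ⟩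

/-- Projective limit topology on `G^{(α)}_n`: the coarsest topology for which all the inclusions
into the spaces `W^{q,n}_{a,α}`, `a > 0`, are continuous. -/
abbrev beurlingTopology (q : ℝ≥0∞) [Fact (1 ≤ q)] (n : ℕ) (α : ℝ) :
    TopologicalSpace (GBeurling q n α) :=
  ⨅ a : {a : ℝ // 0 < a},
    (wTopology q n a α).induced (Submodule.inclusion (GBeurling_le q n α a.2))

/-- Inductive limit topology on `G^{{α}}_n`: the finest locally convex vector space topology for
which all the inclusions of the spaces `W^{q,n}_{a,α}`, `a > 0`, are continuous. (In Mathlib's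
order on topologies, finer means smaller.) -/
abbrev roumieuTopology (q : ℝ≥0∞) [Fact (1 ≤ q)] (n : ℕ) (α : ℝ) :
    TopologicalSpace (GRoumieu q n α) :=
  sInf {t | @IsTopologicalAddGroup _ t _ ∧ @ContinuousSMul ℂ _ _ _ t ∧
    @LocallyConvexSpace ℝ (GRoumieu q n α) _ _ _ _ t ∧
    ∀ (a : ℝ) (ha : 0 < a),
      Continuous[wTopology q n a α, t] (Submodule.inclusion (le_GRoumieu q n α ha))}

/-- The topological dual `G^{(α)'}_n`. -/
def beurlingDual (q : ℝ≥0∞) [Fact (1 ≤ q)] (n : ℕ) (α : ℝ) :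
    Set (GBeurling q n α →ₗ[ℂ] ℂ) :=
  {u | Continuous[beurlingTopology q n α, inferInstance] u}

/-- The topological dual `G^{{α}'}_n`. -/
def roumieuDual (q : ℝ≥0∞) [Fact (1 ≤ q)] (n : ℕ) (α : ℝ) :
    Set (GRoumieu q n α →ₗ[ℂ] ℂ) :=
  {u | Continuous[roumieuTopology q n α, inferInstance] u}

/-- The functional `u` on `S` is given by the function `F` through the pairing
`⟨σ, F⟩ = ∑_{j ≤ n} ∫ (P^j σ)(z) \overline{(P^j F)(z)} dμ(z)`, all integrals being absolutely
convergent. -/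
def Represents (n : ℕ) {S : Submodule ℂ (ℂ → ℂ)} (F : ℂ → ℂ) (u : S →ₗ[ℂ] ℂ) : Prop :=
  ∀ σ : S,
    (∀ j ≤ n, Integrable (fun z => proj j σ.1 z * conj (proj j F z) * gauss z)) ∧
    u σ = ∑ j ∈ Finset.range (n + 1), ∫ z, proj j σ.1 z * conj (proj j F z) * gauss z

/-- The Cauchy-Riemann operator `∂_{z̄} = (∂_x + i ∂_ω) / 2`, where `z = x + i ω`. -/
def dbar (F : ℂ → ℂ) (z : ℂ) : ℂ :=
  (fderiv ℝ F z 1 + Complex.I * fderiv ℝ F z Complex.I) / 2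

/-- `F` is smooth and `(∂_{z̄})^N F = 0` on all of `ℂ`. -/
def IsPolyanalytic (N : ℕ) (F : ℂ → ℂ) : Prop :=
  ContDiff ℝ ∞ F ∧ ∀ z, (dbar^[N] F) z = 0

end PolyFock

end

namespace PolyFock

/-! ### Binomial identities and Laguerre polynomials -/

/-! The proof rests on a mean value property. If `G = P^j σ`, then averaging `G(ζ + w) e^{-π ζ̄ w}`
over rotations of `w` gives `L_j(π|w|²) G(ζ)`. For the kernels `K^j(·, z)` this is a product formula
for Laguerre polynomials (`meanValue_kernel`). Fubini carries it to every `σ` in the domain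
(`ExpInt.meanValue_proj`), so no L² theory of the projections is needed.

Integrating the property against radial functions (`MeanValue.integral_radial`) has two
consequences. Orthonormality of the Laguerre polynomials gives `P^k P^j σ = δ_{jk} P^j σ` whenever
the integral converges (`MeanValue.proj_eq`). A cut-off to the unit disc bounds `|G(ζ)|
e^{-π|ζ|²/2}` by a local L¹ norm (`MeanValue.norm_mul_hgauss_le`). The weights are moderate under
unit translations and `e^{-δ|z|^{1/α}}` lies in every L^q. Hence weighted L^q and L^p bounds are
interchangeable at the price of enlarging `a` (`W_le_pos`), and the pairing of `W_{6a}` with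
`W_{-a}` is absolutely convergent and continuous (`pairing_bound`).

To represent a functional, bound it by a weighted L² norm. Hahn–Banach and Riesz then give functions
`g_j` in L² acting on the weighted components. Since `P^j σ` reproduces itself, Fubini moves the
projection onto the other factor: `g_j` with its weight removed is replaced by its image `F_j` under
`P^j` (`integral_pairing_unweight`). The sum of the `F_j` is polyanalytic and has components `F_j`
(`exists_representing`). This needs `e^{b|z|^{1/α}}` to be dominated by `e^{π|z|²/2}`, which is the
condition `Good`: it holds for all `b` if `α > 1/2`, and for small `b` if `α = 1/2`.

Uniqueness comes from testing on reproducing kernels, which recovers `P^j F` pointwise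
(`apply_kernel_of_represents`); a polyanalytic function is determined by its components
(`IsPolyanalytic.eq_zero`). In the Roumieu case uniqueness also shows that the representatives found
for different `a` coincide. For `α = 1/2` all components of elements of the Beurling space vanish
(`MeanValue.eq_zero`), so its dual is trivial and the zero function represents it. -/

/-- Binomial inversion: `C(k,b) C(b,i) = C(k,i) C(k-i,b-i)` reduces the sum to an alternating row
sum. It is the source of Laguerre orthogonality below. -/
lemma sum_neg_one_pow_choose_mul_choose (k i : ℕ) :
    ∑ b ∈ Finset.range (k + 1), (-1 : ℝ) ^ b * k.choose b * b.choose i =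
      if i = k then (-1) ^ k else 0 := by
  rcases lt_or_ge k i with h | h
  · rw [if_neg h.ne']
    refine Finset.sum_eq_zero fun b hb => ?_
    rw [Nat.choose_eq_zero_of_lt (by simp at hb; omega : b < i)]
    simp
  · obtain ⟨d, rfl⟩ := Nat.exists_eq_add_of_le h
    have h1 : ∑ b ∈ Finset.range (i + (d + 1)),
        (-1 : ℝ) ^ b * (i + d).choose b * b.choose i =
        ∑ m ∈ Finset.range (d + 1), ((i + d).choose i * (-1 : ℝ) ^ i) *
          ((-1) ^ m * d.choose m) := by
      rw [Finset.sum_range_add, Finset.sum_eq_zero, zero_add]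
      · refine Finset.sum_congr rfl fun m hm => ?_
        have := Nat.choose_mul (n := i + d) (k := i + m) (s := i) (by omega)
        simp only [Nat.add_sub_cancel_left] at this
        rw [mul_assoc, ← Nat.cast_mul, this, pow_add]
        push_cast
        ring
      · intro b hb
        rw [Nat.choose_eq_zero_of_lt (by simpa using hb : b < i)]
        simp
    rw [show i + d + 1 = i + (d + 1) by ring, h1, ← Finset.mul_sum]
    have h2 := Int.alternating_sum_range_choose (n := d)
    have h3 : ∑ m ∈ Finset.range (d + 1), (-1 : ℝ) ^ m * d.choose m = if d = 0 then 1 else 0 := by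
      exact_mod_cast congrArg (Int.cast : ℤ → ℝ) h2
    rw [h3]
    rcases eq_or_ne d 0 with rfl | hd
    · simp
    · simp [hd]

lemma choose_add_eq_sum (a b : ℕ) :
    (a + b).choose a = ∑ i ∈ Finset.range (a + 1), a.choose i * b.choose i := by
  rw [add_comm a b, Nat.add_choose_eq, Finset.Nat.sum_antidiagonal_eq_sum_range_succ
    (fun x y => b.choose x * a.choose y)]
  refine Finset.sum_congr rfl fun i hi => ?_
  rw [Nat.choose_symm (by simp at hi; omega), mul_comm]

/-- Both sides count pairs of subsets of sizes `b` and `c` in a `j`-set, the right side by the size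
`k` of the union. The proof applies Vandermonde to `C(j,c)` and sets `k = b + i`. -/
lemma choose_mul_choose_eq_sum (j b c : ℕ) (hb : b ≤ j) :
    j.choose c * j.choose b = ∑ k ∈ Finset.range (j + 1),
      if c ≤ k ∧ b ≤ k ∧ k ≤ b + c then j.choose k * k.choose b * b.choose (k - c) else 0 := by
  have h1 : j.choose c = ∑ i ∈ Finset.range (c + 1), (j - b).choose i * b.choose (c - i) := by
    conv_lhs => rw [← Nat.sub_add_cancel hb, Nat.add_choose_eq]
    rw [Finset.Nat.sum_antidiagonal_eq_sum_range_succ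
      (fun x y => (j - b).choose x * b.choose y)]
  have h2 : ∑ k ∈ Finset.range (j + 1),
      (if c ≤ k ∧ b ≤ k ∧ k ≤ b + c then j.choose k * k.choose b * b.choose (k - c) else 0) =
      ∑ k ∈ Finset.range (b + (c + 1 + j)),
      (if c ≤ k ∧ b ≤ k ∧ k ≤ b + c then j.choose k * k.choose b * b.choose (k - c) else 0) := by
    refine Finset.sum_subset (Finset.range_mono (by omega)) fun k _ hk => ?_
    rw [Nat.choose_eq_zero_of_lt (by simp at hk; omega : j < k)]
    simp
  rw [h2, Finset.sum_range_add, Finset.sum_eq_zero, zero_add, Finset.sum_range_add]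
  · rw [Finset.sum_eq_zero (s := Finset.range j), add_zero, h1, Finset.sum_mul]
    · refine Finset.sum_congr rfl fun i hi => ?_
      have hi' : i ≤ c := by simp at hi; omega
      have := Nat.choose_mul (n := j) (k := b + i) (s := b) (by omega)
      simp only [Nat.add_sub_cancel_left] at this
      rw [this]
      split_ifs with h
      · have : b.choose (c - i) = b.choose (b + i - c) := by
          rw [← Nat.choose_symm (by omega : c - i ≤ b)]
          congr 1; omega
        rw [this]; ring
      · have : b < c - i := by omega
        rw [Nat.choose_eq_zero_of_lt this]; simp
    · intro i _
      rw [if_neg (by omega)]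
  · intro k hk
    rw [if_neg (by simp at hk; omega)]

/-- The Laguerre polynomial `L_j`. -/
noncomputable def lag (j : ℕ) (x : ℝ) : ℝ :=
  ∑ k ∈ Finset.range (j + 1), (j.choose k : ℝ) * (-x) ^ k / (k.factorial : ℝ)

lemma diagPhi_eq (j : ℕ) (z : ℂ) : diagPhi j z = (lag j (Real.pi * ‖z‖ ^ 2) : ℝ) := by
  simp [diagPhi, lag]

lemma lag_zero (j : ℕ) : lag j 0 = 1 := by
  rw [lag, Finset.sum_eq_single 0]
  · simp
  · intro b _ hb; simp [hb]
  · simp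

lemma continuous_lag (j : ℕ) : Continuous (lag j) := by
  unfold lag; fun_prop

/-- The left side is the form in which the rotation average in `integral_cis_exp_mul_phi` comes out.
Comparing coefficients of `A^c B^b` leaves the identity `choose_mul_choose_eq_sum`. -/
lemma lag_mul_lag (j : ℕ) (A B : ℝ) :
    ∑ k ∈ Finset.range (j + 1), (j.choose k : ℝ) * (-1) ^ k / k.factorial *
      ∑ c ∈ Finset.range (k + 1), ∑ b ∈ Finset.range (k + 1),
        (if k ≤ b + c then (k.choose c : ℝ) * k.choose b * ((-1) ^ (b + c - k) /
          (b + c - k).factorial) * (A ^ c * B ^ b) else 0) = lag j A * lag j B := by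
  have key : ∀ b c, b ≤ j → ∑ k ∈ Finset.range (j + 1), ((j.choose k : ℝ) * (-1) ^ k / k.factorial *
      (if k ≤ b + c then (k.choose c : ℝ) * k.choose b * ((-1) ^ (b + c - k) /
          (b + c - k).factorial) * (A ^ c * B ^ b) else 0)) =
      (j.choose c : ℝ) * (-A) ^ c / c.factorial * ((j.choose b : ℝ) * (-B) ^ b / b.factorial) := by
    intro b c hb
    have h := congrArg (Nat.cast : ℕ → ℝ) (choose_mul_choose_eq_sum j b c hb)
    push_cast at h
    have : (j.choose c : ℝ) * (-A) ^ c / c.factorial * ((j.choose b : ℝ) * (-B) ^ b / b.factorial)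
      = (j.choose c * j.choose b : ℝ) *
        ((-1) ^ (b + c) * A ^ c * B ^ b / (b.factorial * c.factorial)) := by
      rw [neg_pow A, neg_pow B, pow_add]; field_simp
    rw [this, h, Finset.sum_mul]
    refine Finset.sum_congr rfl fun k _ => ?_
    by_cases h1 : c ≤ k ∧ b ≤ k ∧ k ≤ b + c
    · obtain ⟨hc, hb', hk⟩ := h1
      rw [if_pos hk, if_pos ⟨hc, hb', hk⟩, Nat.cast_choose ℝ hc,
        Nat.cast_choose ℝ (by omega : k - c ≤ b)]
      have e1 : b - (k - c) = b + c - k := by omega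
      have e2 : (-1 : ℝ) ^ (b + c) = (-1) ^ k * (-1) ^ (b + c - k) := by
        rw [← pow_add]; congr 1; omega
      rw [e1, e2]
      field_simp
    · rw [if_neg h1]
      by_cases hk : k ≤ b + c
      · rw [if_pos hk]
        have : k < c ∨ k < b := by omega
        rcases this with h2 | h2 <;> simp [Nat.choose_eq_zero_of_lt h2]
      · rw [if_neg hk]; simp
  -- The inner ranges are made independent of `k` so that the sums can be exchanged; the new terms
  -- contain a vanishing binomial.
  have ext : ∀ k ∈ Finset.range (j + 1), ∑ c ∈ Finset.range (k + 1), ∑ b ∈ Finset.range (k + 1),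
        (if k ≤ b + c then (k.choose c : ℝ) * k.choose b * ((-1) ^ (b + c - k) /
          (b + c - k).factorial) * (A ^ c * B ^ b) else 0) =
      ∑ c ∈ Finset.range (j + 1), ∑ b ∈ Finset.range (j + 1),
        (if k ≤ b + c then (k.choose c : ℝ) * k.choose b * ((-1) ^ (b + c - k) /
          (b + c - k).factorial) * (A ^ c * B ^ b) else 0) := by
    intro k hk
    have hk' : k ≤ j := by simp at hk; omega
    rw [Finset.sum_subset (Finset.range_mono (by omega : k + 1 ≤ j + 1))]
    · refine Finset.sum_congr rfl fun c _ => ?_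
      refine Finset.sum_subset (Finset.range_mono (by omega : k + 1 ≤ j + 1)) fun b _ hb => ?_
      rw [Nat.choose_eq_zero_of_lt (by simp at hb; omega : k < b)]; simp
    · intro c _ hc
      rw [Nat.choose_eq_zero_of_lt (by simp at hc; omega : k < c)]; simp
  rw [Finset.sum_congr rfl fun k hk => by rw [ext k hk]]
  simp_rw [Finset.mul_sum]
  rw [Finset.sum_comm]
  unfold lag
  rw [Finset.sum_mul_sum]
  refine Finset.sum_congr rfl fun c _ => ?_
  rw [Finset.sum_comm]
  exact Finset.sum_congr rfl fun b hb => key b c (by simp at hb; omega)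

/-! ### Gaussian moments and orthogonality -/

/-- The real Gaussian density. -/
noncomputable def rgauss (z : ℂ) : ℝ := Real.exp (-(Real.pi * ‖z‖ ^ 2))

lemma gauss_eq (z : ℂ) : gauss z = (rgauss z : ℂ) := rfl

lemma rgauss_pos (z : ℂ) : 0 < rgauss z := Real.exp_pos _

lemma continuous_rgauss : Continuous rgauss := by unfold rgauss; fun_prop

lemma continuous_gauss : Continuous gauss := by
  unfold gauss; fun_prop

lemma integral_pow_mul_rgauss (m : ℕ) :
    ∫ z : ℂ, (Real.pi * ‖z‖ ^ 2) ^ m * rgauss z = m.factorial := by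
  have h := Complex.integral_rpow_mul_exp_neg_mul_rpow (p := 2) (q := 2 * m) (b := Real.pi)
    (by norm_num) (by linarith [(Nat.cast_nonneg m : (0 : ℝ) ≤ m)]) Real.pi_pos
  have h2 : ∀ z : ℂ, (Real.pi * ‖z‖ ^ 2) ^ m * rgauss z =
      Real.pi ^ m * (‖z‖ ^ (2 * m : ℝ) * Real.exp (-Real.pi * ‖z‖ ^ (2 : ℝ))) := by
    intro z
    rw [rgauss, Real.rpow_mul (norm_nonneg _), Real.rpow_natCast, Real.rpow_two, mul_pow]
    ring_nf
  simp_rw [h2]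
  rw [integral_const_mul, h]
  have e : -(2 * (m : ℝ) + 2) / 2 = -((m + 1 : ℕ) : ℝ) := by push_cast; ring
  have e2 : (2 * (m : ℝ) + 2) / 2 = m + 1 := by ring
  rw [e, e2, Real.Gamma_nat_eq_factorial, Real.rpow_neg Real.pi_pos.le, Real.rpow_natCast]
  field_simp
  rw [pow_succ]

/-- A non-integrable function has Bochner integral 0, whereas this integral is `m! ≠ 0`. -/
lemma integrable_pow_mul_rgauss (m : ℕ) :
    Integrable fun z : ℂ => (Real.pi * ‖z‖ ^ 2) ^ m * rgauss z := by
  by_contra h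
  have := integral_undef h
  rw [integral_pow_mul_rgauss] at this
  exact (Nat.cast_ne_zero.mpr m.factorial_ne_zero) this

/-- The function `L_j(π|z|²)`. -/
noncomputable def phi (j : ℕ) (z : ℂ) : ℝ := lag j (Real.pi * ‖z‖ ^ 2)

lemma continuous_phi (j : ℕ) : Continuous (phi j) := by
  unfold phi; exact (continuous_lag j).comp (by fun_prop)

lemma phi_zero (j : ℕ) : phi j 0 = 1 := by simp [phi, lag_zero]

lemma diagPhi_eq_phi (j : ℕ) (z : ℂ) : diagPhi j z = (phi j z : ℂ) := diagPhi_eq j z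

/-- Each moment is `(m+b)! = m! b! C(m+b,m)`; Vandermonde splits the binomial and binomial inversion
leaves one term. The value vanishes for `m < k`, which is orthogonality to lower degrees. -/
lemma integral_pow_mul_phi (m k : ℕ) :
    Integrable (fun z : ℂ => (Real.pi * ‖z‖ ^ 2) ^ m * phi k z * rgauss z) ∧
    ∫ z : ℂ, (Real.pi * ‖z‖ ^ 2) ^ m * phi k z * rgauss z =
      m.factorial * ((-1) ^ k * m.choose k) := by
  have e : ∀ z : ℂ, (Real.pi * ‖z‖ ^ 2) ^ m * phi k z * rgauss z =
      ∑ b ∈ Finset.range (k + 1), ((k.choose b : ℝ) * (-1) ^ b / b.factorial) *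
        ((Real.pi * ‖z‖ ^ 2) ^ (m + b) * rgauss z) := by
    intro z
    rw [phi, lag, Finset.mul_sum, Finset.sum_mul]
    refine Finset.sum_congr rfl fun b _ => ?_
    rw [neg_pow, pow_add]; ring
  simp_rw [e]
  refine ⟨integrable_finsetSum _ fun b _ => (integrable_pow_mul_rgauss _).const_mul _, ?_⟩
  rw [integral_finsetSum _ fun b _ => (integrable_pow_mul_rgauss _).const_mul _]
  simp_rw [integral_const_mul, integral_pow_mul_rgauss]
  have h1 : ∀ b : ℕ, ((k.choose b : ℝ) * (-1) ^ b / b.factorial) * ((m + b).factorial : ℝ) =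
      ∑ i ∈ Finset.range (m + 1), (m.factorial * m.choose i : ℝ) *
        ((-1) ^ b * k.choose b * b.choose i) := by
    intro b
    have h2 : (((m + b).choose m : ℕ) : ℝ) = ((m + b).factorial : ℝ) /
        (m.factorial * b.factorial) := by
      rw [Nat.cast_add_choose]
    rw [choose_add_eq_sum] at h2
    push_cast at h2
    have h3 : ((m + b).factorial : ℝ) = m.factorial * b.factorial *
        ∑ i ∈ Finset.range (m + 1), (m.choose i * b.choose i : ℝ) := by
      rw [h2]; field_simp
    rw [h3, Finset.mul_sum, Finset.mul_sum]
    refine Finset.sum_congr rfl fun i _ => ?_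
    field_simp
  simp_rw [h1]
  rw [Finset.sum_comm]
  simp_rw [← Finset.mul_sum, sum_neg_one_pow_choose_mul_choose]
  by_cases hk : k ≤ m
  · rw [Finset.sum_eq_single k]
    · simp; ring
    · intro b _ hb; simp [hb]
    · intro h; simp at h; omega
  · rw [Finset.sum_eq_zero, Nat.choose_eq_zero_of_lt (by omega)]
    · simp
    · intro i hi
      rw [if_neg (by simp at hi; omega)]; simp

lemma integral_phi_mul_phi (j k : ℕ) :
    Integrable (fun z : ℂ => phi j z * phi k z * rgauss z) ∧
    ∫ z : ℂ, phi j z * phi k z * rgauss z = if j = k then 1 else 0 := by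
  have e : ∀ z : ℂ, phi j z * phi k z * rgauss z =
      ∑ a ∈ Finset.range (j + 1), ((j.choose a : ℝ) * (-1) ^ a / a.factorial) *
        ((Real.pi * ‖z‖ ^ 2) ^ a * phi k z * rgauss z) := by
    intro z
    conv_lhs => rw [phi, lag]
    rw [Finset.sum_mul, Finset.sum_mul]
    refine Finset.sum_congr rfl fun b _ => ?_
    rw [neg_pow]; ring
  simp_rw [e]
  refine ⟨integrable_finsetSum _ fun b _ => (integral_pow_mul_phi _ _).1.const_mul _, ?_⟩
  rw [integral_finsetSum _ fun b _ => (integral_pow_mul_phi _ _).1.const_mul _]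
  simp_rw [integral_const_mul, (integral_pow_mul_phi _ _).2]
  have h1 : ∀ a : ℕ, ((j.choose a : ℝ) * (-1) ^ a / a.factorial) *
      (a.factorial * ((-1) ^ k * a.choose k)) =
      (-1) ^ k * ((-1) ^ a * j.choose a * a.choose k) := by
    intro a; field_simp
  simp_rw [h1]
  rw [← Finset.mul_sum, sum_neg_one_pow_choose_mul_choose]
  rcases eq_or_ne j k with rfl | h
  · simp [← mul_pow]
  · simp [h, h.symm]

/-! ### Averages over rotations -/

/-- The unimodular number `e^{iθ}`. -/
noncomputable def cis (θ : ℝ) : ℂ := Complex.exp (θ * Complex.I)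

lemma norm_cis (θ : ℝ) : ‖cis θ‖ = 1 := Complex.norm_exp_ofReal_mul_I θ

lemma continuous_cis : Continuous cis := by unfold cis; fun_prop

lemma norm_cis_mul (θ : ℝ) (w : ℂ) : ‖cis θ * w‖ = ‖w‖ := by simp [norm_cis]

lemma integral_cis_pow (m i : ℕ) :
    ∫ θ in (0 : ℝ)..(2 * Real.pi), cis θ ^ m * conj (cis θ) ^ i =
      if m = i then (2 * Real.pi : ℂ) else 0 := by
  have e : ∀ θ : ℝ, cis θ ^ m * conj (cis θ) ^ i =
      Complex.exp ((((m : ℂ) - i) * Complex.I) * θ) := by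
    intro θ
    rw [cis, ← Complex.exp_conj, ← Complex.exp_nat_mul, ← Complex.exp_nat_mul, ← Complex.exp_add]
    congr 1
    simp
    ring
  simp_rw [e]
  by_cases h : m = i
  · subst h; simp
  · have h' : ((m : ℂ) - i) ≠ 0 := sub_ne_zero.mpr (by exact_mod_cast h)
    rw [integral_exp_mul_complex (mul_ne_zero h' Complex.I_ne_zero), if_neg h]
    have : Complex.exp ((((m : ℂ) - i) * Complex.I) * ((2 * Real.pi : ℝ) : ℂ)) = 1 := by
      rw [show (((m : ℂ) - i) * Complex.I) * ((2 * Real.pi : ℝ) : ℂ) =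
        ((m - i : ℤ) : ℂ) * (2 * Real.pi * Complex.I) by push_cast; ring]
      exact Complex.exp_int_mul_two_pi_mul_I _
    rw [this]; simp

/-- Rotation averages kill every monomial of the power series except the one of degree `i`. Termwise
integration is allowed because the series converges absolutely on the circle of radius `‖w‖`. -/
lemma integral_cis_hasSum {c : ℕ → ℂ} {g : ℂ → ℂ} (hg : ∀ z, HasSum (fun m => c m * z ^ m) (g z))
    (i : ℕ) (w : ℂ) :
    ∫ θ in (0 : ℝ)..(2 * Real.pi), conj (cis θ * w) ^ i * g (cis θ * w) =
      2 * Real.pi * ((‖w‖ : ℂ) ^ 2) ^ i * c i := by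
  have h1 := intervalIntegral.hasSum_integral_of_dominated_convergence (a := 0)
    (b := 2 * Real.pi) (μ := volume)
    (F := fun m θ => conj (cis θ * w) ^ i * (c m * (cis θ * w) ^ m))
    (f := fun θ => conj (cis θ * w) ^ i * g (cis θ * w))
    (fun m _ => ‖w‖ ^ i * ‖c m * w ^ m‖)
    (fun m => by
      have := continuous_cis
      exact Continuous.aestronglyMeasurable (by fun_prop))
    (fun m => Filter.Eventually.of_forall fun θ _ => by
      simp [norm_cis])
    (Filter.Eventually.of_forall fun θ _ => ((hg w).summable.norm).mul_left _)
    intervalIntegrable_const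
    (Filter.Eventually.of_forall fun θ _ => (hg _).mul_left _)
  have h2 : ∀ m, ∫ θ in (0 : ℝ)..(2 * Real.pi), conj (cis θ * w) ^ i * (c m * (cis θ * w) ^ m) =
      if m = i then 2 * Real.pi * ((‖w‖ : ℂ) ^ 2) ^ i * c i else 0 := by
    intro m
    have : ∀ θ, conj (cis θ * w) ^ i * (c m * (cis θ * w) ^ m) =
        (conj w ^ i * c m * w ^ m) * (cis θ ^ m * conj (cis θ) ^ i) := by
      intro θ; rw [map_mul]; ring
    simp_rw [this]
    rw [intervalIntegral.integral_const_mul, integral_cis_pow]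
    split_ifs with h
    · subst h
      rw [← Complex.conj_mul' w]; ring
    · simp
  simp_rw [h2] at h1
  exact h1.unique (hasSum_ite_eq i _)

lemma hasSum_pow_mul_exp (a : ℕ) (c z : ℂ) :
    HasSum (fun m => (if a ≤ m then c ^ (m - a) / ((m - a).factorial : ℂ) else 0) * z ^ m)
      (z ^ a * Complex.exp (c * z)) := by
  have h1 : HasSum (fun m => z ^ a * ((c * z) ^ m / (m.factorial : ℂ)))
      (z ^ a * Complex.exp (c * z)) := by
    refine HasSum.mul_left _ ?_
    rw [Complex.exp_eq_exp_ℂ]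
    exact NormedSpace.expSeries_div_hasSum_exp _
  have h2 : Function.Injective (fun m : ℕ => m + a) := add_left_injective a
  rw [← h2.hasSum_iff]
  · convert h1 using 2 with m
    simp only [Function.comp, Nat.le_add_left, if_true, Nat.add_sub_cancel]
    rw [pow_add, mul_pow]; ring
  · intro m hm
    have : ¬ a ≤ m := fun h => hm ⟨m - a, by simp; omega⟩
    simp [this]

lemma integral_cis_pow_mul_exp (a b : ℕ) (c w : ℂ) :
    ∫ θ in (0 : ℝ)..(2 * Real.pi),
      conj (cis θ * w) ^ b * ((cis θ * w) ^ a * Complex.exp (c * (cis θ * w))) =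
      2 * Real.pi * ((‖w‖ : ℂ) ^ 2) ^ b *
        (if a ≤ b then c ^ (b - a) / ((b - a).factorial : ℂ) else 0) :=
  integral_cis_hasSum (g := fun z => z ^ a * Complex.exp (c * z)) (hasSum_pow_mul_exp a c) b w

/-- The product formula for Laguerre polynomials, in the twisted form. -/
lemma integral_cis_exp_mul_phi (j : ℕ) (u w : ℂ) :
    ∫ θ in (0 : ℝ)..(2 * Real.pi),
      Complex.exp (-Real.pi * conj u * (cis θ * w)) * (phi j (u + cis θ * w) : ℂ) =
      2 * Real.pi * (phi j u * phi j w : ℝ) := by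
  -- Writing `|u+v|² = (u+v)(ū+v̄)` and expanding both factors gives terms `v̄^b v^{k-c} e^{-π ū
  -- v}`, whose averages are single Taylor coefficients.
  have e : ∀ v : ℂ, Complex.exp (-Real.pi * conj u * v) * (phi j (u + v) : ℂ) =
      ∑ k ∈ Finset.range (j + 1), ∑ c ∈ Finset.range (k + 1), ∑ b ∈ Finset.range (k + 1),
        ((j.choose k : ℂ) * (-1) ^ k / k.factorial * Real.pi ^ k * k.choose c * k.choose b *
          u ^ c * conj u ^ (k - b)) *
        (conj v ^ b * (v ^ (k - c) * Complex.exp (-Real.pi * conj u * v))) := by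
    intro v
    rw [phi, lag]
    push_cast
    rw [Finset.mul_sum]
    refine Finset.sum_congr rfl fun k _ => ?_
    have h1 : (-((Real.pi : ℂ) * (‖u + v‖ : ℂ) ^ 2)) ^ k =
        (-1) ^ k * Real.pi ^ k * ((u + v) ^ k * (conj v + conj u) ^ k) := by
      rw [← Complex.conj_mul', map_add, ← mul_pow, ← mul_pow, ← mul_pow]
      congr 1; ring
    rw [h1, add_pow, add_pow, Finset.sum_mul_sum]
    simp only [Finset.mul_sum, Finset.sum_div]
    refine Finset.sum_congr rfl fun c _ => Finset.sum_congr rfl fun b _ => ?_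
    ring
  have hc := continuous_cis
  simp_rw [e]
  rw [intervalIntegral.integral_finsetSum
    fun k _ => Continuous.intervalIntegrable (by fun_prop) _ _]
  rw [phi, phi, ← lag_mul_lag]
  push_cast
  rw [Finset.mul_sum]
  refine Finset.sum_congr rfl fun k _ => ?_
  rw [intervalIntegral.integral_finsetSum
    fun k _ => Continuous.intervalIntegrable (by fun_prop) _ _, Finset.mul_sum, Finset.mul_sum]
  refine Finset.sum_congr rfl fun c hc' => ?_
  rw [intervalIntegral.integral_finsetSum
    fun k _ => Continuous.intervalIntegrable (by fun_prop) _ _, Finset.mul_sum, Finset.mul_sum]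
  refine Finset.sum_congr rfl fun b hb' => ?_
  rw [intervalIntegral.integral_const_mul, integral_cis_pow_mul_exp]
  have hcb : c ≤ k ∧ b ≤ k := by simp at hc' hb'; omega
  -- The Taylor coefficient of order `b` of `v^{k-c} e^{-π ū v}` vanishes when `b < k - c`.
  by_cases h : k ≤ b + c
  · rw [if_pos h, if_pos (by omega)]
    obtain ⟨d, hd⟩ := Nat.exists_eq_add_of_le h
    have e1 : b - (k - c) = d := by omega
    have e2 : b + c - k = d := by omega
    have e3 : conj u ^ c = conj u ^ (k - b) * conj u ^ d := by
      rw [← pow_add]; congr 1; omega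
    have e4 : (Real.pi : ℂ) ^ b * Real.pi ^ c = Real.pi ^ k * Real.pi ^ d := by
      rw [← pow_add, ← pow_add, hd]
    have e5 : ((Real.pi : ℂ) * (‖u‖ : ℂ) ^ 2) ^ c * ((Real.pi : ℂ) * (‖w‖ : ℂ) ^ 2) ^ b =
        Real.pi ^ k * Real.pi ^ d * (conj u ^ (k - b) * conj u ^ d * u ^ c) *
          ((‖w‖ : ℂ) ^ 2) ^ b := by
      rw [mul_pow, mul_pow, ← e4, ← e3, ← mul_pow (conj u), Complex.conj_mul']; ring
    rw [e1, e2]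
    push_cast
    rw [e5]
    have e6 : (-(Real.pi : ℂ) * conj u) ^ d = (-1) ^ d * Real.pi ^ d * conj u ^ d := by
      rw [← mul_pow, ← mul_pow]; congr 1; ring
    rw [e6]
    ring
  · rw [if_neg h, if_neg (by omega)]
    simp

/-- The mean value property which characterizes the functions `P^j σ`. -/
def MeanValue (j : ℕ) (G : ℂ → ℂ) : Prop :=
  Continuous G ∧ ∀ ζ w : ℂ, ∫ θ in (0 : ℝ)..(2 * Real.pi),
    G (ζ + cis θ * w) * Complex.exp (-Real.pi * conj ζ * (cis θ * w)) =
      2 * Real.pi * phi j w * G ζ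

lemma continuous_diagPhi (j : ℕ) : Continuous (diagPhi j) := by
  have : diagPhi j = fun z => (phi j z : ℂ) := funext (diagPhi_eq_phi j)
  rw [this]
  exact Complex.continuous_ofReal.comp (continuous_phi j)

lemma continuous_kernel (j : ℕ) : Continuous fun p : ℂ × ℂ => kernel j p.1 p.2 := by
  unfold kernel
  have := continuous_diagPhi j
  have h2 : Continuous fun p : ℂ × ℂ => diagPhi j (p.1 - p.2) := this.comp (by fun_prop)
  have h3 : Continuous fun p : ℂ × ℂ => Complex.exp ((Real.pi : ℂ) * conj p.2 * p.1) := by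
    fun_prop
  exact h3.mul h2

lemma kernel_conj (j : ℕ) (ζ z : ℂ) : conj (kernel j ζ z) = kernel j z ζ := by
  have : ‖ζ - z‖ = ‖z - ζ‖ := norm_sub_rev _ _
  rw [kernel, kernel, map_mul, diagPhi_eq_phi, diagPhi_eq_phi, Complex.conj_ofReal,
    ← Complex.exp_conj, phi, phi, this]
  simp
  left; ring_nf

/-- After the factor `e^{π z̄ ζ}` is pulled out, this is the twisted product formula with `u = ζ -
z`. -/
lemma meanValue_kernel (j : ℕ) (z : ℂ) : MeanValue j fun ζ => kernel j ζ z := by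
  refine ⟨(continuous_kernel j).comp (by fun_prop : Continuous fun ζ : ℂ => (ζ, z)), fun ζ w => ?_⟩
  have e : ∀ v : ℂ, kernel j (ζ + v) z * Complex.exp (-Real.pi * conj ζ * v) =
      Complex.exp (Real.pi * conj z * ζ) *
        (Complex.exp (-Real.pi * conj (ζ - z) * v) * (phi j (ζ - z + v) : ℂ)) := by
    intro v
    rw [kernel, diagPhi_eq_phi, ← mul_assoc, ← Complex.exp_add, mul_right_comm, ← Complex.exp_add]
    congr 2
    · simp; ring
    · ring_nf
  simp_rw [e]
  rw [intervalIntegral.integral_const_mul, integral_cis_exp_mul_phi, kernel, diagPhi_eq_phi]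
  push_cast
  ring

/-! ### Radial averaging -/

lemma measurePreserving_cis_mul (θ : ℝ) : MeasurePreserving (fun w : ℂ => cis θ * w) := by
  have h : (fun w : ℂ => cis θ * w) = rotation (Circle.exp θ) := by
    funext w; simp [cis, rotation_apply]
  rw [h]
  exact LinearIsometryEquiv.measurePreserving _

/-- The skew map `(θ, w) ↦ (θ, e^{iθ} w)` preserves the product measure. -/
lemma integrable_rotate {f : ℂ → ℂ} (hf : Integrable f) :
    Integrable (Function.uncurry fun (θ : ℝ) (w : ℂ) => f (cis θ * w))
      ((volume.restrict (Set.uIoc 0 (2 * Real.pi))).prod volume) := by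
  have h := MeasurePreserving.skew_product
    (MeasurePreserving.id (volume.restrict (Set.uIoc (0 : ℝ) (2 * Real.pi))))
    (g := fun θ (w : ℂ) => cis θ * w) (μc := volume) (μd := volume)
    (by have := continuous_cis; exact Continuous.measurable (by fun_prop))
    (Filter.Eventually.of_forall fun θ => (measurePreserving_cis_mul θ).map_eq)
  have : IsFiniteMeasure (volume.restrict (Set.uIoc (0 : ℝ) (2 * Real.pi))) :=
    ⟨by rw [Measure.restrict_apply_univ, Set.uIoc]; exact measure_Ioc_lt_top⟩
  have h2 : Integrable (fun p : ℝ × ℂ => f p.2)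
      ((volume.restrict (Set.uIoc (0 : ℝ) (2 * Real.pi))).prod volume) := hf.comp_snd _
  exact h.integrable_comp_of_integrable h2

lemma integral_eq_integral_rotate {f : ℂ → ℂ} (hf : Integrable f) :
    ∫ w, ∫ θ in (0 : ℝ)..(2 * Real.pi), f (cis θ * w) = 2 * Real.pi * ∫ w, f w := by
  rw [← intervalIntegral_integral_swap (integrable_rotate hf)]
  have : ∀ θ, ∫ w, f (cis θ * w) = ∫ w, f w := by
    intro θ
    have h : (fun w : ℂ => cis θ * w) = rotation (Circle.exp θ) := by
      funext w; simp [cis, rotation_apply]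
    have h2 := (LinearIsometryEquiv.measurePreserving (rotation (Circle.exp θ))).integral_comp
      (rotation (Circle.exp θ)).toHomeomorph.measurableEmbedding f
    rw [← h2]
    simp [cis, rotation_apply]
  simp_rw [this]
  simp

/-- Rotating the variable does not change the integral; after averaging, the radial factor comes out
and the mean value property evaluates the rest. -/
lemma MeanValue.integral_radial {j : ℕ} {G : ℂ → ℂ} (hG : MeanValue j G) (ζ : ℂ) {h : ℂ → ℂ}
    (hh : ∀ θ w, h (cis θ * w) = h w)
    (hi : Integrable fun w => G (ζ + w) * Complex.exp (-Real.pi * conj ζ * w) * h w) :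
    ∫ w, G (ζ + w) * Complex.exp (-Real.pi * conj ζ * w) * h w =
      G ζ * ∫ w, (phi j w : ℂ) * h w := by
  have h1 := integral_eq_integral_rotate hi
  simp_rw [hh, intervalIntegral.integral_mul_const, hG.2] at h1
  have h2 : ∀ w, 2 * Real.pi * (phi j w : ℂ) * G ζ * h w =
      (2 * Real.pi * G ζ) * ((phi j w : ℂ) * h w) := fun w => by ring
  simp_rw [h2] at h1
  rw [integral_const_mul] at h1
  have hpi : (2 * Real.pi : ℂ) ≠ 0 := by simp [Real.pi_ne_zero]
  apply mul_left_cancel₀ hpi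
  rw [← h1]; ring

/-- Completing the square around `ζ` turns `K^k dμ` into the twist of the mean value property times
a radial function. This is why `P^k` can be computed by radial averaging. -/
lemma kernel_shift (k : ℕ) (ζ w : ℂ) : kernel k ζ (ζ + w) * gauss (ζ + w) =
    Complex.exp (-Real.pi * conj ζ * w) * ((phi k w * rgauss w : ℝ) : ℂ) := by
  have h : phi k (ζ - (ζ + w)) = phi k w := by simp [phi]
  have e : Complex.exp (Real.pi * conj (ζ + w) * ζ) * gauss (ζ + w) =
      Complex.exp (-Real.pi * conj ζ * w) * gauss w := by
    rw [gauss, gauss]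
    push_cast
    rw [← Complex.exp_add, ← Complex.exp_add, ← Complex.conj_mul', ← Complex.conj_mul', map_add]
    congr 1; ring
  rw [kernel, diagPhi_eq_phi, h, mul_right_comm, e, gauss_eq]
  push_cast; ring

lemma phi_cis_mul (k : ℕ) (θ : ℝ) (w : ℂ) : phi k (cis θ * w) = phi k w := by
  simp only [phi, norm_cis_mul]

lemma rgauss_cis_mul (θ : ℝ) (w : ℂ) : rgauss (cis θ * w) = rgauss w := by
  simp only [rgauss, norm_cis_mul]

lemma proj_eq_integral_shift (k : ℕ) (G : ℂ → ℂ) (ζ : ℂ) :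
    proj k G ζ = ∫ w, G (ζ + w) * Complex.exp (-Real.pi * conj ζ * w) *
      ((phi k w * rgauss w : ℝ) : ℂ) := by
  rw [proj, ← integral_add_left_eq_self _ ζ]
  congr 1; funext w
  rw [mul_assoc, kernel_shift, ← mul_assoc]

lemma integrable_shift {k : ℕ} {G : ℂ → ℂ} {ζ : ℂ}
    (hi : Integrable fun z => G z * kernel k ζ z * gauss z) :
    Integrable fun w => G (ζ + w) * Complex.exp (-Real.pi * conj ζ * w) *
      ((phi k w * rgauss w : ℝ) : ℂ) := by
  refine (hi.comp_add_left ζ).congr (Filter.Eventually.of_forall fun w => ?_)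
  simp only
  rw [mul_assoc, kernel_shift, ← mul_assoc]

/-- Radial integration reduces the projection to `∫ φ_j φ_k dμ`, which is `δ_{jk}`. Only convergence
of this one integral is required. -/
lemma MeanValue.proj_eq {j k : ℕ} {G : ℂ → ℂ} (hG : MeanValue j G) (ζ : ℂ)
    (hi : Integrable fun z => G z * kernel k ζ z * gauss z) :
    proj k G ζ = if j = k then G ζ else 0 := by
  rw [proj_eq_integral_shift, hG.integral_radial ζ (fun θ w => by
    rw [phi_cis_mul, rgauss_cis_mul]) (integrable_shift hi)]
  have : ∀ w, (phi j w : ℂ) * ((phi k w * rgauss w : ℝ) : ℂ) =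
      ((phi j w * phi k w * rgauss w : ℝ) : ℂ) := by
    intro w; push_cast; ring
  simp_rw [this]
  rw [integral_complex_ofReal, (integral_phi_mul_phi j k).2]
  split_ifs <;> simp

/-- The weight `e^{-π|z|²/2}`. -/
noncomputable def hgauss (z : ℂ) : ℝ := Real.exp (-(Real.pi / 2 * ‖z‖ ^ 2))

lemma hgauss_pos (z : ℂ) : 0 < hgauss z := Real.exp_pos _

lemma continuous_hgauss : Continuous hgauss := by unfold hgauss; fun_prop

lemma hgauss_mul_self (z : ℂ) : hgauss z * hgauss z = rgauss z := by
  rw [hgauss, rgauss, ← Real.exp_add]; congr 1; ring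

lemma norm_exp_mul_hgauss (ζ w : ℂ) :
    ‖Complex.exp (-Real.pi * conj ζ * w)‖ * hgauss ζ =
      hgauss (ζ + w) * Real.exp (Real.pi / 2 * ‖w‖ ^ 2) := by
  rw [Complex.norm_exp, hgauss, hgauss, ← Real.exp_add, ← Real.exp_add]
  congr 1
  rw [← Complex.normSq_eq_norm_sq, ← Complex.normSq_eq_norm_sq, ← Complex.normSq_eq_norm_sq,
    Complex.normSq_add]
  simp [Complex.normSq_apply]
  ring

/-- This replaces subharmonicity. The radial test function is `φ_j` cut off to the unit disc, so
that `G(ζ)` is multiplied by `∫ φ_j²` over the disc, a positive constant because `φ_j(0) = 1`. -/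
lemma MeanValue.norm_mul_hgauss_le (j : ℕ) : ∃ C : ℝ, 0 ≤ C ∧ ∀ G : ℂ → ℂ, MeanValue j G →
    ∀ ζ, ‖G ζ‖ * hgauss ζ ≤ C * ∫ w in Metric.ball (0 : ℂ) 1, ‖G (ζ + w)‖ * hgauss (ζ + w) := by
  set D := Metric.ball (0 : ℂ) 1 with hD
  have hDm : MeasurableSet D := measurableSet_ball
  have hcphi := continuous_phi j
  have ion : ∀ {f : ℂ → ℝ}, Continuous f → IntegrableOn f D := fun hf =>
    (hf.continuousOn.integrableOn_compact (isCompact_closedBall 0 1)).mono_set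
      Metric.ball_subset_closedBall
  have hpos : 0 < ∫ w in D, phi j w * phi j w := by
    rw [setIntegral_pos_iff_support_of_nonneg_ae
      (Filter.Eventually.of_forall fun w => mul_self_nonneg _) (ion (by fun_prop))]
    have ho : IsOpen ((Function.support fun w => phi j w * phi j w) ∩ D) :=
      ((by fun_prop : Continuous fun w => phi j w * phi j w).isOpen_support).inter
        Metric.isOpen_ball
    exact ho.measure_pos _ ⟨0, by simp [phi_zero], by simp [hD]⟩
  -- By `norm_exp_mul_hgauss` the twist moves the half Gaussian from `ζ` to `ζ + w` at the cost of
  -- `e^{π|w|²/2}`; `M` absorbs this factor together with `φ_j`.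
  obtain ⟨M, hM⟩ := (isCompact_closedBall (0 : ℂ) 1).exists_bound_of_continuousOn
    (f := fun w => Real.exp (Real.pi / 2 * ‖w‖ ^ 2) * phi j w)
    (by fun_prop : Continuous fun w : ℂ => Real.exp (Real.pi / 2 * ‖w‖ ^ 2) * phi j w).continuousOn
  have hM0 : 0 ≤ M := (norm_nonneg _).trans (hM 0 (by simp))
  refine ⟨M / ∫ w in D, phi j w * phi j w, by positivity, fun G hG ζ => ?_⟩
  have hGc := hG.1
  set h : ℂ → ℂ := D.indicator fun w => (phi j w : ℂ) with hh
  have e1 : ∀ w, G (ζ + w) * Complex.exp (-Real.pi * conj ζ * w) * h w =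
      D.indicator (fun w => G (ζ + w) * Complex.exp (-Real.pi * conj ζ * w) * (phi j w : ℂ)) w := by
    intro w; by_cases hw : w ∈ D <;> simp [hh, hw]
  have e2 : ∀ w, (phi j w : ℂ) * h w =
      D.indicator (fun w => ((phi j w * phi j w : ℝ) : ℂ)) w := by
    intro w; by_cases hw : w ∈ D <;> simp [hh, hw]
  have hi : IntegrableOn (fun w => G (ζ + w) * Complex.exp (-Real.pi * conj ζ * w) *
      (phi j w : ℂ)) D :=
    ((by fun_prop : Continuous fun w => G (ζ + w) * Complex.exp (-Real.pi * conj ζ * w) *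
      (phi j w : ℂ)).continuousOn.integrableOn_compact (isCompact_closedBall 0 1)).mono_set
      Metric.ball_subset_closedBall
  have key := hG.integral_radial ζ (h := h) (fun θ w => by
    have : cis θ * w ∈ D ↔ w ∈ D := by simp only [hD, mem_ball_zero_iff, norm_cis_mul]
    by_cases hw : w ∈ D
    · simp [hh, hw, this.mpr hw, phi_cis_mul]
    · simp [hh, hw, mt this.mp hw])
    (by simp_rw [e1]; exact hi.integrable_indicator hDm)
  simp_rw [e1, e2] at key
  rw [integral_indicator hDm, integral_indicator hDm, integral_complex_ofReal] at key
  have key2 : ‖G ζ‖ * ∫ w in D, phi j w * phi j w ≤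
      ∫ w in D, ‖G (ζ + w)‖ * ‖Complex.exp (-Real.pi * conj ζ * w)‖ * |phi j w| := by
    have : ‖G ζ‖ * ∫ w in D, phi j w * phi j w =
        ‖G ζ * ((∫ w in D, phi j w * phi j w : ℝ) : ℂ)‖ := by
      rw [norm_mul, Complex.norm_real, Real.norm_of_nonneg hpos.le]
    rw [this]
    refine (congrArg norm key.symm).le.trans ((norm_integral_le_integral_norm _).trans_eq ?_)
    simp
  rw [div_mul_eq_mul_div, le_div_iff₀ hpos, mul_right_comm]
  refine (mul_le_mul_of_nonneg_right key2 (hgauss_pos ζ).le).trans ?_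
  rw [← integral_mul_const, ← integral_const_mul]
  have hcg := continuous_hgauss
  refine setIntegral_mono_on (ion (by fun_prop)) (ion (by fun_prop)) hDm fun w hw => ?_
  have := hM w (Metric.ball_subset_closedBall hw)
  rw [norm_mul, Real.norm_of_nonneg (Real.exp_pos _).le, Real.norm_eq_abs] at this
  calc ‖G (ζ + w)‖ * ‖Complex.exp (-Real.pi * conj ζ * w)‖ * |phi j w| * hgauss ζ
      = ‖G (ζ + w)‖ * (‖Complex.exp (-Real.pi * conj ζ * w)‖ * hgauss ζ) * |phi j w| := by ring
    _ = ‖G (ζ + w)‖ * hgauss (ζ + w) * (Real.exp (Real.pi / 2 * ‖w‖ ^ 2) * |phi j w|) := by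
        rw [norm_exp_mul_hgauss]; ring
    _ ≤ ‖G (ζ + w)‖ * hgauss (ζ + w) * M :=
        mul_le_mul_of_nonneg_left this (mul_nonneg (norm_nonneg _) (hgauss_pos _).le)
    _ = _ := by ring

/-! ### The domain of the projections -/

lemma abs_phi_le (j : ℕ) : ∃ C : ℝ, 0 ≤ C ∧ ∀ w : ℂ, |phi j w| ≤ C * Real.exp ‖w‖ := by
  refine ⟨∑ k ∈ Finset.range (j + 1), (j.choose k : ℝ) * (Real.pi ^ k * (2 * k).factorial) /
    k.factorial, Finset.sum_nonneg fun k _ => by positivity, fun w => ?_⟩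
  rw [phi, lag, Finset.sum_mul]
  refine (Finset.abs_sum_le_sum_abs _ _).trans (Finset.sum_le_sum fun k _ => ?_)
  rw [abs_div, abs_mul, abs_pow, abs_neg, Nat.abs_cast, Nat.abs_cast, abs_of_nonneg (by positivity),
    div_mul_eq_mul_div, mul_assoc]
  gcongr
  rw [mul_pow, ← pow_mul, mul_assoc]
  gcongr
  have := Real.pow_div_factorial_le_exp ‖w‖ (norm_nonneg _) (2 * k)
  rw [div_le_iff₀ (by positivity)] at this
  linarith

lemma norm_gauss (z : ℂ) : ‖gauss z‖ = rgauss z := by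
  rw [gauss_eq, Complex.norm_real, Real.norm_of_nonneg (rgauss_pos z).le]

lemma continuous_kernel_comp (j : ℕ) {X : Type*} [TopologicalSpace X] {f g : X → ℂ}
    (hf : Continuous f) (hg : Continuous g) : Continuous fun x => kernel j (f x) (g x) :=
  (continuous_kernel j).comp (hf.prodMk hg)

lemma norm_kernel_le (j : ℕ) : ∃ C : ℝ, 0 ≤ C ∧ ∀ (ρ : ℝ) (ζ z : ℂ), ‖ζ‖ ≤ ρ →
    ‖kernel j ζ z‖ ≤ C * Real.exp ρ * Real.exp ((Real.pi * ρ + 1) * ‖z‖) := by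
  obtain ⟨C, hC, h⟩ := abs_phi_le j
  refine ⟨C, hC, fun ρ ζ z hρ => ?_⟩
  rw [kernel, norm_mul, diagPhi_eq_phi, Complex.norm_real, Real.norm_eq_abs, Complex.norm_exp]
  have h1 : (↑Real.pi * conj z * ζ).re ≤ Real.pi * ρ * ‖z‖ := by
    refine (Complex.re_le_norm _).trans ?_
    rw [norm_mul, norm_mul, Complex.norm_conj, Complex.norm_real,
      Real.norm_of_nonneg Real.pi_pos.le, mul_right_comm]
    gcongr
  have h2 : |phi j (ζ - z)| ≤ C * (Real.exp ρ * Real.exp ‖z‖) := by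
    refine (h _).trans ?_
    rw [← Real.exp_add]
    gcongr
    exact (norm_sub_le _ _).trans (by linarith)
  calc _ ≤ Real.exp (Real.pi * ρ * ‖z‖) * (C * (Real.exp ρ * Real.exp ‖z‖)) := by gcongr
    _ = C * Real.exp ρ * (Real.exp (Real.pi * ρ * ‖z‖) * Real.exp ‖z‖) := by ring
    _ = _ := by rw [← Real.exp_add]; ring_nf

/-- Integrability against all `e^{R|z|} dμ`. -/
def ExpInt (τ : ℂ → ℂ) : Prop :=
  AEStronglyMeasurable τ ∧ ∀ R : ℝ, Integrable fun z => ‖τ z‖ * (Real.exp (R * ‖z‖) * rgauss z)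

lemma ExpInt.inDomain {τ : ℂ → ℂ} (hτ : ExpInt τ) : InDomain τ := by
  intro j ζ
  obtain ⟨C, hC, h⟩ := norm_kernel_le j
  have hk : Continuous fun z => kernel j ζ z :=
    continuous_kernel_comp j continuous_const continuous_id
  refine ((hτ.2 (Real.pi * ‖ζ‖ + 1)).const_mul (C * Real.exp ‖ζ‖)).mono'
    ((hτ.1.mul hk.aestronglyMeasurable).mul continuous_gauss.aestronglyMeasurable)
    (Filter.Eventually.of_forall fun z => ?_)
  rw [norm_mul, norm_mul, norm_gauss]
  have := h ‖ζ‖ ζ z le_rfl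
  calc _ ≤ ‖τ z‖ * (C * Real.exp ‖ζ‖ * Real.exp ((Real.pi * ‖ζ‖ + 1) * ‖z‖)) * rgauss z := by
        gcongr; exact (rgauss_pos z).le
    _ = _ := by ring

/-- Already the order-zero kernels, of modulus `e^{π Re(z̄ ζ)}`, suffice: four values of `ζ` on the
axes dominate `e^{R|z|}`. With `ExpInt.inDomain`, the domain is exactly the class of exponentially
integrable functions. -/
lemma InDomain.expInt {σ : ℂ → ℂ} (hσ : InDomain σ) : ExpInt σ := by
  have hm : AEStronglyMeasurable σ := by
    have h1 := (hσ 0 0).1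
    have h2 : Continuous fun z => (gauss z)⁻¹ := continuous_gauss.inv₀ fun z => by
      rw [gauss_eq]; exact_mod_cast (rgauss_pos z).ne'
    refine (h1.mul h2.aestronglyMeasurable).congr (Filter.Eventually.of_forall fun z => ?_)
    have : gauss z ≠ 0 := by rw [gauss_eq]; exact_mod_cast (rgauss_pos z).ne'
    simp [kernel, diagPhi, this]
  refine ⟨hm, fun R => ?_⟩
  have h1 : ∀ ζ : ℂ, Integrable fun z =>
      ‖σ z‖ * (Real.exp (Real.pi * (conj z * ζ).re) * rgauss z) := by
    intro ζ
    refine (hσ 0 ζ).norm.congr (Filter.Eventually.of_forall fun z => ?_)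
    simp only [kernel, diagPhi_eq_phi, phi, lag, norm_mul, norm_gauss, Complex.norm_exp]
    simp [mul_assoc]
  -- The factor 2 is due to `|z| ≤ |Re z| + |Im z| ≤ 2 max(|Re z|, |Im z|)`.
  set s : ℝ := 2 * |R| / Real.pi with hs
  have hs' : Real.pi * s = 2 * |R| := by rw [hs]; field_simp
  have h2 := ((h1 s).add (h1 (-s))).add ((h1 (s * Complex.I)).add (h1 (-(s * Complex.I))))
  refine h2.mono' ?_ (Filter.Eventually.of_forall fun z => ?_)
  · refine hm.norm.mul (Continuous.aestronglyMeasurable ?_)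
    have := continuous_rgauss
    fun_prop
  · have key : Real.exp (R * ‖z‖) ≤ Real.exp (Real.pi * (conj z * (s : ℂ)).re) +
        Real.exp (Real.pi * (conj z * (-s : ℂ)).re) +
        (Real.exp (Real.pi * (conj z * (s * Complex.I)).re) +
        Real.exp (Real.pi * (conj z * (-(s * Complex.I))).re)) := by
      have e1 : Real.pi * (conj z * (s : ℂ)).re = 2 * |R| * z.re := by
        rw [← hs']; simp; ring
      have e2 : Real.pi * (conj z * (-s : ℂ)).re = -(2 * |R| * z.re) := by
        rw [← hs']; simp; ring
      have e3 : Real.pi * (conj z * (s * Complex.I)).re = 2 * |R| * z.im := by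
        rw [← hs']; simp; ring
      have e4 : Real.pi * (conj z * (-(s * Complex.I))).re = -(2 * |R| * z.im) := by
        rw [← hs']; simp; ring
      rw [e1, e2, e3, e4]
      have b : R * ‖z‖ ≤ |R| * (|z.re| + |z.im|) :=
        mul_le_mul (le_abs_self R) (Complex.norm_le_abs_re_add_abs_im z) (norm_nonneg _)
          (abs_nonneg _)
      have p1 := Real.exp_pos (2 * |R| * z.re)
      have p2 := Real.exp_pos (-(2 * |R| * z.re))
      have p3 := Real.exp_pos (2 * |R| * z.im)
      have p4 := Real.exp_pos (-(2 * |R| * z.im))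
      have q : ∀ x : ℝ, Real.exp (2 * |R| * |x|) ≤
          Real.exp (2 * |R| * x) + Real.exp (-(2 * |R| * x)) := by
        intro x
        have p1 := Real.exp_pos (2 * |R| * x)
        have p2 := Real.exp_pos (-(2 * |R| * x))
        rcases abs_cases x with ⟨h, _⟩ | ⟨h, _⟩ <;> rw [h]
        · linarith
        · rw [mul_neg]; linarith
      have q1 := q z.re
      have q2 := q z.im
      rcases le_total |z.re| |z.im| with h | h
      · have : Real.exp (R * ‖z‖) ≤ Real.exp (2 * |R| * |z.im|) := by
          apply Real.exp_le_exp.mpr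
          nlinarith [mul_le_mul_of_nonneg_left h (abs_nonneg R)]
        linarith
      · have : Real.exp (R * ‖z‖) ≤ Real.exp (2 * |R| * |z.re|) := by
          apply Real.exp_le_exp.mpr
          nlinarith [mul_le_mul_of_nonneg_left h (abs_nonneg R)]
        linarith
    have hr := rgauss_pos z
    rw [Real.norm_of_nonneg (by positivity)]
    simp only [Pi.add_apply]
    calc _ ≤ ‖σ z‖ * ((Real.exp (Real.pi * (conj z * (s : ℂ)).re) +
        Real.exp (Real.pi * (conj z * (-s : ℂ)).re) +
        (Real.exp (Real.pi * (conj z * (s * Complex.I)).re) +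
        Real.exp (Real.pi * (conj z * (-(s * Complex.I))).re))) * rgauss z) := by gcongr
      _ = _ := by ring

lemma ExpInt.mul_pow {τ : ℂ → ℂ} (hτ : ExpInt τ) (a b : ℕ) :
    ExpInt fun z => τ z * (z ^ a * conj z ^ b) := by
  refine ⟨hτ.1.mul (Continuous.aestronglyMeasurable (by fun_prop)), fun R => ?_⟩
  refine ((hτ.2 (R + 1)).const_mul ((a + b).factorial : ℝ)).mono' ?_
    (Filter.Eventually.of_forall fun z => ?_)
  · have := continuous_rgauss
    exact (hτ.1.mul (Continuous.aestronglyMeasurable (by fun_prop))).norm.mul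
      (Continuous.aestronglyMeasurable (by fun_prop))
  · have hr := rgauss_pos z
    rw [Real.norm_of_nonneg (by positivity), norm_mul, norm_mul, norm_pow, norm_pow,
      Complex.norm_conj, ← pow_add]
    have := Real.pow_div_factorial_le_exp ‖z‖ (norm_nonneg _) (a + b)
    rw [div_le_iff₀ (by positivity)] at this
    calc ‖τ z‖ * ‖z‖ ^ (a + b) * (Real.exp (R * ‖z‖) * rgauss z) ≤
        ‖τ z‖ * (Real.exp ‖z‖ * (a + b).factorial) * (Real.exp (R * ‖z‖) * rgauss z) := by
          gcongr
      _ = (a + b).factorial * (‖τ z‖ * ((Real.exp (R * ‖z‖) * Real.exp ‖z‖) * rgauss z)) := by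
          ring
      _ = _ := by rw [← Real.exp_add]; ring_nf

lemma ExpInt.differentiable_integral {τ : ℂ → ℂ} (hτ : ExpInt τ) :
    Differentiable ℂ fun ζ => ∫ z, τ z * Complex.exp (Real.pi * conj z * ζ) * gauss z := by
  intro ζ₀
  have hg := continuous_gauss
  have hr := continuous_rgauss
  have hsm : ∀ ζ : ℂ, AEStronglyMeasurable
      (fun z => τ z * Complex.exp (Real.pi * conj z * ζ) * gauss z) := fun ζ =>
    (hτ.1.mul (Continuous.aestronglyMeasurable (by fun_prop))).mul hg.aestronglyMeasurable
  have hre : ∀ ζ z : ℂ, ∀ ρ : ℝ, ‖ζ‖ ≤ ρ → ‖Complex.exp (Real.pi * conj z * ζ)‖ ≤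
      Real.exp (Real.pi * ρ * ‖z‖) := by
    intro ζ z ρ hρ
    rw [Complex.norm_exp]
    apply Real.exp_le_exp.mpr
    refine (Complex.re_le_norm _).trans ?_
    rw [norm_mul, norm_mul, Complex.norm_conj, Complex.norm_real,
      Real.norm_of_nonneg Real.pi_pos.le, mul_right_comm]
    gcongr
  refine (hasDerivAt_integral_of_dominated_loc_of_deriv_le (s := Metric.ball ζ₀ 1)
    (F := fun ζ z => τ z * Complex.exp (Real.pi * conj z * ζ) * gauss z)
    (F' := fun ζ z => τ z * (Complex.exp (Real.pi * conj z * ζ) * (Real.pi * conj z)) * gauss z)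
    -- The first `+ 1` covers the unit ball around `ζ₀`; the second absorbs the factor `‖z‖`
    -- produced by the derivative.
    (bound := fun z => Real.pi * (‖τ z‖ *
      (Real.exp ((Real.pi * (‖ζ₀‖ + 1) + 1) * ‖z‖) * rgauss z)))
    (Metric.ball_mem_nhds ζ₀ one_pos) (Filter.Eventually.of_forall hsm) ?_ ?_ ?_ ?_ ?_).2
    |>.differentiableAt
  · refine (hτ.2 (Real.pi * ‖ζ₀‖)).mono' (hsm ζ₀) (Filter.Eventually.of_forall fun z => ?_)
    rw [norm_mul, norm_mul, norm_gauss, mul_assoc]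
    have := hre ζ₀ z _ le_rfl
    have := rgauss_pos z
    gcongr
  · exact (hτ.1.mul (Continuous.aestronglyMeasurable (by fun_prop))).mul hg.aestronglyMeasurable
  · refine Filter.Eventually.of_forall fun z ζ hζ => ?_
    have h1 : ‖ζ‖ ≤ ‖ζ₀‖ + 1 := by
      have := norm_sub_norm_le ζ ζ₀
      rw [mem_ball_iff_norm] at hζ
      linarith
    have h2 := hre ζ z _ h1
    have h3 := rgauss_pos z
    have h4 : ‖z‖ ≤ Real.exp ‖z‖ := by linarith [Real.add_one_le_exp ‖z‖]
    rw [norm_mul, norm_mul, norm_mul, norm_mul, norm_gauss, Complex.norm_conj, Complex.norm_real,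
      Real.norm_of_nonneg Real.pi_pos.le]
    calc _ ≤ ‖τ z‖ * (Real.exp (Real.pi * (‖ζ₀‖ + 1) * ‖z‖) * (Real.pi * Real.exp ‖z‖)) *
          rgauss z := by gcongr
      _ = Real.pi * (‖τ z‖ * ((Real.exp (Real.pi * (‖ζ₀‖ + 1) * ‖z‖) * Real.exp ‖z‖) *
          rgauss z)) := by ring
      _ = _ := by rw [← Real.exp_add]; ring_nf
  · exact (hτ.2 _).const_mul _
  · refine Filter.Eventually.of_forall fun z ζ _ => ?_
    have h := ((hasDerivAt_id ζ).const_mul (Real.pi * conj z)).cexp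
    simp only [id, mul_one] at h
    exact (h.const_mul (τ z)).mul_const (gauss z)

lemma ExpInt.integrable_exp {τ : ℂ → ℂ} (hτ : ExpInt τ) (ζ : ℂ) :
    Integrable fun z => τ z * Complex.exp (Real.pi * conj z * ζ) * gauss z := by
  refine (hτ.inDomain 0 ζ).congr (Filter.Eventually.of_forall fun z => ?_)
  simp [kernel, diagPhi]

/-- Expanding the powers of `|ζ - z|²` separates the powers of `ζ̄`; what remains is a polynomial in
`ζ` times entire integrals. This yields both continuity and polyanalyticity of the projections. -/
lemma ExpInt.proj_eq_sum {σ : ℂ → ℂ} (hσ : ExpInt σ) (j : ℕ) :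
    ∃ h : ℕ → ℂ → ℂ, (∀ k, Differentiable ℂ (h k)) ∧
      ∀ ζ, proj j σ ζ = ∑ k ∈ Finset.range (j + 1), conj ζ ^ k * h k ζ := by
  set E : ℕ → ℕ → ℂ → ℂ := fun a b ζ =>
    ∫ z, (σ z * (z ^ a * conj z ^ b)) * Complex.exp (Real.pi * conj z * ζ) * gauss z with hE
  set co : ℕ → ℕ → ℕ → ℂ := fun m k c => (j.choose m : ℂ) * (-1) ^ m * Real.pi ^ m /
    (m.factorial : ℂ) * m.choose k * (-1) ^ (m - k) * (m.choose c * (-1) ^ (m - c)) with hco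
  refine ⟨fun k ζ => ∑ m ∈ Finset.range (j + 1), ∑ c ∈ Finset.range (m + 1),
    co m k c * ζ ^ c * E (m - c) (m - k) ζ, fun k => ?_, fun ζ => ?_⟩
  · refine Differentiable.fun_sum fun m _ => Differentiable.fun_sum fun c _ => ?_
    have := (hσ.mul_pow (m - c) (m - k)).differentiable_integral
    exact ((differentiable_const _).mul (differentiable_id.pow c)).mul this
  · have e : ∀ z, σ z * kernel j ζ z * gauss z = ∑ m ∈ Finset.range (j + 1),
        ∑ k ∈ Finset.range (j + 1), ∑ c ∈ Finset.range (m + 1), (conj ζ ^ k * co m k c * ζ ^ c) *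
          ((σ z * (z ^ (m - c) * conj z ^ (m - k))) * Complex.exp (Real.pi * conj z * ζ) *
            gauss z) := by
      intro z
      rw [kernel, diagPhi_eq_phi, phi, lag]
      push_cast
      simp only [Finset.mul_sum, Finset.sum_mul]
      refine Finset.sum_congr rfl fun m hm => ?_
      have h1 : (-((Real.pi : ℂ) * (‖ζ - z‖ : ℂ) ^ 2)) ^ m =
          (-1) ^ m * Real.pi ^ m * ((ζ + -z) ^ m * (conj ζ + -conj z) ^ m) := by
        rw [← Complex.conj_mul', map_sub, ← _root_.mul_pow, ← _root_.mul_pow, ← _root_.mul_pow]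
        congr 1; ring
      have h2 : (conj ζ + -conj z) ^ m = ∑ k ∈ Finset.range (j + 1),
          conj ζ ^ k * (-conj z) ^ (m - k) * m.choose k := by
        rw [add_pow]
        refine Finset.sum_subset (Finset.range_mono (by simp at hm; omega)) fun k _ hk => ?_
        rw [Nat.choose_eq_zero_of_lt (by simp at hk; omega)]; simp
      rw [h1, h2, add_pow, Finset.sum_mul_sum, Finset.sum_comm]
      simp only [Finset.mul_sum, Finset.sum_mul, Finset.sum_div]
      refine Finset.sum_congr rfl fun k _ => Finset.sum_congr rfl fun c _ => ?_
      rw [hco, neg_pow z, neg_pow (conj z)]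
      ring
    rw [proj]
    simp_rw [e]
    have hi : ∀ a b, Integrable fun z =>
        (σ z * (z ^ a * conj z ^ b)) * Complex.exp (Real.pi * conj z * ζ) * gauss z := fun a b =>
      (hσ.mul_pow a b).integrable_exp ζ
    rw [integral_finsetSum _ fun m _ => integrable_finsetSum _ fun k _ =>
      integrable_finsetSum _ fun c _ => (hi _ _).const_mul _]
    simp only [Finset.mul_sum]
    rw [Finset.sum_comm]
    refine Finset.sum_congr rfl fun m _ => ?_
    rw [integral_finsetSum _ fun k _ => integrable_finsetSum _ fun c _ => (hi _ _).const_mul _]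
    refine Finset.sum_congr rfl fun k _ => ?_
    rw [integral_finsetSum _ fun c _ => (hi _ _).const_mul _]
    refine Finset.sum_congr rfl fun c _ => ?_
    rw [integral_const_mul, hE]
    ring

/-- Fubini reduces the identity to the kernel. Exponential integrability gives a majorant uniform in
the angle, since `ζ + e^{iθ} w` stays in the ball of radius `‖ζ‖ + ‖w‖`. -/
lemma ExpInt.meanValue_proj {σ : ℂ → ℂ} (hσ : ExpInt σ) (j : ℕ) : MeanValue j (proj j σ) := by
  constructor
  · obtain ⟨h, hd, he⟩ := hσ.proj_eq_sum j
    have : proj j σ = fun ζ => ∑ k ∈ Finset.range (j + 1), conj ζ ^ k * h k ζ := funext he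
    rw [this]
    refine continuous_finsetSum _ fun k _ => ?_
    have := (hd k).continuous
    fun_prop
  · intro ζ w
    obtain ⟨C, hC, hk⟩ := norm_kernel_le j
    have hcis := continuous_cis
    have hg := continuous_gauss
    set ρ := ‖ζ‖ + ‖w‖
    have hnorm : ∀ θ, ‖ζ + cis θ * w‖ ≤ ρ := fun θ =>
      (norm_add_le _ _).trans (by rw [norm_cis_mul])
    have : IsFiniteMeasure (volume.restrict (Set.uIoc (0 : ℝ) (2 * Real.pi))) :=
      ⟨by rw [Measure.restrict_apply_univ, Set.uIoc]; exact measure_Ioc_lt_top⟩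
    have hint : Integrable (Function.uncurry fun (θ : ℝ) (z : ℂ) =>
        σ z * kernel j (ζ + cis θ * w) z * gauss z *
          Complex.exp (-Real.pi * conj ζ * (cis θ * w)))
        ((volume.restrict (Set.uIoc 0 (2 * Real.pi))).prod volume) := by
      refine Integrable.mono' (g := fun p : ℝ × ℂ => (C * Real.exp ρ *
        Real.exp (Real.pi * ‖ζ‖ * ‖w‖)) * (‖σ p.2‖ *
        (Real.exp ((Real.pi * ρ + 1) * ‖p.2‖) * rgauss p.2)))
        ((hσ.2 (Real.pi * ρ + 1)).comp_snd _ |>.const_mul _) ?_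
        (Filter.Eventually.of_forall fun p => ?_)
      · have h1 : Continuous fun p : ℝ × ℂ => kernel j (ζ + cis p.1 * w) p.2 :=
          continuous_kernel_comp j (by fun_prop) (by fun_prop)
        have h2 : Continuous fun p : ℝ × ℂ =>
            Complex.exp (-Real.pi * conj ζ * (cis p.1 * w)) := by fun_prop
        have h3 : Continuous fun p : ℝ × ℂ => gauss p.2 := by fun_prop
        exact ((hσ.1.comp_snd.mul h1.aestronglyMeasurable).mul h3.aestronglyMeasurable).mul
          h2.aestronglyMeasurable
      · obtain ⟨θ, z⟩ := p
        simp only [Function.uncurry]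
        rw [norm_mul, norm_mul, norm_mul, norm_gauss, Complex.norm_exp]
        have h1 := hk ρ _ z (hnorm θ)
        have h2 : (-Real.pi * conj ζ * (cis θ * w)).re ≤ Real.pi * ‖ζ‖ * ‖w‖ := by
          refine (Complex.re_le_norm _).trans ?_
          rw [norm_mul, norm_mul, norm_cis_mul, norm_neg, Complex.norm_conj, Complex.norm_real,
            Real.norm_of_nonneg Real.pi_pos.le]
        have h3 := rgauss_pos z
        calc _ ≤ ‖σ z‖ * (C * Real.exp ρ * Real.exp ((Real.pi * ρ + 1) * ‖z‖)) * rgauss z *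
              Real.exp (Real.pi * ‖ζ‖ * ‖w‖) := by gcongr
          _ = _ := by ring
    have e1 : ∀ θ, proj j σ (ζ + cis θ * w) * Complex.exp (-Real.pi * conj ζ * (cis θ * w)) =
        ∫ z, σ z * kernel j (ζ + cis θ * w) z * gauss z *
          Complex.exp (-Real.pi * conj ζ * (cis θ * w)) := fun θ => by
      rw [integral_mul_const, proj]
    simp_rw [e1]
    rw [intervalIntegral_integral_swap hint, proj, ← integral_const_mul]
    congr 1; funext z
    have := (meanValue_kernel j z).2 ζ w
    have e2 : ∀ θ, σ z * kernel j (ζ + cis θ * w) z * gauss z *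
          Complex.exp (-Real.pi * conj ζ * (cis θ * w)) = (σ z * gauss z) *
          (kernel j (ζ + cis θ * w) z * Complex.exp (-Real.pi * conj ζ * (cis θ * w))) :=
      fun θ => by ring
    simp_rw [e2]
    rw [intervalIntegral.integral_const_mul, this]
    ring

lemma InDomain.meanValue_proj {σ : ℂ → ℂ} (hσ : InDomain σ) (j : ℕ) : MeanValue j (proj j σ) :=
  hσ.expInt.meanValue_proj j

/-! ### Weights -/

/-- The exponent `|z|^{1/α}`. -/
noncomputable def lam (α : ℝ) (z : ℂ) : ℝ := ‖z‖ ^ (1 / α)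

/-- The weight, as a real number. -/
noncomputable def wt (a α : ℝ) (z : ℂ) : ℝ := Real.exp (a * lam α z) * hgauss z

lemma weight_eq (a α : ℝ) (z : ℂ) : weight a α z = (wt a α z : ℂ) := rfl

lemma wt_pos (a α : ℝ) (z : ℂ) : 0 < wt a α z := mul_pos (Real.exp_pos _) (hgauss_pos z)

lemma norm_weighted (a α : ℝ) (j : ℕ) (σ : ℂ → ℂ) (z : ℂ) :
    ‖weighted a α j σ z‖ = wt a α z * ‖proj j σ z‖ := by
  rw [weighted, weight_eq, norm_mul, Complex.norm_real, Real.norm_of_nonneg (wt_pos a α z).le]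

lemma lam_nonneg (α : ℝ) (z : ℂ) : 0 ≤ lam α z := Real.rpow_nonneg (norm_nonneg _) _

lemma one_le_one_div {α : ℝ} (hα : 1 / 2 ≤ α) (hα' : α ≤ 1) : 1 ≤ 1 / α := by
  rw [le_div_iff₀ (by linarith)]; linarith

lemma one_div_le_two {α : ℝ} (hα : 1 / 2 ≤ α) : 1 / α ≤ 2 := by
  rw [div_le_iff₀ (by linarith)]; linarith

lemma continuous_lam {α : ℝ} (hα : 1 / 2 ≤ α) : Continuous (lam α) := by
  have : 0 ≤ 1 / α := by have : 0 < α := by linarith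
                         positivity
  unfold lam
  exact continuous_norm.rpow_const fun _ => Or.inr this

lemma continuous_wt (a : ℝ) {α : ℝ} (hα : 1 / 2 ≤ α) : Continuous (wt a α) := by
  have := continuous_lam hα
  have := continuous_hgauss
  unfold wt; fun_prop

lemma lam_neg (α : ℝ) (z : ℂ) : lam α (-z) = lam α z := by simp [lam]

lemma lam_le_one {α : ℝ} (hα : 1 / 2 ≤ α) {z : ℂ} (hz : ‖z‖ ≤ 1) : lam α z ≤ 1 :=
  Real.rpow_le_one (norm_nonneg _) hz (by have : 0 < α := by linarith
                                          positivity)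

/-- By convexity the constant is `2^{1/α - 1}`, and `1 ≤ 1/α ≤ 2` bounds it by 2. The doublings of
`a` below come from here. -/
lemma lam_add_le {α : ℝ} (hα : 1 / 2 ≤ α) (hα' : α ≤ 1) (z w : ℂ) :
    lam α (z + w) ≤ 2 * (lam α z + lam α w) := by
  have h1 := one_le_one_div hα hα'
  have h2 := one_div_le_two hα
  have h3 : lam α (z + w) ≤ (‖z‖ + ‖w‖) ^ (1 / α) :=
    Real.rpow_le_rpow (norm_nonneg _) (norm_add_le _ _) (by linarith)
  have h4 := NNReal.rpow_add_le_mul_rpow_add_rpow ‖z‖₊ ‖w‖₊ h1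
  have h5 : (‖z‖ + ‖w‖) ^ (1 / α) ≤ (2 : ℝ) ^ (1 / α - 1) * (lam α z + lam α w) := by
    exact_mod_cast h4
  have h6 : (2 : ℝ) ^ (1 / α - 1) ≤ 2 := by
    calc (2 : ℝ) ^ (1 / α - 1) ≤ 2 ^ (1 : ℝ) :=
          Real.rpow_le_rpow_of_exponent_le (by norm_num) (by linarith)
      _ = 2 := by norm_num
  have h7 := lam_nonneg α z
  have h8 := lam_nonneg α w
  exact h3.trans (h5.trans (mul_le_mul_of_nonneg_right h6 (by linarith)))

lemma lam_sub_le {α : ℝ} (hα : 1 / 2 ≤ α) (hα' : α ≤ 1) (z w : ℂ) :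
    lam α z ≤ 2 * (lam α (z + w) + lam α w) := by
  have := lam_add_le hα hα' (z + w) (-w)
  rwa [add_neg_cancel_right, lam_neg] at this

lemma integrable_exp_neg_lam {α : ℝ} (hα : 1 / 2 ≤ α) (hα' : α ≤ 1) {δ : ℝ} (hδ : 0 < δ) :
    Integrable fun z : ℂ => Real.exp (-δ * lam α z) := by
  by_contra h
  have h1 := integral_undef h
  have h3 := one_le_one_div hα hα'
  have h2 := Complex.integral_exp_neg_mul_rpow h3 hδ
  simp only [lam] at h1
  rw [h1] at h2
  have h4 : 0 < Real.pi * δ ^ (-2 / (1 / α)) * Real.Gamma (2 / (1 / α) + 1) := by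
    have : 0 < 1 / α := by linarith
    have := Real.Gamma_pos_of_pos (by positivity : 0 < 2 / (1 / α) + 1)
    positivity
  linarith

lemma memLp_exp_neg_lam {α : ℝ} (hα : 1 / 2 ≤ α) (hα' : α ≤ 1) {δ : ℝ} (hδ : 0 < δ)
    (q : ℝ≥0∞) [hq : Fact (1 ≤ q)] : MemLp (fun z : ℂ => Real.exp (-δ * lam α z)) q := by
  have hc : Continuous fun z : ℂ => Real.exp (-δ * lam α z) := by
    have := continuous_lam hα; fun_prop
  by_cases hq' : q = ⊤
  · subst hq'
    refine memLp_top_of_bound hc.aestronglyMeasurable 1 (Filter.Eventually.of_forall fun z => ?_)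
    rw [Real.norm_of_nonneg (Real.exp_pos _).le, Real.exp_le_one_iff]
    nlinarith [lam_nonneg α z]
  · have hq0 : q ≠ 0 := (zero_lt_one.trans_le hq.out).ne'
    rw [← integrable_norm_rpow_iff hc.aestronglyMeasurable hq0 hq']
    have hq1 : 0 < q.toReal := ENNReal.toReal_pos hq0 hq'
    refine (integrable_exp_neg_lam hα hα' (mul_pos hδ hq1)).congr
      (Filter.Eventually.of_forall fun z => ?_)
    simp only
    rw [Real.norm_of_nonneg (Real.exp_pos _).le, ← Real.exp_mul]
    ring_nf

lemma wt_mul_exp (a b α : ℝ) (z : ℂ) : wt a α z * Real.exp (b * lam α z) = wt (a + b) α z := by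
  rw [wt, wt, add_mul, Real.exp_add]; ring

/-- The gap between the weights leaves the factor `e^{-(b-a)|z|^{1/α}}`, which lies in every L^q;
its norm is the constant. -/
lemma memLp_of_wt_le {α : ℝ} (hα : 1 / 2 ≤ α) (hα' : α ≤ 1) {a b : ℝ} (hab : a < b)
    (q : ℝ≥0∞) [Fact (1 ≤ q)] : ∃ K : ℝ, 0 ≤ K ∧ ∀ (j : ℕ) (σ : ℂ → ℂ) (B : ℝ), 0 ≤ B →
      Continuous (proj j σ) → (∀ z, wt b α z * ‖proj j σ z‖ ≤ B) →
      MemLp (weighted a α j σ) q ∧ (eLpNorm (weighted a α j σ) q volume).toReal ≤ K * B := by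
  have hE := memLp_exp_neg_lam hα hα' (sub_pos.mpr hab) q
  refine ⟨_, ENNReal.toReal_nonneg (a := eLpNorm (fun z : ℂ => Real.exp (-(b - a) * lam α z)) q
    volume), fun j σ B hB hc hb => ?_⟩
  have hle : ∀ z, ‖weighted a α j σ z‖ ≤ B * ‖Real.exp (-(b - a) * lam α z)‖ := by
    intro z
    rw [norm_weighted, Real.norm_of_nonneg (Real.exp_pos _).le,
      show a = b + (-(b - a)) by ring, ← wt_mul_exp, mul_right_comm]
    have : b + -(b - a) = a := by ring
    rw [this]
    exact mul_le_mul_of_nonneg_right (hb z) (Real.exp_pos _).le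
  have hm : AEStronglyMeasurable (weighted a α j σ) := by
    refine Continuous.aestronglyMeasurable ?_
    have h1 : Continuous fun z => (wt a α z : ℂ) :=
      Complex.continuous_ofReal.comp (continuous_wt a hα)
    exact h1.mul hc
  have h1 := eLpNorm_le_mul_eLpNorm_of_ae_le_mul (Filter.Eventually.of_forall hle) q
    (μ := volume)
  refine ⟨hE.of_le_mul hm (Filter.Eventually.of_forall hle), ?_⟩
  have h2 := ENNReal.toReal_mono (ENNReal.mul_ne_top ENNReal.ofReal_ne_top hE.2.ne) h1
  rwa [ENNReal.toReal_mul, ENNReal.toReal_ofReal hB, mul_comm] at h2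

/-- The local L¹ bound is combined with Hölder on the unit disc, after comparing the weight at `z`
with the weight at nearby points. The comparison is a hypothesis so that both signs of the exponent
are covered. -/
lemma wt_norm_le {α : ℝ} (hα : 1 / 2 ≤ α) {b c M : ℝ}
    (hbc : ∀ z w : ℂ, ‖w‖ ≤ 1 → b * lam α z ≤ c * lam α (z + w) + M) (j : ℕ)
    (p : ℝ≥0∞) [hp : Fact (1 ≤ p)] : ∃ C : ℝ, 0 ≤ C ∧ ∀ σ : ℂ → ℂ, InDomain σ →
      MemLp (weighted c α j σ) p →
      ∀ z, wt b α z * ‖proj j σ z‖ ≤ C * (eLpNorm (weighted c α j σ) p volume).toReal := by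
  obtain ⟨C, hC, h⟩ := MeanValue.norm_mul_hgauss_le j
  set D := Metric.ball (0 : ℂ) 1 with hD
  -- The Hölder factor `|D|^{1 - 1/p}`; for `p = ∞` the convention `∞.toReal = 0` gives the exponent
  -- 1.
  set V : ℝ≥0∞ := (volume.restrict D) Set.univ ^ (1 / (1 : ℝ≥0∞).toReal - 1 / p.toReal) with hV
  have hDtop : (volume.restrict D) Set.univ ≠ ⊤ := by
    rw [Measure.restrict_apply_univ]; exact measure_ball_lt_top.ne
  have hVtop : V ≠ ⊤ := by
    refine ENNReal.rpow_ne_top_of_nonneg ?_ hDtop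
    simp only [ENNReal.toReal_one, div_one, sub_nonneg]
    rcases eq_or_ne p ⊤ with rfl | hp'
    · simp
    · have : 1 ≤ p.toReal := by
        rw [← ENNReal.toReal_one]; exact ENNReal.toReal_mono hp' hp.out
      exact div_le_one_of_le₀ this (by linarith)
  refine ⟨C * Real.exp M * V.toReal, by positivity, fun σ hσ hmem z => ?_⟩
  have hmv := hσ.meanValue_proj j
  have h1 := h _ hmv z
  have hpc := hmv.1
  have hcw := continuous_wt c hα
  have hch := continuous_hgauss
  have ion : ∀ {f : ℂ → ℝ}, Continuous f → IntegrableOn f D := fun hf =>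
    (hf.continuousOn.integrableOn_compact (isCompact_closedBall 0 1)).mono_set
      Metric.ball_subset_closedBall
  have h2 : Real.exp (b * lam α z) * ∫ w in D, ‖proj j σ (z + w)‖ * hgauss (z + w) ≤
      Real.exp M * ∫ w in D, ‖weighted c α j σ (z + w)‖ := by
    simp_rw [norm_weighted]
    rw [← integral_const_mul, ← integral_const_mul]
    refine setIntegral_mono_on (ion (by fun_prop)) (ion (by fun_prop)) measurableSet_ball
      fun w hw => ?_
    have h3 := hbc z w (by simpa [hD] using (Metric.ball_subset_closedBall hw))
    have h4 : Real.exp (b * lam α z) ≤ Real.exp M * Real.exp (c * lam α (z + w)) := by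
      rw [← Real.exp_add]; exact Real.exp_le_exp.mpr (by linarith)
    have h5 := hgauss_pos (z + w)
    calc _ ≤ (Real.exp M * Real.exp (c * lam α (z + w))) *
          (‖proj j σ (z + w)‖ * hgauss (z + w)) := by gcongr
      _ = _ := by rw [wt]; ring
  have hwc : Continuous (weighted c α j σ) :=
    (Complex.continuous_ofReal.comp hcw).mul hpc
  have h3 : ∫ w in D, ‖weighted c α j σ (z + w)‖ ≤
      (eLpNorm (weighted c α j σ) p volume).toReal * V.toReal := by
    have hcomp : Continuous (weighted c α j σ ∘ fun w => z + w) := hwc.comp (by fun_prop)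
    have e1 : ∫ w in D, ‖weighted c α j σ (z + w)‖ =
        (eLpNorm (weighted c α j σ ∘ fun w => z + w) 1 (volume.restrict D)).toReal := by
      rw [eLpNorm_one_eq_lintegral_enorm, ← integral_norm_eq_lintegral_enorm
        hcomp.aestronglyMeasurable.restrict]
      rfl
    rw [e1, ← ENNReal.toReal_mul]
    refine ENNReal.toReal_mono (ENNReal.mul_ne_top hmem.2.ne hVtop) ?_
    refine (eLpNorm_le_eLpNorm_mul_rpow_measure_univ hp.out
      hcomp.aestronglyMeasurable.restrict).trans ?_
    refine mul_le_mul_left ?_ _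
    refine (eLpNorm_mono_measure _ Measure.restrict_le_self).trans_eq ?_
    exact eLpNorm_comp_measurePreserving hmem.1 (measurePreserving_add_left volume z)
  calc wt b α z * ‖proj j σ z‖ = Real.exp (b * lam α z) * (‖proj j σ z‖ * hgauss z) := by
        rw [wt]; ring
    _ ≤ Real.exp (b * lam α z) * (C * ∫ w in D, ‖proj j σ (z + w)‖ * hgauss (z + w)) := by
        gcongr
    _ = C * (Real.exp (b * lam α z) * ∫ w in D, ‖proj j σ (z + w)‖ * hgauss (z + w)) := by ring
    _ ≤ C * (Real.exp M * ((eLpNorm (weighted c α j σ) p volume).toReal * V.toReal)) := by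
        refine mul_le_mul_of_nonneg_left (h2.trans ?_) hC
        exact mul_le_mul_of_nonneg_left h3 (Real.exp_pos _).le
    _ = _ := by ring

lemma wt_norm_le_pos {α : ℝ} (hα : 1 / 2 ≤ α) (hα' : α ≤ 1) {a : ℝ} (ha : 0 < a) (j : ℕ)
    (p : ℝ≥0∞) [Fact (1 ≤ p)] : ∃ C : ℝ, 0 ≤ C ∧ ∀ σ : ℂ → ℂ, InDomain σ →
      MemLp (weighted (2 * a) α j σ) p →
      ∀ z, wt a α z * ‖proj j σ z‖ ≤ C * (eLpNorm (weighted (2 * a) α j σ) p volume).toReal := by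
  refine wt_norm_le hα (M := 2 * a) (fun z w hw => ?_) j p
  have h1 := lam_sub_le hα hα' z w
  have h2 := lam_le_one hα hw
  nlinarith

lemma wt_norm_le_neg {α : ℝ} (hα : 1 / 2 ≤ α) (hα' : α ≤ 1) {a : ℝ} (ha : 0 < a) (j : ℕ)
    (p : ℝ≥0∞) [Fact (1 ≤ p)] : ∃ C : ℝ, 0 ≤ C ∧ ∀ σ : ℂ → ℂ, InDomain σ →
      MemLp (weighted (-a) α j σ) p →
      ∀ z, wt (-(2 * a)) α z * ‖proj j σ z‖ ≤
        C * (eLpNorm (weighted (-a) α j σ) p volume).toReal := by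
  refine wt_norm_le hα (M := 2 * a) (fun z w hw => ?_) j p
  have h1 := lam_add_le hα hα' z w
  have h2 := lam_le_one hα hw
  nlinarith

/-- Passing from L^q to a pointwise bound costs `4a → 2a`; integrating that bound in L^p costs `2a →
a`. -/
lemma W_le_pos {α : ℝ} (hα : 1 / 2 ≤ α) (hα' : α ≤ 1) {a : ℝ} (ha : 0 < a) (n : ℕ)
    (p q : ℝ≥0∞) [Fact (1 ≤ p)] [Fact (1 ≤ q)] : W q n (4 * a) α ≤ W p n a α := by
  rintro σ ⟨hσ, h⟩
  refine ⟨hσ, fun j hj => ?_⟩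
  obtain ⟨C, hC, hC'⟩ := wt_norm_le_pos hα hα' (a := 2 * a) (by linarith) j q
  obtain ⟨K, hK, hK'⟩ := memLp_of_wt_le hα hα' (a := a) (b := 2 * a) (by linarith) p
  exact (hK' j σ _ (by positivity) (hσ.meanValue_proj j).1
    (hC' σ hσ (by convert h j hj using 2; ring))).1

lemma eLpNorm_weighted_le {α : ℝ} (hα : 1 / 2 ≤ α) (hα' : α ≤ 1) {a : ℝ} (ha : 0 < a) (j : ℕ)
    (p q : ℝ≥0∞) [Fact (1 ≤ p)] [Fact (1 ≤ q)] : ∃ C : ℝ, 0 ≤ C ∧ ∀ σ : ℂ → ℂ, InDomain σ →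
      MemLp (weighted (4 * a) α j σ) q →
      (eLpNorm (weighted a α j σ) p volume).toReal ≤
        C * (eLpNorm (weighted (4 * a) α j σ) q volume).toReal := by
  obtain ⟨C, hC, hC'⟩ := wt_norm_le_pos hα hα' (a := 2 * a) (by linarith) j q
  obtain ⟨K, hK, hK'⟩ := memLp_of_wt_le hα hα' (a := a) (b := 2 * a) (by linarith) p
  refine ⟨K * C, by positivity, fun σ hσ h => ?_⟩
  rw [show (2 : ℝ) * (2 * a) = 4 * a by ring] at hC'
  rw [mul_assoc]
  exact (hK' j σ _ (by positivity) (hσ.meanValue_proj j).1 (hC' σ hσ h)).2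

lemma continuous_proj {σ : ℂ → ℂ} (hσ : InDomain σ) (j : ℕ) : Continuous (proj j σ) :=
  (hσ.meanValue_proj j).1

/-! ### The pairing -/

lemma wt_mul_wt (a b α : ℝ) (z : ℂ) :
    wt a α z * wt b α z = Real.exp ((a + b) * lam α z) * rgauss z := by
  rw [wt, wt, ← hgauss_mul_self, add_mul, Real.exp_add]; ring

lemma norm_pairing_le {α a A B : ℝ} {j : ℕ} {σ F : ℂ → ℂ} {z : ℂ}
    (h1 : wt (3 * a) α z * ‖proj j σ z‖ ≤ A) (h2 : wt (-(2 * a)) α z * ‖proj j F z‖ ≤ B)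
    (hA : 0 ≤ A) :
    ‖proj j σ z * conj (proj j F z) * gauss z‖ ≤ A * B * Real.exp (-a * lam α z) := by
  rw [norm_mul, norm_mul, Complex.norm_conj, norm_gauss]
  -- The exponents `3a - 2a - a` cancel, leaving the integrable factor `e^{-a|z|^{1/α}}` as
  -- majorant.
  have h3 : rgauss z = wt (3 * a) α z * wt (-(2 * a)) α z * Real.exp (-a * lam α z) := by
    rw [wt_mul_wt, mul_right_comm, ← Real.exp_add]
    rw [show (3 * a + -(2 * a)) * lam α z + -a * lam α z = 0 by ring, Real.exp_zero, one_mul]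
  rw [h3]
  calc _ = (wt (3 * a) α z * ‖proj j σ z‖) * (wt (-(2 * a)) α z * ‖proj j F z‖) *
        Real.exp (-a * lam α z) := by ring
    _ ≤ _ := by
      have := wt_pos (-(2 * a)) α z
      gcongr

lemma pairing_bound {α : ℝ} (hα : 1 / 2 ≤ α) (hα' : α ≤ 1) {a : ℝ} (ha : 0 < a) {n : ℕ}
    (p q : ℝ≥0∞) [Fact (1 ≤ p)] [Fact (1 ≤ q)] {F : ℂ → ℂ} (hF : F ∈ W p n (-a) α) {j : ℕ}
    (hj : j ≤ n) : ∃ C : ℝ, 0 ≤ C ∧ ∀ σ ∈ W q n (6 * a) α,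
      Integrable (fun z => proj j σ z * conj (proj j F z) * gauss z) ∧
      ‖∫ z, proj j σ z * conj (proj j F z) * gauss z‖ ≤
        C * (eLpNorm (weighted (6 * a) α j σ) q volume).toReal := by
  obtain ⟨C, hC, hC'⟩ := wt_norm_le_pos hα hα' (a := 3 * a) (by linarith) j q
  rw [show (2 : ℝ) * (3 * a) = 6 * a by ring] at hC'
  obtain ⟨C₂, hC₂, hC₂'⟩ := wt_norm_le_neg hα hα' ha j p
  have hB := hC₂' F hF.1 (hF.2 j hj)
  set B := C₂ * (eLpNorm (weighted (-a) α j F) p volume).toReal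
  have hB0 : 0 ≤ B := by positivity
  have hE := integrable_exp_neg_lam hα hα' ha
  refine ⟨C * B * ∫ z : ℂ, Real.exp (-a * lam α z),
    mul_nonneg (by positivity) (integral_nonneg fun z => (Real.exp_pos _).le), fun σ hσ => ?_⟩
  have hA := hC' σ hσ.1 (hσ.2 j hj)
  set N := (eLpNorm (weighted (6 * a) α j σ) q volume).toReal
  have hN : 0 ≤ N := ENNReal.toReal_nonneg
  have hle : ∀ z, ‖proj j σ z * conj (proj j F z) * gauss z‖ ≤
      C * N * B * Real.exp (-a * lam α z) := fun z =>
    norm_pairing_le (hA z) (hB z) (by positivity)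
  have h1 := continuous_proj hσ.1 j
  have h2 := continuous_proj hF.1 j
  have h3 := continuous_gauss
  refine ⟨(hE.const_mul _).mono' (Continuous.aestronglyMeasurable (by fun_prop))
    (Filter.Eventually.of_forall hle), ?_⟩
  refine (norm_integral_le_of_norm_le (hE.const_mul (C * N * B))
    (Filter.Eventually.of_forall hle)).trans_eq ?_
  rw [integral_const_mul]; ring

/-! ### Polyanalytic functions -/

lemma dbar_add {f g : ℂ → ℂ} (hf : Differentiable ℝ f) (hg : Differentiable ℝ g) :
    dbar (fun z => f z + g z) = fun z => dbar f z + dbar g z := by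
  funext z
  simp only [dbar]
  rw [fderiv_fun_add (hf z) (hg z)]
  simp only [_root_.add_apply]
  ring

lemma dbar_sub {f g : ℂ → ℂ} (hf : Differentiable ℝ f) (hg : Differentiable ℝ g) :
    dbar (fun z => f z - g z) = fun z => dbar f z - dbar g z := by
  funext z
  simp only [dbar]
  rw [fderiv_fun_sub (hf z) (hg z)]
  simp only [_root_.sub_apply]
  ring

lemma dbar_sum {ι : Type*} (s : Finset ι) {f : ι → ℂ → ℂ} (hf : ∀ i, Differentiable ℝ (f i)) :
    dbar (fun z => ∑ i ∈ s, f i z) = fun z => ∑ i ∈ s, dbar (f i) z := by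
  classical
  induction s using Finset.induction_on with
  | empty => funext z; simp [dbar]
  | insert i s hi ih =>
    simp_rw [Finset.sum_insert hi]
    rw [dbar_add (hf i) (Differentiable.fun_sum fun i _ => hf i), ih]

lemma dbar_eq_zero {f : ℂ → ℂ} (hf : Differentiable ℂ f) (z : ℂ) : dbar f z = 0 := by
  have h := (differentiableAt_complex_iff_differentiableAt_real.mp (hf z)).2
  rw [dbar, h, smul_eq_mul, ← mul_assoc, Complex.I_mul_I]
  ring

lemma differentiable_of_dbar_eq_zero {f : ℂ → ℂ} (hf : Differentiable ℝ f)
    (h : ∀ z, dbar f z = 0) : Differentiable ℂ f := by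
  intro z
  refine differentiableAt_complex_iff_differentiableAt_real.mpr ⟨hf z, ?_⟩
  have h1 := h z
  rw [dbar, div_eq_zero_iff] at h1
  have h2 : fderiv ℝ f z 1 + Complex.I * fderiv ℝ f z Complex.I = 0 := by simpa using h1
  have h3 : Complex.I * Complex.I = -1 := Complex.I_mul_I
  rw [smul_eq_mul]
  linear_combination (-Complex.I) * h2 + fderiv ℝ f z Complex.I * h3

lemma dbar_conj_pow_mul {h : ℂ → ℂ} (hh : Differentiable ℂ h) (k : ℕ) (z : ℂ) :
    dbar (fun z => conj z ^ k * h z) z = k * conj z ^ (k - 1) * h z := by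
  have h1 : HasFDerivAt (fun z : ℂ => conj z) (Complex.conjCLE : ℂ →L[ℝ] ℂ) z :=
    Complex.conjCLE.hasFDerivAt
  have h2 : HasFDerivAt (fun z : ℂ => conj z ^ k * h z) _ z :=
    (h1.pow k).mul (hh.restrictScalars ℝ z).hasFDerivAt
  have h3 := dbar_eq_zero hh z
  rw [dbar] at h3
  rw [dbar, h2.fderiv]
  simp only [_root_.add_apply, _root_.smul_apply, smul_eq_mul,
    nsmul_eq_mul, ContinuousLinearEquiv.coe_coe, Complex.conjCLE_apply, map_one, Complex.conj_I]
  have h4 : Complex.I * Complex.I = -1 := Complex.I_mul_I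
  linear_combination conj z ^ k * h3 - (h z * k * conj z ^ (k - 1) / 2) * h4

lemma contDiff_dbar {f : ℂ → ℂ} (hf : ContDiff ℝ ∞ f) : ContDiff ℝ ∞ (dbar f) := by
  have h1 : ContDiff ℝ ∞ (fderiv ℝ f) := hf.fderiv_right (by norm_cast)
  unfold dbar
  exact ((h1.clm_apply contDiff_const).add
    (contDiff_const.mul (h1.clm_apply contDiff_const))).div_const _

lemma contDiff_of_entire {h : ℂ → ℂ} (hh : Differentiable ℂ h) : ContDiff ℝ ∞ h :=
  (hh.contDiff (n := ∞)).restrict_scalars ℝ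

lemma contDiff_conj_pow_mul {h : ℂ → ℂ} (hh : Differentiable ℂ h) (k : ℕ) :
    ContDiff ℝ ∞ fun z => conj z ^ k * h z :=
  (Complex.conjCLE.contDiff.pow k).mul (contDiff_of_entire hh)

lemma contDiff_sum_conj_pow {h : ℕ → ℂ → ℂ} (hh : ∀ k, Differentiable ℂ (h k)) (N : ℕ) :
    ContDiff ℝ ∞ fun z => ∑ k ∈ Finset.range N, conj z ^ k * h k z :=
  ContDiff.sum fun k _ => contDiff_conj_pow_mul (hh k) k

lemma dbar_sum_conj_pow {h : ℕ → ℂ → ℂ} (hh : ∀ k, Differentiable ℂ (h k)) (N : ℕ) :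
    dbar (fun z => ∑ k ∈ Finset.range (N + 1), conj z ^ k * h k z) =
      fun z => ∑ k ∈ Finset.range N, conj z ^ k * ((k + 1) * h (k + 1) z) := by
  rw [dbar_sum _ fun k => (contDiff_conj_pow_mul (hh k) k).differentiable (by simp)]
  funext z
  simp_rw [dbar_conj_pow_mul (hh _)]
  rw [Finset.sum_range_succ']
  simp only [Nat.cast_zero, zero_mul, add_zero, Nat.add_sub_cancel]
  refine Finset.sum_congr rfl fun k _ => ?_
  push_cast; ring

lemma isPolyanalytic_sum_conj_pow {h : ℕ → ℂ → ℂ} (hh : ∀ k, Differentiable ℂ (h k)) (N : ℕ) :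
    IsPolyanalytic N fun z => ∑ k ∈ Finset.range N, conj z ^ k * h k z := by
  refine ⟨contDiff_sum_conj_pow hh N, ?_⟩
  induction N generalizing h with
  | zero => intro z; simp
  | succ N ih =>
    intro z
    rw [Function.iterate_succ_apply, dbar_sum_conj_pow hh]
    exact ih (h := fun k z => (k + 1) * h (k + 1) z) (fun k => (hh (k + 1)).const_mul _) z

/-- Induction on the order: decompose `∂_{z̄} F`, take an explicit `∂_{z̄}`-primitive of it, and
note that `F` minus this primitive is entire. -/
lemma IsPolyanalytic.exists_eq_sum {N : ℕ} {F : ℂ → ℂ} (hF : IsPolyanalytic N F) :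
    ∃ h : ℕ → ℂ → ℂ, (∀ k, Differentiable ℂ (h k)) ∧
      ∀ z, F z = ∑ k ∈ Finset.range N, conj z ^ k * h k z := by
  induction N generalizing F with
  | zero => exact ⟨fun _ _ => 0, fun _ => differentiable_const _, fun z => by simpa using hF.2 z⟩
  | succ N ih =>
    obtain ⟨g, hg, hg'⟩ := ih (F := dbar F) ⟨contDiff_dbar hF.1, hF.2⟩
    -- The primitive of `z̄^k g_k` is `z̄^{k+1} g_k / (k+1)`, so the indices shift by one.
    set h₁ : ℕ → ℂ → ℂ := fun k => match k with
      | 0 => fun _ => 0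
      | k + 1 => fun z => (k + 1 : ℂ)⁻¹ * g k z with hh₁
    have hd : ∀ k, Differentiable ℂ (h₁ k) := by
      rintro (_ | k)
      · exact differentiable_const _
      · exact (hg k).const_mul _
    set H : ℂ → ℂ := fun z => ∑ k ∈ Finset.range (N + 1), conj z ^ k * h₁ k z with hH
    have hHs : ContDiff ℝ ∞ H := contDiff_sum_conj_pow hd _
    have hHd : dbar H = dbar F := by
      rw [hH, dbar_sum_conj_pow hd]
      funext z
      rw [hg']
      refine Finset.sum_congr rfl fun k _ => ?_
      have : (k + 1 : ℂ) ≠ 0 := by exact_mod_cast k.succ_ne_zero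
      simp only [hh₁]
      rw [mul_inv_cancel_left₀ this]
    have h0 : Differentiable ℂ fun z => F z - H z := by
      have d1 := hF.1.differentiable (by simp)
      have d2 := hHs.differentiable (by simp)
      refine differentiable_of_dbar_eq_zero (d1.sub d2) fun z => ?_
      rw [dbar_sub d1 d2, hHd]
      exact sub_self _
    refine ⟨fun k => match k with
      | 0 => fun z => F z - H z
      | k + 1 => h₁ (k + 1), ?_, fun z => ?_⟩
    · rintro (_ | k)
      · exact h0
      · exact hd (k + 1)
    · have e : H z = ∑ k ∈ Finset.range N, conj z ^ (k + 1) * h₁ (k + 1) z := by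
        rw [hH]
        simp only
        rw [Finset.sum_range_succ']
        simp [hh₁]
      rw [Finset.sum_range_succ', ← e]
      simp

lemma IsPolyanalytic.sub {N : ℕ} {F G : ℂ → ℂ} (hF : IsPolyanalytic N F)
    (hG : IsPolyanalytic N G) : IsPolyanalytic N (F - G) := by
  obtain ⟨f, hf, hf'⟩ := hF.exists_eq_sum
  obtain ⟨g, hg, hg'⟩ := hG.exists_eq_sum
  have : F - G = fun z => ∑ k ∈ Finset.range N, conj z ^ k * (f k z - g k z) := by
    funext z
    simp [hf', hg', mul_sub]
  rw [this]
  exact isPolyanalytic_sum_conj_pow (h := fun k z => f k z - g k z) (fun k => (hf k).sub (hg k)) N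

lemma isPolyanalytic_sum {n : ℕ} {F : ℕ → ℂ → ℂ}
    (hF : ∀ j ≤ n, ∃ h : ℕ → ℂ → ℂ, (∀ k, Differentiable ℂ (h k)) ∧
      ∀ ζ, F j ζ = ∑ k ∈ Finset.range (j + 1), conj ζ ^ k * h k ζ) :
    IsPolyanalytic (n + 1) fun z => ∑ j ∈ Finset.range (n + 1), F j z := by
  choose! h hd he using hF
  have : (fun z => ∑ j ∈ Finset.range (n + 1), F j z) = fun z =>
      ∑ k ∈ Finset.range (n + 1), conj z ^ k *
        ∑ j ∈ Finset.range (n + 1), if k ≤ j then h j k z else 0 := by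
    funext z
    simp_rw [Finset.mul_sum]
    rw [Finset.sum_comm]
    refine Finset.sum_congr rfl fun j hj => ?_
    have hj' : j ≤ n := by simp at hj; omega
    rw [he j hj']
    rw [← Finset.sum_subset (Finset.range_mono (by omega : j + 1 ≤ n + 1))]
    · refine Finset.sum_congr rfl fun k hk => ?_
      rw [if_pos (by simp at hk; omega)]
    · intro k _ hk
      rw [if_neg (by simp at hk; omega), mul_zero]
  rw [this]
  refine isPolyanalytic_sum_conj_pow
    (h := fun k z => ∑ j ∈ Finset.range (n + 1), if k ≤ j then h j k z else 0) (fun k => ?_) _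
  refine Differentiable.fun_sum fun j hj => ?_
  split_ifs
  · exact hd j (by simp at hj; omega) k
  · exact differentiable_const _

lemma integral_cis_conj_pow_mul {g : ℂ → ℂ} (hg : Differentiable ℂ g) (i : ℕ) :
    ∃ q : ℂ, ∀ w, ∫ θ in (0 : ℝ)..(2 * Real.pi), conj (cis θ * w) ^ i * g (cis θ * w) =
      2 * Real.pi * ((‖w‖ : ℂ) ^ 2) ^ i * q := by
  refine ⟨(i.factorial : ℂ)⁻¹ * iteratedDeriv i g 0, fun w => ?_⟩
  refine integral_cis_hasSum (c := fun m => (m.factorial : ℂ)⁻¹ * iteratedDeriv m g 0)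
    (fun z => ?_) i w
  have h1 := Complex.hasSum_taylorSeries_of_entire hg 0 z
  have h2 : ∀ m : ℕ, (m.factorial : ℂ)⁻¹ • (z - 0) ^ m • iteratedDeriv m g 0 =
      (m.factorial : ℂ)⁻¹ * iteratedDeriv m g 0 * z ^ m := fun m => by
    rw [sub_zero, smul_eq_mul, smul_eq_mul]; ring
  simpa only [h2] using h1

/-- The alternating sum of the equations over `k` isolates `a 0`, because `∑ (-1)^k C(i,k) = 0` for
`i > 0`. -/
lemma eq_zero_of_sum_choose_eq_zero {n : ℕ} {a : ℕ → ℂ}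
    (h : ∀ k ≤ n, ∑ i ∈ Finset.range (n + 1), a i * (i.choose k : ℂ) = 0) : a 0 = 0 := by
  have h1 : ∑ k ∈ Finset.range (n + 1), (-1 : ℂ) ^ k *
      ∑ i ∈ Finset.range (n + 1), a i * (i.choose k : ℂ) = 0 :=
    Finset.sum_eq_zero fun k hk => by rw [h k (by simp at hk; omega), mul_zero]
  simp_rw [Finset.mul_sum] at h1
  rw [Finset.sum_comm] at h1
  have h2 : ∀ i ∈ Finset.range (n + 1), ∑ k ∈ Finset.range (n + 1),
      (-1 : ℂ) ^ k * (a i * (i.choose k : ℂ)) = if i = 0 then a i else 0 := by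
    intro i hi
    have h3 := congrArg (Int.cast : ℤ → ℂ) (Int.alternating_sum_range_choose (n := i))
    push_cast at h3
    have h4 : ∑ k ∈ Finset.range (n + 1), (-1 : ℂ) ^ k * (i.choose k : ℂ) =
        ∑ k ∈ Finset.range (i + 1), (-1 : ℂ) ^ k * (i.choose k : ℂ) := by
      symm
      refine Finset.sum_subset (Finset.range_mono (by simp at hi; omega)) fun k _ hk => ?_
      rw [Nat.choose_eq_zero_of_lt (by simp at hk; omega)]; simp
    have h5 : ∑ k ∈ Finset.range (n + 1), (-1 : ℂ) ^ k * (a i * (i.choose k : ℂ)) =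
        a i * ∑ k ∈ Finset.range (n + 1), (-1 : ℂ) ^ k * (i.choose k : ℂ) := by
      rw [Finset.mul_sum]
      exact Finset.sum_congr rfl fun k _ => by ring
    rw [h5, h4, h3]
    split_ifs <;> simp
  rw [Finset.sum_congr rfl h2, Finset.sum_ite_eq' (Finset.range (n + 1)) 0 a] at h1
  simpa using h1

/-- A polyanalytic function of order `n + 1` all of whose components vanish is zero. -/
lemma IsPolyanalytic.eq_zero {n : ℕ} {F : ℂ → ℂ} (hF : IsPolyanalytic (n + 1) F)
    (hD : InDomain F) (h0 : ∀ j ≤ n, proj j F = 0) : F = 0 := by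
  obtain ⟨h, hd, he⟩ := hF.exists_eq_sum
  funext ζ
  -- These are the holomorphic coefficients of `v̄^i` in the twisted function `F(ζ + v) e^{-π ζ̄
  -- v}`. Its rotation average is then a polynomial in `‖w‖²` with coefficients `q i`, up to `2π`.
  set g : ℕ → ℂ → ℂ := fun i v => ∑ k ∈ Finset.range (n + 1),
    (k.choose i : ℂ) * conj ζ ^ (k - i) * (h k (ζ + v) * Complex.exp (-Real.pi * conj ζ * v))
    with hg
  have hgd : ∀ i, Differentiable ℂ (g i) := by
    intro i
    refine Differentiable.fun_sum fun k _ => ?_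
    refine (Differentiable.mul ?_ ?_).const_mul _
    · exact (hd k).comp ((differentiable_const ζ).add differentiable_id)
    · fun_prop
  choose q hq using fun i => integral_cis_conj_pow_mul (hgd i) i
  have e1 : ∀ v, F (ζ + v) * Complex.exp (-Real.pi * conj ζ * v) =
      ∑ i ∈ Finset.range (n + 1), conj v ^ i * g i v := by
    intro v
    rw [he, Finset.sum_mul]
    simp only [hg, Finset.mul_sum]
    rw [Finset.sum_comm]
    refine Finset.sum_congr rfl fun k hk => ?_
    have : conj (ζ + v) ^ k = ∑ i ∈ Finset.range (n + 1),
        conj v ^ i * conj ζ ^ (k - i) * k.choose i := by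
      rw [map_add, add_comm, add_pow]
      refine Finset.sum_subset (Finset.range_mono (by simp at hk; omega)) fun i _ hi => ?_
      rw [Nat.choose_eq_zero_of_lt (by simp at hi; omega)]; simp
    rw [this, Finset.sum_mul, Finset.sum_mul]
    exact Finset.sum_congr rfl fun i _ => by ring
  have e2 : ∀ w, ∫ θ in (0 : ℝ)..(2 * Real.pi),
      F (ζ + cis θ * w) * Complex.exp (-Real.pi * conj ζ * (cis θ * w)) =
      2 * Real.pi * ∑ i ∈ Finset.range (n + 1), ((‖w‖ : ℂ) ^ 2) ^ i * q i := by
    intro w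
    simp_rw [e1]
    rw [intervalIntegral.integral_finsetSum, Finset.mul_sum]
    · exact Finset.sum_congr rfl fun i _ => by rw [hq, mul_assoc]
    · intro i _
      have h1 := (hgd i).continuous
      have h2 := continuous_cis
      exact Continuous.intervalIntegrable (by fun_prop) _ _
  have hpi : (2 * Real.pi : ℂ) ≠ 0 := by simp [Real.pi_ne_zero]
  have hF0 : F ζ = q 0 := by
    have := e2 0
    simp only [mul_zero, add_zero, Complex.exp_zero, mul_one, intervalIntegral.integral_const,
      sub_zero, norm_zero, Finset.sum_range_succ', pow_succ, zero_mul, pow_zero, one_mul,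
      Finset.sum_const_zero, zero_add, Complex.ofReal_zero] at this
    rw [Complex.real_smul] at this
    push_cast at this
    exact mul_left_cancel₀ hpi this
  -- Vanishing of `P^k F` at `ζ` says that this radial polynomial is orthogonal to `φ_k`. The moment
  -- formula turns this into a binomial system that forces `q 0 = F ζ` to vanish.
  have key : ∀ k ≤ n, ∑ i ∈ Finset.range (n + 1),
      (q i / Real.pi ^ i * i.factorial) * (i.choose k : ℂ) = 0 := by
    intro k hk
    have h1 := integral_eq_integral_rotate (integrable_shift (hD k ζ))
    rw [← proj_eq_integral_shift, h0 k hk, Pi.zero_apply, mul_zero] at h1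
    simp_rw [phi_cis_mul, rgauss_cis_mul, intervalIntegral.integral_mul_const, e2] at h1
    have e3 : ∀ w : ℂ, 2 * Real.pi * (∑ i ∈ Finset.range (n + 1), ((‖w‖ : ℂ) ^ 2) ^ i * q i) *
        ((phi k w * rgauss w : ℝ) : ℂ) = ∑ i ∈ Finset.range (n + 1),
        (2 * Real.pi * (q i / Real.pi ^ i)) *
          (((Real.pi * ‖w‖ ^ 2) ^ i * phi k w * rgauss w : ℝ) : ℂ) := by
      intro w
      rw [mul_assoc, Finset.sum_mul, Finset.mul_sum]
      refine Finset.sum_congr rfl fun i _ => ?_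
      push_cast
      rw [mul_pow]
      field_simp
    simp_rw [e3] at h1
    rw [integral_finsetSum _ fun i _ => ((integral_pow_mul_phi i k).1.ofReal).const_mul _] at h1
    simp_rw [integral_const_mul, integral_complex_ofReal, (integral_pow_mul_phi _ k).2] at h1
    have e4 : ∑ i ∈ Finset.range (n + 1), (2 * Real.pi * (q i / Real.pi ^ i)) *
        ((i.factorial * ((-1) ^ k * i.choose k) : ℝ) : ℂ) = (2 * Real.pi * (-1) ^ k) *
        ∑ i ∈ Finset.range (n + 1), (q i / Real.pi ^ i * i.factorial) * (i.choose k : ℂ) := by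
      rw [Finset.mul_sum]
      refine Finset.sum_congr rfl fun i _ => ?_
      push_cast; ring
    rw [e4] at h1
    exact (mul_eq_zero.mp h1).resolve_left (mul_ne_zero hpi (by simp))
  have := eq_zero_of_sum_choose_eq_zero key
  simpa [hF0] using this

/-! ### Gaussian domination -/

/-- The exponent `b|z|^{1/α}` is dominated by the Gaussian `e^{-(π/2)|z|²}`. -/
def Good (b α : ℝ) : Prop :=
  ∃ c < Real.pi / 2, ∃ K : ℝ, ∀ z : ℂ, b * lam α z ≤ c * ‖z‖ ^ 2 + K

lemma good_of_half_lt {α : ℝ} (hα : 1 / 2 < α) (b : ℝ) : Good b α := by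
  have hα0 : 0 < α := by linarith
  have hθ : 1 / α < 2 := by rw [div_lt_iff₀ hα0]; linarith
  have hθ0 : 0 < 1 / α := by positivity
  -- Beyond `X` the power `|z|^{2 - 1/α}` exceeds `|b|`, so the quadratic term wins with constant `1
  -- < π/2`.
  set X : ℝ := |b| ^ (1 / (2 - 1 / α)) with hX
  have hX0 : 0 ≤ X := by positivity
  refine ⟨1, by linarith [Real.pi_gt_three], |b| * (X + 1) ^ (1 / α), fun z => ?_⟩
  have h1 : b * lam α z ≤ |b| * lam α z := mul_le_mul_of_nonneg_right (le_abs_self b)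
    (lam_nonneg α z)
  refine h1.trans ?_
  rcases le_total ‖z‖ (X + 1) with h | h
  · have : |b| * lam α z ≤ |b| * (X + 1) ^ (1 / α) := by
      unfold lam; gcongr
    nlinarith [sq_nonneg ‖z‖]
  · have hz : 0 < ‖z‖ := by linarith
    have h2 : |b| ≤ ‖z‖ ^ (2 - 1 / α) := by
      have h3 : X ^ (2 - 1 / α) = |b| := by
        rw [hX, ← Real.rpow_mul (abs_nonneg b), one_div_mul_cancel (by linarith), Real.rpow_one]
      rw [← h3]
      exact Real.rpow_le_rpow hX0 (by linarith) (by linarith)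
    have h4 : |b| * lam α z ≤ ‖z‖ ^ 2 := by
      calc |b| * lam α z ≤ ‖z‖ ^ (2 - 1 / α) * ‖z‖ ^ (1 / α) := by unfold lam; gcongr
        _ = ‖z‖ ^ 2 := by
          rw [← Real.rpow_add hz, sub_add_cancel, Real.rpow_two]
    have : 0 ≤ |b| * (X + 1) ^ (1 / α) := by positivity
    linarith

lemma good_of_le_one {α : ℝ} (hα : 1 / 2 ≤ α) {b : ℝ} (hb : 0 ≤ b) (hb' : b ≤ 1) :
    Good b α := by
  refine ⟨1, by linarith [Real.pi_gt_three], 1, fun z => ?_⟩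
  have h0 := lam_nonneg α z
  have h1 : lam α z ≤ ‖z‖ ^ 2 + 1 := by
    rcases le_total ‖z‖ 1 with h | h
    · have := lam_le_one hα h
      nlinarith [sq_nonneg ‖z‖]
    · have : lam α z ≤ ‖z‖ ^ (2 : ℝ) :=
        Real.rpow_le_rpow_of_exponent_le h (one_div_le_two hα)
      rw [Real.rpow_two] at this
      linarith
  nlinarith

lemma Good.mono {α b b' : ℝ} (h : Good b α) (hb : b' ≤ b) : Good b' α := by
  obtain ⟨c, hc, K, hK⟩ := h
  exact ⟨c, hc, K, fun z => (mul_le_mul_of_nonneg_right hb (lam_nonneg α z)).trans (hK z)⟩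

lemma Good.exp_mul_hgauss_le {α b : ℝ} (h : Good b α) (R : ℝ) :
    ∃ M : ℝ, 0 ≤ M ∧ ∀ z : ℂ, Real.exp (b * lam α z) * Real.exp (R * ‖z‖) * hgauss z ≤
      M * Real.exp (-‖z‖) := by
  obtain ⟨c, hc, K, hK⟩ := h
  have hd : 0 < Real.pi / 2 - c := by linarith
  refine ⟨Real.exp (K + (R + 1) ^ 2 / (4 * (Real.pi / 2 - c))), (Real.exp_pos _).le, fun z => ?_⟩
  rw [hgauss, ← Real.exp_add, ← Real.exp_add, ← Real.exp_add]
  apply Real.exp_le_exp.mpr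
  have h1 := hK z
  set d := Real.pi / 2 - c with hd'
  -- The strict gap `d` below `π/2` absorbs any linear exponent by completing the square.
  have h2 : (R + 1) * ‖z‖ ≤ d * ‖z‖ ^ 2 + (R + 1) ^ 2 / (4 * d) := by
    have h3 : 0 ≤ d * (‖z‖ - (R + 1) / (2 * d)) ^ 2 := by positivity
    have h4 : d * (‖z‖ - (R + 1) / (2 * d)) ^ 2 =
        d * ‖z‖ ^ 2 + (R + 1) ^ 2 / (4 * d) - (R + 1) * ‖z‖ := by
      field_simp; ring
    linarith
  have h5 : Real.pi / 2 * ‖z‖ ^ 2 = c * ‖z‖ ^ 2 + d * ‖z‖ ^ 2 := by rw [hd']; ring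
  linarith

lemma integrable_exp_neg_norm : Integrable fun z : ℂ => Real.exp (-‖z‖) := by
  have := integrable_exp_neg_lam (α := 1) (by norm_num) le_rfl one_pos
  simpa [lam] using this

lemma integrable_exp_neg_norm_sq : Integrable fun z : ℂ => Real.exp (-‖z‖) ^ 2 := by
  refine integrable_exp_neg_norm.mono' (by fun_prop) (Filter.Eventually.of_forall fun z => ?_)
  have h1 : Real.exp (-‖z‖) ≤ 1 := Real.exp_le_one_iff.mpr (by simp)
  have h2 := Real.exp_pos (-‖z‖)
  rw [Real.norm_of_nonneg (by positivity)]
  nlinarith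

lemma expInt_of_wt_le {α b B : ℝ} {G : ℂ → ℂ} (hG : AEStronglyMeasurable G)
    (hg : Good b α) (h : ∀ z, wt (-b) α z * ‖G z‖ ≤ B) : ExpInt G := by
  refine ⟨hG, fun R => ?_⟩
  obtain ⟨M, hM, hb⟩ := hg.exp_mul_hgauss_le R
  have hr := continuous_rgauss
  refine (integrable_exp_neg_norm.const_mul (B * M)).mono'
    (hG.norm.mul (Continuous.aestronglyMeasurable (by fun_prop)))
    (Filter.Eventually.of_forall fun z => ?_)
  have h0 := rgauss_pos z
  have h1 := hgauss_pos z
  have hB : 0 ≤ B := (mul_nonneg (wt_pos _ _ _).le (norm_nonneg _)).trans (h z)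
  rw [Real.norm_of_nonneg (by positivity)]
  calc ‖G z‖ * (Real.exp (R * ‖z‖) * rgauss z)
      = (wt (-b) α z * ‖G z‖) *
        (Real.exp (b * lam α z) * Real.exp (R * ‖z‖) * hgauss z) := by
        have : Real.exp (-b * lam α z) * Real.exp (b * lam α z) = 1 := by
          rw [← Real.exp_add]; simp
        rw [wt, ← hgauss_mul_self]
        linear_combination (-(‖G z‖ * Real.exp (R * ‖z‖) * hgauss z * hgauss z)) * this
    _ ≤ B * (M * Real.exp (-‖z‖)) := by
        have := hb z
        have := h z
        gcongr
    _ = _ := by ring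

/-! ### The reproducing kernels as elements of the spaces -/

lemma wt_kernel_le {α b : ℝ} (hg : Good b α) (j : ℕ) (ζ : ℂ) :
    ∃ B : ℝ, 0 ≤ B ∧ ∀ z, wt b α z * ‖kernel j z ζ‖ ≤ B := by
  obtain ⟨C, hC, h⟩ := norm_kernel_le j
  obtain ⟨M, hM, hb⟩ := hg.exp_mul_hgauss_le (Real.pi * ‖ζ‖ + 1)
  refine ⟨C * Real.exp ‖ζ‖ * M, by positivity, fun z => ?_⟩
  have h1 : ‖kernel j z ζ‖ = ‖kernel j ζ z‖ := by rw [← kernel_conj, Complex.norm_conj]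
  have h2 := h ‖ζ‖ ζ z le_rfl
  have h3 := (hb z).trans (mul_le_of_le_one_right hM (Real.exp_le_one_iff.mpr (by simp)))
  rw [h1]
  calc wt b α z * ‖kernel j ζ z‖ ≤ wt b α z *
        (C * Real.exp ‖ζ‖ * Real.exp ((Real.pi * ‖ζ‖ + 1) * ‖z‖)) :=
        mul_le_mul_of_nonneg_left h2 (wt_pos _ _ _).le
    _ = C * Real.exp ‖ζ‖ * (Real.exp (b * lam α z) *
        Real.exp ((Real.pi * ‖ζ‖ + 1) * ‖z‖) * hgauss z) := by rw [wt]; ring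
    _ ≤ _ := by gcongr

lemma inDomain_kernel (j : ℕ) (ζ : ℂ) : InDomain fun z => kernel j z ζ := by
  have hg : Good 0 1 := good_of_half_lt (by norm_num) 0
  obtain ⟨B, _, hB⟩ := wt_kernel_le hg j ζ
  exact (expInt_of_wt_le (continuous_kernel_comp j continuous_id
    continuous_const).aestronglyMeasurable hg (by simpa using hB)).inDomain

lemma proj_kernel (j k : ℕ) (ζ : ℂ) :
    proj k (fun z => kernel j z ζ) = fun z => if j = k then kernel j z ζ else 0 := by
  funext z
  exact (meanValue_kernel j ζ).proj_eq z (inDomain_kernel j ζ k z)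

lemma kernel_mem_W {α : ℝ} (hα : 1 / 2 ≤ α) (hα' : α ≤ 1) {a b : ℝ} (hab : a < b)
    (hg : Good b α) (q : ℝ≥0∞) [Fact (1 ≤ q)] (n j : ℕ) (ζ : ℂ) :
    (fun z => kernel j z ζ) ∈ W q n a α := by
  refine ⟨inDomain_kernel j ζ, fun k _ => ?_⟩
  obtain ⟨B, hB, h⟩ := wt_kernel_le hg j ζ
  obtain ⟨K, hK, hK'⟩ := memLp_of_wt_le hα hα' hab q
  refine (hK' k _ B hB (continuous_proj (inDomain_kernel j ζ) k) fun z => ?_).1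
  rw [proj_kernel]
  split_ifs
  · exact h z
  · simpa using hB

/-- Pairing with a reproducing kernel evaluates `P^j P^j F`, up to conjugation. Absolute convergence
of the pairing supplies the integrability needed for the reproducing property, so no growth bound on
`P^j F` is required. -/
lemma apply_kernel_of_represents {n : ℕ} {S : Submodule ℂ (ℂ → ℂ)} {F : ℂ → ℂ}
    {u : S →ₗ[ℂ] ℂ} (hF : InDomain F) (h : Represents n F u) {j : ℕ} (hj : j ≤ n) {ζ : ℂ}
    (hK : (fun z => kernel j z ζ) ∈ S) : u ⟨_, hK⟩ = conj (proj j F ζ) := by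
  obtain ⟨hi, he⟩ := h ⟨_, hK⟩
  simp only [proj_kernel] at hi he
  have e1 : ∀ z, conj (kernel j z ζ * conj (proj j F z) * gauss z) =
      proj j F z * kernel j ζ z * gauss z := by
    intro z
    rw [map_mul, map_mul, kernel_conj, Complex.conj_conj, gauss_eq, Complex.conj_ofReal]
    ring
  have hi' : Integrable fun z => proj j F z * kernel j ζ z * gauss z := by
    have h1 := hi j hj
    simp only [if_true] at h1
    have h2 : Integrable fun z => conj (kernel j z ζ * conj (proj j F z) * gauss z) :=
      (Complex.conjCLE : ℂ →L[ℝ] ℂ).integrable_comp h1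
    simpa only [e1] using h2
  have h3 := (hF.meanValue_proj j).proj_eq ζ hi'
  rw [if_pos rfl] at h3
  rw [he, Finset.sum_eq_single j]
  · simp only [if_true]
    rw [← h3, proj, ← integral_conj]
    congr 1; funext z
    rw [← e1, Complex.conj_conj]
  · intro k _ hk; simp [hk.symm]
  · intro h; simp at h; omega

lemma proj_eq_of_represents {n : ℕ} {S : Submodule ℂ (ℂ → ℂ)} {F₁ F₂ : ℂ → ℂ}
    {u : S →ₗ[ℂ] ℂ} (hF₁ : InDomain F₁) (hF₂ : InDomain F₂) (h₁ : Represents n F₁ u)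
    (h₂ : Represents n F₂ u) (hK : ∀ j ζ, (fun z => kernel j z ζ) ∈ S) :
    ∀ j ≤ n, proj j F₁ = proj j F₂ := by
  intro j hj
  funext ζ
  have h1 := apply_kernel_of_represents hF₁ h₁ hj (hK j ζ)
  have h2 := apply_kernel_of_represents hF₂ h₂ hj (hK j ζ)
  exact (starRingEnd ℂ).injective (h1.symm.trans h2)

lemma eq_of_proj_eq {n : ℕ} {F₁ F₂ : ℂ → ℂ} (hF₁ : InDomain F₁) (hF₂ : InDomain F₂)
    (h : ∀ j ≤ n, proj j F₁ = proj j F₂) (hp₁ : IsPolyanalytic (n + 1) F₁)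
    (hp₂ : IsPolyanalytic (n + 1) F₂) : F₁ = F₂ := by
  have e : F₁ - F₂ = F₁ + (-1 : ℂ) • F₂ := by funext z; simp [sub_eq_add_neg]
  have h2 : InDomain ((-1 : ℂ) • F₂) := fun j ζ => by
    refine ((hF₂ j ζ).const_mul (-1)).congr (Filter.Eventually.of_forall fun z => ?_)
    simp only [Pi.smul_apply, smul_eq_mul]; ring
  have hd : InDomain (F₁ + (-1 : ℂ) • F₂) := fun j ζ => by
    refine ((hF₁ j ζ).add (h2 j ζ)).congr (Filter.Eventually.of_forall fun z => ?_)
    simp only [Pi.add_apply]; ring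
  refine sub_eq_zero.mp ((hp₁.sub hp₂).eq_zero (e ▸ hd) fun j hj => ?_)
  rw [e, proj_add j hF₁ h2, proj_smul, h j hj]
  simp

/-! ### Vanishing of rapidly decreasing components -/

/-- A polynomial tending to 0 at infinity is zero, while `L_j(0) = 1`. -/
lemma eq_zero_of_abs_lag_mul_le {j : ℕ} {c C : ℝ}
    (h : ∀ x : ℝ, 0 ≤ x → |lag j x| * c ≤ C * Real.exp (-x)) (hc : 0 ≤ c) : c = 0 := by
  by_contra hne
  have hc' : 0 < c := lt_of_le_of_ne hc (Ne.symm hne)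
  set P : Polynomial ℝ := ∑ k ∈ Finset.range (j + 1),
    Polynomial.C ((j.choose k : ℝ) * (-1) ^ k / (k.factorial : ℝ)) * Polynomial.X ^ k with hP
  have hev : ∀ x, P.eval x = lag j x := by
    intro x
    rw [hP, Polynomial.eval_finsetSum, lag]
    refine Finset.sum_congr rfl fun k _ => ?_
    rw [Polynomial.eval_mul, Polynomial.eval_C, Polynomial.eval_pow, Polynomial.eval_X, neg_pow x]
    ring
  have ht : Filter.Tendsto (fun x => P.eval x) Filter.atTop (𝓝 0) := by
    have h1 : Filter.Tendsto (fun x : ℝ => C / c * Real.exp (-x)) Filter.atTop (𝓝 0) := by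
      simpa using (Real.tendsto_exp_neg_atTop_nhds_zero).const_mul (C / c)
    refine squeeze_zero_norm' ?_ h1
    filter_upwards [Filter.eventually_ge_atTop 0] with x hx
    rw [hev, Real.norm_eq_abs, div_mul_eq_mul_div, le_div_iff₀ hc']
    exact h x hx
  have h0 := (Polynomial.tendsto_nhds_iff P).mp ht
  have hP0 : P = 0 := Polynomial.leadingCoeff_eq_zero.mp h0.1
  have := hev 0
  rw [hP0, lag_zero] at this
  simp at this

/-- The decay of `G` outweighs the twist, so the averages `φ_j(w) G(ζ)` decay like a Gaussian in
`w`. A nonzero polynomial factor cannot do this. -/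
lemma MeanValue.eq_zero {j : ℕ} {G : ℂ → ℂ} (hG : MeanValue j G) {B : ℝ}
    (h : ∀ z, ‖G z‖ ≤ B * Real.exp (-(2 * Real.pi * ‖z‖ ^ 2))) : G = 0 := by
  funext ζ
  have hB : 0 ≤ B := nonneg_of_mul_nonneg_left ((norm_nonneg _).trans (h 0)) (Real.exp_pos _)
  have hpi := Real.pi_pos
  set C := B * Real.exp (5 * Real.pi * ‖ζ‖ ^ 2) with hC
  have key : ∀ w : ℂ, |phi j w| * ‖G ζ‖ ≤ C * Real.exp (-(Real.pi * ‖w‖ ^ 2)) := by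
    intro w
    have h1 : ∀ v : ℂ, ‖v‖ = ‖w‖ → ‖G (ζ + v) * Complex.exp (-Real.pi * conj ζ * v)‖ ≤
        C * Real.exp (-(Real.pi * ‖w‖ ^ 2)) := by
      intro v hv
      rw [norm_mul, Complex.norm_exp]
      have h2 : (-Real.pi * conj ζ * v).re ≤ Real.pi * ‖ζ‖ * ‖w‖ := by
        refine (Complex.re_le_norm _).trans ?_
        rw [norm_mul, norm_mul, hv, norm_neg, Complex.norm_conj, Complex.norm_real,
          Real.norm_of_nonneg hpi.le]
      have h3 : (‖w‖ - ‖ζ‖) ^ 2 ≤ ‖ζ + v‖ ^ 2 := by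
        rw [← hv]
        apply sq_le_sq'
        · have : ‖ζ‖ ≤ ‖ζ + v‖ + ‖v‖ := by simpa using norm_sub_le (ζ + v) v
          linarith
        · have : ‖v‖ ≤ ‖ζ + v‖ + ‖ζ‖ := by simpa using norm_sub_le (ζ + v) ζ
          linarith
      calc _ ≤ B * Real.exp (-(2 * Real.pi * ‖ζ + v‖ ^ 2)) *
            Real.exp (Real.pi * ‖ζ‖ * ‖w‖) := by
            have := h (ζ + v)
            gcongr
        _ = B * Real.exp (-(2 * Real.pi * ‖ζ + v‖ ^ 2) + Real.pi * ‖ζ‖ * ‖w‖) := by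
            rw [Real.exp_add]; ring
        _ ≤ B * Real.exp (5 * Real.pi * ‖ζ‖ ^ 2 + -(Real.pi * ‖w‖ ^ 2)) := by
            refine mul_le_mul_of_nonneg_left (Real.exp_le_exp.mpr ?_) hB
            -- The constant 5 leaves `‖w‖² - 5‖w‖‖ζ‖ + 7‖ζ‖² ≥ 0`, that is, `(2‖w‖ - 5‖ζ‖)²/4 +
            -- 3‖ζ‖²/4`.
            have h4 := mul_le_mul_of_nonneg_left h3 hpi.le
            nlinarith [mul_nonneg hpi.le (sq_nonneg (2 * ‖w‖ - 5 * ‖ζ‖)),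
              mul_nonneg hpi.le (sq_nonneg ‖ζ‖)]
        _ = _ := by rw [Real.exp_add, hC]; ring
    have h5 := hG.2 ζ w
    have h6 := intervalIntegral.norm_integral_le_of_norm_le_const (a := 0) (b := 2 * Real.pi)
      (f := fun θ => G (ζ + cis θ * w) * Complex.exp (-Real.pi * conj ζ * (cis θ * w)))
      (C := C * Real.exp (-(Real.pi * ‖w‖ ^ 2))) (fun θ _ => h1 _ (norm_cis_mul θ w))
    rw [h5, sub_zero, norm_mul, norm_mul, norm_mul, Complex.norm_real, Complex.norm_real,
      Real.norm_of_nonneg hpi.le, abs_of_nonneg (by positivity), Real.norm_eq_abs] at h6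
    have h7 : ‖(2 : ℂ)‖ = 2 := by simp
    rw [h7] at h6
    have h8 : (2 * Real.pi) * (|phi j w| * ‖G ζ‖) ≤
        (2 * Real.pi) * (C * Real.exp (-(Real.pi * ‖w‖ ^ 2))) := by linarith
    exact le_of_mul_le_mul_left h8 (by positivity)
  have : ‖G ζ‖ = 0 := by
    refine eq_zero_of_abs_lag_mul_le (j := j) (C := C) (fun x hx => ?_) (norm_nonneg _)
    have h1 := key (Real.sqrt (x / Real.pi) : ℝ)
    have h2 : Real.pi * ‖((Real.sqrt (x / Real.pi) : ℝ) : ℂ)‖ ^ 2 = x := by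
      rw [Complex.norm_real, Real.norm_of_nonneg (Real.sqrt_nonneg _),
        Real.sq_sqrt (by positivity)]
      field_simp
    rwa [phi, h2] at h1
  simpa using this

lemma proj_eq_zero_of_mem_GBeurling_half {q : ℝ≥0∞} [Fact (1 ≤ q)] {n : ℕ} {σ : ℂ → ℂ}
    (hσ : σ ∈ GBeurling q n (1 / 2)) {j : ℕ} (hj : j ≤ n) : proj j σ = 0 := by
  have hpi := Real.pi_pos
  -- With `α = 1/2`, the exponent `5π/2` minus the half Gaussian's `π/2` is the rate `2π` required
  -- by `MeanValue.eq_zero`.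
  obtain ⟨C, hC, h⟩ := wt_norm_le_pos (α := 1 / 2) le_rfl (by norm_num)
    (a := 5 * Real.pi / 2) (by positivity) j q
  have hm := hσ (2 * (5 * Real.pi / 2)) (by positivity)
  have hb := h σ hm.1 (hm.2 j hj)
  set B := C * (eLpNorm (weighted (2 * (5 * Real.pi / 2)) (1 / 2) j σ) q volume).toReal
  refine (hm.1.meanValue_proj j).eq_zero (B := B) fun z => ?_
  have e : wt (5 * Real.pi / 2) (1 / 2) z = Real.exp (2 * Real.pi * ‖z‖ ^ 2) := by
    rw [wt, hgauss, ← Real.exp_add, lam]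
    norm_num
    ring
  have := hb z
  rw [e] at this
  rw [Real.exp_neg, ← div_eq_mul_inv, le_div_iff₀ (Real.exp_pos _), mul_comm]
  exact this

/-! ### Representation of functionals -/

/-- The bound lets `u` descend to the range of `Λ`; Hahn–Banach extends it from there. -/
lemma exists_continuousLinearMap_comp {V E : Type*} [AddCommGroup V] [Module ℂ V]
    [NormedAddCommGroup E] [NormedSpace ℂ E] (Λ : V →ₗ[ℂ] E) (u : V →ₗ[ℂ] ℂ) {C : ℝ}
    (h : ∀ v, ‖u v‖ ≤ C * ‖Λ v‖) : ∃ g : E →L[ℂ] ℂ, ∀ v, u v = g (Λ v) := by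
  have hker : LinearMap.ker Λ ≤ LinearMap.ker u := fun v hv => by
    have h1 := h v
    rw [LinearMap.mem_ker.mp hv, norm_zero, mul_zero] at h1
    exact LinearMap.mem_ker.mpr (norm_le_zero_iff.mp h1)
  set f₀ : LinearMap.range Λ →ₗ[ℂ] ℂ :=
    ((LinearMap.ker Λ).liftQ u hker) ∘ₗ Λ.quotKerEquivRange.symm.toLinearMap with hf₀
  have hf : ∀ v, f₀ ⟨Λ v, LinearMap.mem_range_self Λ v⟩ = u v := by
    intro v
    have : Λ.quotKerEquivRange.symm ⟨Λ v, LinearMap.mem_range_self Λ v⟩ =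
        (LinearMap.ker Λ).mkQ v := LinearMap.quotKerEquivRange_symm_apply_image _ _ _
    simp only [hf₀, LinearMap.comp_apply, LinearEquiv.coe_coe]
    rw [this]
    simp
  have hb : ∀ x : LinearMap.range Λ, ‖f₀ x‖ ≤ C * ‖x‖ := by
    rintro ⟨_, v, rfl⟩
    rw [hf]
    exact h v
  obtain ⟨g, hg, _⟩ := exists_extension_norm_eq (LinearMap.range Λ) (f₀.mkContinuous C hb)
  exact ⟨g, fun v => by rw [← hf v]; exact (hg ⟨Λ v, LinearMap.mem_range_self Λ v⟩).symm⟩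

lemma exists_memLp_representing (n : ℕ) (g : (Fin (n + 1) → Lp ℂ 2 (volume : Measure ℂ)) →L[ℂ] ℂ) :
    ∃ f : ℕ → ℂ → ℂ, (∀ j, MemLp (f j) 2) ∧ ∀ (h : ℕ → ℂ → ℂ) (hh : ∀ j : Fin (n + 1),
      MemLp (h j) 2), g (fun j => (hh j).toLp (h j)) =
        ∑ j ∈ Finset.range (n + 1), ∫ z, h j z * conj (f j z) := by
  set G : Fin (n + 1) → Lp ℂ 2 (volume : Measure ℂ) := fun j =>
    (InnerProductSpace.toDual ℂ (Lp ℂ 2 (volume : Measure ℂ))).symm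
      (g ∘L ContinuousLinearMap.single ℂ (fun _ : Fin (n + 1) => Lp ℂ 2 (volume : Measure ℂ)) j)
    with hG
  refine ⟨fun j => if hj : j < n + 1 then (G ⟨j, hj⟩ : ℂ → ℂ) else 0, fun j => ?_,
    fun h hh => ?_⟩
  · simp only
    split_ifs
    · exact Lp.memLp _
    · exact MemLp.zero
  · have h1 : (fun j => (hh j).toLp (h j)) = ∑ j : Fin (n + 1), ContinuousLinearMap.single ℂ
        (fun _ : Fin (n + 1) => Lp ℂ 2 (volume : Measure ℂ)) j ((hh j).toLp (h j)) := by
      funext i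
      rw [Finset.sum_apply, Finset.sum_eq_single i]
      · simp
      · intro b _ hb; simp [hb.symm]
      · simp
    rw [h1, map_sum, Finset.sum_range]
    refine Finset.sum_congr rfl fun j _ => ?_
    have h2 : g (ContinuousLinearMap.single ℂ
        (fun _ : Fin (n + 1) => Lp ℂ 2 (volume : Measure ℂ)) j ((hh j).toLp (h j))) =
        inner ℂ (G j) ((hh j).toLp (h j)) := by
      rw [hG, InnerProductSpace.toDual_symm_apply]
      rfl
    rw [h2, L2.inner_def]
    refine integral_congr_ae ?_
    filter_upwards [(hh j).coeFn_toLp] with z hz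
    rw [RCLike.inner_apply, hz, dif_pos j.2]

/-- The weight `e^{b|w|^{1/α}} |Φ_{j,j}(w)| e^{-π|w|²/2}`. -/
noncomputable def psi (b α : ℝ) (j : ℕ) (w : ℂ) : ℝ :=
  Real.exp (b * lam α w) * |phi j w| * hgauss w

lemma psi_nonneg (b α : ℝ) (j : ℕ) (w : ℂ) : 0 ≤ psi b α j w :=
  mul_nonneg (by positivity) (hgauss_pos w).le

lemma continuous_psi (b : ℝ) {α : ℝ} (hα : 1 / 2 ≤ α) (j : ℕ) : Continuous (psi b α j) := by
  have h1 := continuous_lam hα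
  have h2 := continuous_hgauss
  have h3 := continuous_phi j
  unfold psi
  exact ((by fun_prop : Continuous fun w => Real.exp (b * lam α w)).mul h3.abs).mul h2

lemma Good.integrable_psi_sq {b α : ℝ} (hα : 1 / 2 ≤ α) (hg : Good b α) (j : ℕ) :
    Integrable fun w => psi b α j w ^ 2 := by
  obtain ⟨C, hC, h⟩ := abs_phi_le j
  obtain ⟨M, hM, hb⟩ := hg.exp_mul_hgauss_le 1
  have hc := continuous_psi b hα j
  refine (integrable_exp_neg_norm_sq.const_mul ((C * M) ^ 2)).mono'
    (by fun_prop) (Filter.Eventually.of_forall fun w => ?_)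
  have h0 := psi_nonneg b α j w
  rw [Real.norm_of_nonneg (by positivity), ← mul_pow]
  refine pow_le_pow_left₀ h0 ?_ 2
  have h1 := hgauss_pos w
  calc psi b α j w ≤ Real.exp (b * lam α w) * (C * Real.exp ‖w‖) * hgauss w := by
        unfold psi; gcongr; exact h w
    _ = C * (Real.exp (b * lam α w) * Real.exp (1 * ‖w‖) * hgauss w) := by rw [one_mul]; ring
    _ ≤ C * (M * Real.exp (-‖w‖)) := mul_le_mul_of_nonneg_left (hb w) hC
    _ = _ := by ring

/-- With half a Gaussian in each variable the kernel becomes, in modulus, a function of `ζ - z`, so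
that translation invariant estimates apply. -/
lemma norm_kernel_mul (j : ℕ) (ζ z : ℂ) :
    ‖kernel j ζ z‖ * hgauss ζ * hgauss z = |phi j (ζ - z)| * hgauss (ζ - z) := by
  rw [kernel, norm_mul, diagPhi_eq_phi, Complex.norm_real, Real.norm_eq_abs, Complex.norm_exp,
    hgauss, hgauss, hgauss]
  have : Real.exp (Real.pi * conj z * ζ : ℂ).re * Real.exp (-(Real.pi / 2 * ‖ζ‖ ^ 2)) *
      Real.exp (-(Real.pi / 2 * ‖z‖ ^ 2)) = Real.exp (-(Real.pi / 2 * ‖ζ - z‖ ^ 2)) := by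
    rw [← Real.exp_add, ← Real.exp_add]
    congr 1
    rw [← Complex.normSq_eq_norm_sq, ← Complex.normSq_eq_norm_sq, ← Complex.normSq_eq_norm_sq,
      Complex.normSq_sub]
    simp [Complex.normSq_apply]
    ring
  rw [← this]; ring

lemma proj_finset_sum {ι : Type*} (s : Finset ι) {F : ι → ℂ → ℂ} (hF : ∀ i ∈ s, InDomain (F i))
    (k : ℕ) (ζ : ℂ) :
    Integrable (fun z => (∑ i ∈ s, F i z) * kernel k ζ z * gauss z) ∧
    proj k (fun z => ∑ i ∈ s, F i z) ζ = ∑ i ∈ s, proj k (F i) ζ := by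
  simp only [proj, Finset.sum_mul]
  exact ⟨integrable_finsetSum _ fun i hi => hF i hi k ζ,
    integral_finsetSum _ fun i hi => hF i hi k ζ⟩

/-- The function `g e^{a|z|^{1/α}} e^{π|z|²/2}`. -/
noncomputable def unweight (a α : ℝ) (g : ℂ → ℂ) (z : ℂ) : ℂ :=
  g z * ((Real.exp (a * lam α z) / hgauss z : ℝ) : ℂ)

lemma norm_unweight_mul (a α : ℝ) (g : ℂ → ℂ) (z : ℂ) :
    ‖unweight a α g z‖ * hgauss z = ‖g z‖ * Real.exp (a * lam α z) := by
  have := (hgauss_pos z).ne'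
  rw [unweight, norm_mul, Complex.norm_real, Real.norm_of_nonneg
    (div_nonneg (Real.exp_pos _).le (hgauss_pos z).le)]
  field_simp

lemma aestronglyMeasurable_unweight (a : ℝ) {α : ℝ} (hα : 1 / 2 ≤ α) {g : ℂ → ℂ}
    (hg : AEStronglyMeasurable g) : AEStronglyMeasurable (unweight a α g) := by
  have h1 := continuous_lam hα
  have h2 := continuous_hgauss
  have h3 : Continuous fun z => ((Real.exp (a * lam α z) / hgauss z : ℝ) : ℂ) :=
    Complex.continuous_ofReal.comp
      ((by fun_prop : Continuous fun z => Real.exp (a * lam α z)).div h2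
        fun z => (hgauss_pos z).ne')
  exact hg.mul h3.aestronglyMeasurable

lemma expInt_unweight {a α : ℝ} (hα : 1 / 2 ≤ α) (hg : Good a α) {g : ℂ → ℂ} (h : MemLp g 2) :
    ExpInt (unweight a α g) := by
  have hm := aestronglyMeasurable_unweight a hα h.1
  refine ⟨hm, fun R => ?_⟩
  obtain ⟨M, hM, hb⟩ := hg.exp_mul_hgauss_le R
  have hr := continuous_rgauss
  have hi := ((memLp_two_iff_integrable_sq_norm h.1).mp h).add integrable_exp_neg_norm_sq
  refine (hi.const_mul M).mono' (hm.norm.mul (Continuous.aestronglyMeasurable (by fun_prop)))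
    (Filter.Eventually.of_forall fun z => ?_)
  have h0 := rgauss_pos z
  rw [Real.norm_of_nonneg (by positivity), ← hgauss_mul_self]
  calc ‖unweight a α g z‖ * (Real.exp (R * ‖z‖) * (hgauss z * hgauss z))
      = (‖unweight a α g z‖ * hgauss z) * (Real.exp (R * ‖z‖) * hgauss z) := by ring
    _ = ‖g z‖ * (Real.exp (a * lam α z) * Real.exp (R * ‖z‖) * hgauss z) := by
        rw [norm_unweight_mul]; ring
    _ ≤ ‖g z‖ * (M * Real.exp (-‖z‖)) := mul_le_mul_of_nonneg_left (hb z) (norm_nonneg _)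
    _ = M * (‖g z‖ * Real.exp (-‖z‖)) := by ring
    _ ≤ M * (‖g z‖ ^ 2 + Real.exp (-‖z‖) ^ 2) := by
        gcongr
        nlinarith [sq_nonneg (‖g z‖ - Real.exp (-‖z‖)), sq_nonneg (‖g z‖),
          sq_nonneg (Real.exp (-‖z‖))]

/-- Quasi-subadditivity splits the weight at `z` between `ζ` and `ζ - z`. The product `|g| ψ` is
then bounded by `|g|² + ψ²`, a pointwise substitute for Cauchy–Schwarz that is also an integrable
majorant. -/
lemma norm_unweight_kernel_le {α a : ℝ} (hα : 1 / 2 ≤ α) (hα' : α ≤ 1) (ha : 0 < a) (g : ℂ → ℂ)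
    (j : ℕ) (ζ z : ℂ) :
    ‖unweight a α g z‖ * ‖kernel j ζ z‖ * rgauss z * hgauss ζ ≤
      Real.exp (2 * a * lam α ζ) * (‖g z‖ ^ 2 + psi (2 * a) α j (ζ - z) ^ 2) := by
  have h1 : lam α z ≤ 2 * (lam α ζ + lam α (ζ - z)) := by
    have := lam_add_le hα hα' ζ (-(ζ - z))
    rw [lam_neg] at this
    simpa using this
  calc ‖unweight a α g z‖ * ‖kernel j ζ z‖ * rgauss z * hgauss ζ
      = (‖unweight a α g z‖ * hgauss z) * (‖kernel j ζ z‖ * hgauss ζ * hgauss z) := by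
        rw [← hgauss_mul_self]; ring
    _ = ‖g z‖ * Real.exp (a * lam α z) * (|phi j (ζ - z)| * hgauss (ζ - z)) := by
        rw [norm_unweight_mul, norm_kernel_mul]
    _ ≤ ‖g z‖ * Real.exp (2 * a * lam α ζ + 2 * a * lam α (ζ - z)) *
        (|phi j (ζ - z)| * hgauss (ζ - z)) := by
        have := hgauss_pos (ζ - z)
        gcongr
        nlinarith
    _ = Real.exp (2 * a * lam α ζ) * (‖g z‖ * psi (2 * a) α j (ζ - z)) := by
        rw [Real.exp_add, psi]; ring
    _ ≤ _ := by
        gcongr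
        nlinarith [sq_nonneg (‖g z‖ - psi (2 * a) α j (ζ - z)), sq_nonneg (‖g z‖),
          sq_nonneg (psi (2 * a) α j (ζ - z))]

lemma wt_proj_unweight_le {α a : ℝ} (hα : 1 / 2 ≤ α) (hα' : α ≤ 1) (ha : 0 < a)
    (hg : Good (2 * a) α) {g : ℂ → ℂ} (h : MemLp g 2) (j : ℕ) :
    ∃ B : ℝ, 0 ≤ B ∧ ∀ ζ, wt (-(2 * a)) α ζ * ‖proj j (unweight a α g) ζ‖ ≤ B := by
  have hi := (memLp_two_iff_integrable_sq_norm h.1).mp h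
  have hp := hg.integrable_psi_sq hα j
  set I : ℝ := (∫ z, ‖g z‖ ^ 2) + ∫ z, psi (2 * a) α j z ^ 2 with hI
  have hI0 : 0 ≤ I := add_nonneg (integral_nonneg fun z => sq_nonneg _)
    (integral_nonneg fun z => sq_nonneg _)
  refine ⟨I, hI0, fun ζ => ?_⟩
  have hp' : Integrable fun z => psi (2 * a) α j (ζ - z) ^ 2 := hp.comp_sub_left ζ
  have h1 : ‖∫ z, unweight a α g z * kernel j ζ z * gauss z * (hgauss ζ : ℂ)‖ ≤
      ∫ z, Real.exp (2 * a * lam α ζ) * (‖g z‖ ^ 2 + psi (2 * a) α j (ζ - z) ^ 2) := by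
    refine norm_integral_le_of_norm_le ((hi.add hp').const_mul _)
      (Filter.Eventually.of_forall fun z => ?_)
    rw [norm_mul, norm_mul, norm_mul, norm_gauss, Complex.norm_real,
      Real.norm_of_nonneg (hgauss_pos ζ).le]
    exact norm_unweight_kernel_le hα hα' ha g j ζ z
  rw [integral_mul_const, ← proj, norm_mul, Complex.norm_real,
    Real.norm_of_nonneg (hgauss_pos ζ).le, integral_const_mul, integral_add hi hp',
    integral_sub_left_eq_self (fun z => psi (2 * a) α j z ^ 2), ← hI] at h1
  calc wt (-(2 * a)) α ζ * ‖proj j (unweight a α g) ζ‖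
      = Real.exp (-(2 * a) * lam α ζ) * (‖proj j (unweight a α g) ζ‖ * hgauss ζ) := by
        rw [wt]; ring
    _ ≤ Real.exp (-(2 * a) * lam α ζ) * (Real.exp (2 * a * lam α ζ) * I) := by gcongr
    _ = I := by rw [← mul_assoc, ← Real.exp_add]; simp

lemma psi_sub_comm (b α : ℝ) (j : ℕ) (z w : ℂ) : psi b α j (z - w) = psi b α j (w - z) := by
  simp only [psi, lam, phi, hgauss, norm_sub_rev]

/-- Symmetry of `P^j`: insert `P^j σ = P^j P^j σ`, exchange the integrals, and let the hermitian
kernel act on the other factor. -/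
lemma integral_pairing_unweight {α a B : ℝ} (hα : 1 / 2 ≤ α) (hα' : α ≤ 1) (ha : 0 < a)
    (hg : Good (2 * a) α) {g : ℂ → ℂ} (h : MemLp g 2) {j : ℕ} {σ : ℂ → ℂ} (hσ : InDomain σ)
    (hB : ∀ z, wt (3 * a) α z * ‖proj j σ z‖ ≤ B) :
    ∫ z, weighted a α j σ z * conj (g z) =
      ∫ z, proj j σ z * conj (proj j (unweight a α g) z) * gauss z := by
  have hB0 : 0 ≤ B := (mul_nonneg (wt_pos _ _ _).le (norm_nonneg _)).trans (hB 0)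
  have hHc := continuous_proj hσ j
  have hHd : InDomain (proj j σ) := by
    have hg0 : Good (-(3 * a)) α := hg.mono (by linarith)
    exact (expInt_of_wt_le hHc.aestronglyMeasurable hg0 (by simpa using hB)).inDomain
  have hHr : ∀ w, proj j σ w = ∫ z, proj j σ z * kernel j w z * gauss z := by
    intro w
    have := (hσ.meanValue_proj j).proj_eq w (hHd j w)
    rw [if_pos rfl] at this
    exact this.symm
  have hGm := aestronglyMeasurable_unweight a hα h.1
  set G := unweight a α g with hG
  have e0 : ∀ w, weighted a α j σ w * conj (g w) =
      ∫ z, proj j σ z * kernel j w z * gauss z * (conj (G w) * gauss w) := by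
    intro w
    rw [integral_mul_const, ← hHr, weighted, weight_eq, hG, unweight, gauss_eq,
      ← hgauss_mul_self, wt, map_mul, Complex.conj_ofReal]
    have : (hgauss w : ℂ) ≠ 0 := by exact_mod_cast (hgauss_pos w).ne'
    push_cast
    field_simp
  have hi := (memLp_two_iff_integrable_sq_norm h.1).mp h
  have hp := hg.integrable_psi_sq hα j
  have hE := integrable_exp_neg_lam hα hα' ha
  -- The decay `e^{-3aλ(z)}` of `P^j σ` against the kernel's `e^{2aλ(z)}` leaves `e^{-aλ(z)}`. The
  -- majorant is the sum of a product and a convolution integrand.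
  have hint : Integrable (Function.uncurry fun w z =>
      proj j σ z * kernel j w z * gauss z * (conj (G w) * gauss w))
      ((volume : Measure ℂ).prod (volume : Measure ℂ)) := by
    have i1 : Integrable (fun p : ℂ × ℂ => ‖g p.1‖ ^ 2 * Real.exp (-a * lam α p.2))
        ((volume : Measure ℂ).prod (volume : Measure ℂ)) := hi.mul_prod hE
    have i2 : Integrable (fun p : ℂ × ℂ => Real.exp (-a * lam α p.2) *
        psi (2 * a) α j (p.1 - p.2) ^ 2) ((volume : Measure ℂ).prod (volume : Measure ℂ)) :=
      Integrable.convolution_integrand (ContinuousLinearMap.mul ℝ ℝ) hE hp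
    have hk : Continuous fun p : ℂ × ℂ => kernel j p.1 p.2 := continuous_kernel j
    have hgc := continuous_gauss
    refine ((i1.add i2).const_mul B).mono' ?_ (Filter.Eventually.of_forall fun p => ?_)
    · have m1 : AEStronglyMeasurable (fun p : ℂ × ℂ => conj (G p.1))
          ((volume : Measure ℂ).prod (volume : Measure ℂ)) :=
        Complex.continuous_conj.comp_aestronglyMeasurable hGm.comp_fst
      have m2 : Continuous fun p : ℂ × ℂ => proj j σ p.2 * kernel j p.1 p.2 * gauss p.2 := by
        fun_prop
      have m3 : Continuous fun p : ℂ × ℂ => gauss p.1 := by fun_prop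
      exact m2.aestronglyMeasurable.mul (m1.mul m3.aestronglyMeasurable)
    · obtain ⟨w, z⟩ := p
      simp only [Function.uncurry, Pi.add_apply]
      have h1 := norm_unweight_kernel_le hα hα' ha g j z w
      rw [psi_sub_comm, ← hG] at h1
      have h2 : ‖kernel j w z‖ = ‖kernel j z w‖ := by rw [← kernel_conj, Complex.norm_conj]
      have h3 : ‖proj j σ z‖ * hgauss z ≤ B * Real.exp (-(3 * a) * lam α z) := by
        have e : Real.exp (3 * a * lam α z) * Real.exp (-(3 * a) * lam α z) = 1 := by
          rw [← Real.exp_add]; simp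
        calc ‖proj j σ z‖ * hgauss z = (wt (3 * a) α z * ‖proj j σ z‖) *
              Real.exp (-(3 * a) * lam α z) := by
              rw [wt]; linear_combination (-(‖proj j σ z‖ * hgauss z)) * e
          _ ≤ _ := by gcongr; exact hB z
      rw [norm_mul, norm_mul, norm_mul, norm_mul, norm_gauss, norm_gauss, Complex.norm_conj, h2,
        ← hgauss_mul_self z]
      have hr := rgauss_pos w
      have hh := hgauss_pos z
      calc ‖proj j σ z‖ * ‖kernel j z w‖ * (hgauss z * hgauss z) * (‖G w‖ * rgauss w)
          = (‖proj j σ z‖ * hgauss z) * (‖G w‖ * ‖kernel j z w‖ * rgauss w * hgauss z) := by ring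
        _ ≤ (B * Real.exp (-(3 * a) * lam α z)) * (Real.exp (2 * a * lam α z) *
            (‖g w‖ ^ 2 + psi (2 * a) α j (w - z) ^ 2)) := by gcongr
        _ = B * (Real.exp (-(3 * a) * lam α z) * Real.exp (2 * a * lam α z)) *
            (‖g w‖ ^ 2 + psi (2 * a) α j (w - z) ^ 2) := by ring
        _ = _ := by
            rw [← Real.exp_add, show -(3 * a) * lam α z + 2 * a * lam α z = -a * lam α z by ring]
            ring
  simp_rw [e0]
  rw [integral_integral_swap hint]
  congr 1; funext z
  have e1 : ∀ w, proj j σ z * kernel j w z * gauss z * (conj (G w) * gauss w) =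
      (proj j σ z * gauss z) * conj (G w * kernel j z w * gauss w) := by
    intro w
    rw [map_mul, map_mul, kernel_conj, gauss_eq w, Complex.conj_ofReal]
    ring
  simp_rw [e1]
  rw [integral_const_mul, integral_conj, ← proj]
  ring

/-- Riesz applies in `n + 1` copies of L² to the weighted components. The hypothesis at `6a` gives
pointwise decay at `3a`, enough to pair with growth `2a`; the final `3a` leaves room for integration
in L^p. -/
lemma exists_representing {α a : ℝ} (hα : 1 / 2 ≤ α) (hα' : α ≤ 1) (ha : 0 < a)
    (hg : Good (2 * a) α) {n : ℕ} {S : Submodule ℂ (ℂ → ℂ)} (hS : S ≤ W 2 n (6 * a) α)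
    (u : S →ₗ[ℂ] ℂ) {C : ℝ} (hC : 0 ≤ C) (hu : ∀ σ : S, ‖u σ‖ ≤ C *
      ∑ j ∈ Finset.range (n + 1), (eLpNorm (weighted a α j σ.1) 2 volume).toReal) :
    ∃ F, IsPolyanalytic (n + 1) F ∧ Represents n F u ∧
      ∀ (p : ℝ≥0∞) [Fact (1 ≤ p)], F ∈ W p n (-(3 * a)) α := by
  have hm : ∀ (σ : S) (j : Fin (n + 1)), MemLp (weighted a α j σ.1) 2 := fun σ j =>
    (W_anti 2 n α (by linarith : a ≤ 6 * a) (hS σ.2)).2 j (Nat.lt_succ_iff.mp j.2)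
  have hD : ∀ σ : S, InDomain σ.1 := fun σ => (hS σ.2).1
  set Λ : S →ₗ[ℂ] (Fin (n + 1) → Lp ℂ 2 (volume : Measure ℂ)) :=
    { toFun := fun σ j => (hm σ j).toLp _
      map_add' := fun σ τ => by
        funext j
        rw [Pi.add_apply, ← MemLp.toLp_add]
        exact MemLp.toLp_congr _ _ (by rw [Submodule.coe_add, weighted_add a α j (hD σ) (hD τ)])
      map_smul' := fun c σ => by
        funext j
        rw [Pi.smul_apply, RingHom.id_apply, ← MemLp.toLp_const_smul]
        exact MemLp.toLp_congr _ _ (by rw [Submodule.coe_smul, weighted_smul]) } with hΛ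
  have hb : ∀ σ, ‖u σ‖ ≤ (C * (n + 1)) * ‖Λ σ‖ := by
    intro σ
    refine (hu σ).trans ?_
    rw [mul_assoc]
    refine mul_le_mul_of_nonneg_left ?_ hC
    have : ∀ j ∈ Finset.range (n + 1),
        (eLpNorm (weighted a α j σ.1) 2 volume).toReal ≤ ‖Λ σ‖ := by
      intro j hj
      have h1 := norm_le_pi_norm (Λ σ) ⟨j, by simpa using hj⟩
      refine le_trans (le_of_eq ?_) h1
      simp only [hΛ, LinearMap.coe_mk, AddHom.coe_mk, Lp.norm_toLp]
    refine (Finset.sum_le_sum this).trans_eq ?_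
    simp
  obtain ⟨L, hL⟩ := exists_continuousLinearMap_comp Λ u hb
  obtain ⟨g, hg2, hgL⟩ := exists_memLp_representing n L
  set F : ℕ → ℂ → ℂ := fun j => proj j (unweight a α (g j)) with hF
  have hga : Good a α := hg.mono (by linarith)
  have hE : ∀ j, ExpInt (unweight a α (g j)) := fun j => expInt_unweight hα hga (hg2 j)
  have hmv : ∀ j, MeanValue j (F j) := fun j => (hE j).meanValue_proj j
  choose B hB0 hB using fun j => wt_proj_unweight_le hα hα' ha hg (hg2 j) j
  have hFd : ∀ j, InDomain (F j) := fun j =>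
    (expInt_of_wt_le (hmv j).1.aestronglyMeasurable hg (hB j)).inDomain
  -- The projections of different orders annihilate each other, so the components of the sum are the
  -- `F j`.
  set Φ : ℂ → ℂ := fun z => ∑ j ∈ Finset.range (n + 1), F j z with hΦ
  have hΦd : InDomain Φ := fun k ζ => (proj_finset_sum _ (fun j _ => hFd j) k ζ).1
  have hpr : ∀ k ≤ n, proj k Φ = F k := by
    intro k hk
    funext ζ
    rw [hΦ, (proj_finset_sum _ (fun j _ => hFd j) k ζ).2, Finset.sum_eq_single k]
    · rw [(hmv k).proj_eq ζ (hFd k k ζ), if_pos rfl]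
    · intro b _ hb
      rw [(hmv b).proj_eq ζ (hFd b k ζ), if_neg hb]
    · intro h; simp at h; omega
  refine ⟨Φ, isPolyanalytic_sum fun j _ => (hE j).proj_eq_sum j, fun σ => ⟨fun j hj => ?_, ?_⟩,
    fun p _ => ⟨hΦd, fun j hj => ?_⟩⟩
  · obtain ⟨A, hA, hA'⟩ := wt_norm_le_pos hα hα' (a := 3 * a) (by linarith) j 2
    have h1 := hA' σ.1 (hD σ) (by
      rw [show 2 * (3 * a) = 6 * a by ring]; exact (hS σ.2).2 j hj)
    have h2 : ∀ z, wt (-(2 * a)) α z * ‖proj j Φ z‖ ≤ B j := by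
      rw [hpr j hj]; exact hB j
    have c1 := continuous_proj (hD σ) j
    have c2 := continuous_proj hΦd j
    have c3 := continuous_gauss
    exact ((integrable_exp_neg_lam hα hα' ha).const_mul _).mono'
      (Continuous.aestronglyMeasurable (by fun_prop))
      (Filter.Eventually.of_forall fun z => norm_pairing_le (h1 z) (h2 z) (by positivity))
  · rw [hL σ]
    have h1 := hgL (fun j => weighted a α j σ.1) (hm σ)
    refine h1.trans (Finset.sum_congr rfl fun j hj => ?_)
    have hj' : j ≤ n := by simp at hj; omega
    obtain ⟨A, hA, hA'⟩ := wt_norm_le_pos hα hα' (a := 3 * a) (by linarith) j 2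
    rw [hpr j hj']
    exact integral_pairing_unweight hα hα' ha hg (hg2 j) (hD σ) (hA' σ.1 (hD σ) (by
      rw [show 2 * (3 * a) = 6 * a by ring]; exact (hS σ.2).2 j hj'))
  · obtain ⟨K, hK, hK'⟩ := memLp_of_wt_le hα hα' (a := -(3 * a)) (b := -(2 * a)) (by linarith) p
    refine (hK' j Φ (B j) (hB0 j) (continuous_proj hΦd j) ?_).1
    rw [hpr j hj]; exact hB j

/-! ### Continuity of functionals -/

lemma continuous_of_le_wSeminorm {q : ℝ≥0∞} [Fact (1 ≤ q)] {n : ℕ} {a α : ℝ}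
    (v : W q n a α →ₗ[ℂ] ℂ) {C : ℝ} (hC : 0 ≤ C) (h : ∀ σ, ‖v σ‖ ≤ C * wSeminorm q n a α σ) :
    Continuous[wTopology q n a α, inferInstance] v := by
  let _ := wTopology q n a α
  have hp : WithSeminorms (fun _ : Unit => wSeminorm q n a α) := ⟨rfl⟩
  refine hp.continuous_of_isBounded (norm_withSeminorms ℂ ℂ) v fun _ =>
    ⟨{()}, ⟨C, hC⟩, fun σ => ?_⟩
  rw [Finset.sup_singleton]
  exact h σ

lemma exists_le_wSeminorm {q : ℝ≥0∞} [Fact (1 ≤ q)] {n : ℕ} {a α : ℝ}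
    {v : W q n a α →ₗ[ℂ] ℂ} (h : Continuous[wTopology q n a α, inferInstance] v) :
    ∃ C : ℝ, 0 ≤ C ∧ ∀ σ, ‖v σ‖ ≤ C * wSeminorm q n a α σ := by
  let _ := wTopology q n a α
  have hp : WithSeminorms (fun _ : Unit => wSeminorm q n a α) := ⟨rfl⟩
  obtain ⟨s, C, _, hs⟩ := Seminorm.bound_of_continuous hp ((normSeminorm ℂ ℂ).comp v)
    (continuous_norm.comp h)
  refine ⟨C, C.2, fun σ => (hs σ).trans ?_⟩
  rw [_root_.smul_apply, NNReal.smul_def, smul_eq_mul]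
  exact mul_le_mul_of_nonneg_left
    (Seminorm.finset_sup_apply_le (apply_nonneg _ _) fun _ _ => le_rfl) C.2

lemma eLpNorm_weighted_mono {q : ℝ≥0∞} {n : ℕ} {a b α : ℝ} (hab : a ≤ b) {σ : ℂ → ℂ}
    (hσ : σ ∈ W q n b α) {j : ℕ} (hj : j ≤ n) : (eLpNorm (weighted a α j σ) q volume).toReal ≤
      (eLpNorm (weighted b α j σ) q volume).toReal := by
  refine ENNReal.toReal_mono (hσ.2 j hj).2.ne (eLpNorm_mono fun z => ?_)
  rw [norm_weighted, norm_weighted, wt, wt]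
  have h1 := hgauss_pos z
  have h2 := mul_le_mul_of_nonneg_right hab (lam_nonneg α z)
  gcongr

lemma exists_le_of_mem_beurlingDual {q : ℝ≥0∞} [Fact (1 ≤ q)] {n : ℕ} {α : ℝ}
    {u : GBeurling q n α →ₗ[ℂ] ℂ} (hu : u ∈ beurlingDual q n α) :
    ∃ a : ℝ, 0 < a ∧ ∃ C : ℝ, 0 ≤ C ∧ ∀ σ : GBeurling q n α, ‖u σ‖ ≤
      C * ∑ j ∈ Finset.range (n + 1), (eLpNorm (weighted a α j σ.1) q volume).toReal := by
  let _ := beurlingTopology q n α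
  have hp := withSeminorms_iInf (𝕜 := ℂ) (E := GBeurling q n α)
    (t := fun a : {a : ℝ // 0 < a} =>
      (wTopology q n a α).induced (Submodule.inclusion (GBeurling_le q n α a.2)))
    (p := fun a : {a : ℝ // 0 < a} => SeminormFamily.comp (fun _ : Unit => wSeminorm q n a α)
      (Submodule.inclusion (GBeurling_le q n α a.2)))
    (fun a => by
      let _ := wTopology q n a α
      have h : WithSeminorms (fun _ : Unit => wSeminorm q n a α) := ⟨rfl⟩
      exact LinearMap.withSeminorms_induced h _)
  obtain ⟨s, C, _, hs⟩ := Seminorm.bound_of_continuous hp ((normSeminorm ℂ ℂ).comp u)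
    (continuous_norm.comp hu)
  -- Finitely many seminorms are dominated by one of larger index; the summand 1 keeps that index
  -- positive when `s` is empty.
  have hA : ∀ i ∈ s, (i.1 : ℝ) ≤ 1 + ∑ i ∈ s, (i.1 : ℝ) := fun i hi => by
    have := Finset.single_le_sum (f := fun i : (_ : {a : ℝ // 0 < a}) × Unit => (i.1 : ℝ))
      (fun i _ => i.1.2.le) hi
    linarith
  have hA0 : 0 ≤ ∑ i ∈ s, (i.1 : ℝ) := Finset.sum_nonneg fun i _ => i.1.2.le
  refine ⟨1 + ∑ i ∈ s, (i.1 : ℝ), by linarith, C, C.2, fun σ => (hs σ).trans ?_⟩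
  rw [_root_.smul_apply, NNReal.smul_def, smul_eq_mul]
  refine mul_le_mul_of_nonneg_left (Seminorm.finset_sup_apply_le
    (Finset.sum_nonneg fun j _ => ENNReal.toReal_nonneg) fun i hi => ?_) C.2
  change ∑ j ∈ Finset.range (n + 1), (eLpNorm (weighted i.1 α j σ.1) q volume).toReal ≤ _
  refine Finset.sum_le_sum fun j hj => ?_
  exact eLpNorm_weighted_mono (hA i hi) (σ.2 _ (by linarith)) (by simp at hj; omega)

lemma mem_beurlingDual_of_comp {q : ℝ≥0∞} [Fact (1 ≤ q)] {n : ℕ} {a α : ℝ} (ha : 0 < a)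
    {v : W q n a α →ₗ[ℂ] ℂ} (hv : Continuous[wTopology q n a α, inferInstance] v) :
    v ∘ₗ Submodule.inclusion (GBeurling_le q n α ha) ∈ beurlingDual q n α := by
  refine continuous_iInf_dom (i := (⟨a, ha⟩ : {a : ℝ // 0 < a})) ?_
  let _ := wTopology q n a α
  let _ := (wTopology q n a α).induced (Submodule.inclusion (GBeurling_le q n α ha))
  exact Continuous.comp (g := v) hv continuous_induced_dom

/-- For the converse, the topology induced by `u` itself is locally convex and makes the inclusions
continuous, so the inductive limit topology is finer. -/
lemma mem_roumieuDual_iff {q : ℝ≥0∞} [Fact (1 ≤ q)] {n : ℕ} {α : ℝ}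
    {u : GRoumieu q n α →ₗ[ℂ] ℂ} : u ∈ roumieuDual q n α ↔ ∀ (a : ℝ) (ha : 0 < a),
      Continuous[wTopology q n a α, inferInstance]
        (u ∘ₗ Submodule.inclusion (le_GRoumieu q n α ha)) := by
  constructor
  · intro hu a ha
    have h1 : Continuous[wTopology q n a α, roumieuTopology q n α]
        (Submodule.inclusion (le_GRoumieu q n α ha)) :=
      continuous_sInf_rng.mpr fun t ht => ht.2.2.2 a ha
    let _ := wTopology q n a α
    let _ := roumieuTopology q n α
    exact Continuous.comp (g := u) hu h1
  · intro h
    refine continuous_sInf_dom (t := TopologicalSpace.induced u inferInstance)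
      ⟨?_, ?_, ?_, fun a ha => ?_⟩ continuous_induced_dom
    · exact topologicalAddGroup_induced u
    · exact continuousSMul_induced u
    · exact LocallyConvexSpace.induced (u.restrictScalars ℝ)
    · exact continuous_induced_rng.mpr (h a ha)

lemma exists_represents {n : ℕ} {S : Submodule ℂ (ℂ → ℂ)} {F : ℂ → ℂ}
    (hd : ∀ σ ∈ S, InDomain σ) (hi : ∀ σ ∈ S, ∀ j ≤ n,
      Integrable fun z => proj j σ z * conj (proj j F z) * gauss z) :
    ∃ u : S →ₗ[ℂ] ℂ, Represents n F u := by
  refine ⟨{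
    toFun := fun σ => ∑ j ∈ Finset.range (n + 1),
      ∫ z, proj j σ.1 z * conj (proj j F z) * gauss z
    map_add' := fun σ τ => ?_
    map_smul' := fun c σ => ?_ }, fun σ => ⟨hi σ.1 σ.2, rfl⟩⟩
  · rw [← Finset.sum_add_distrib]
    refine Finset.sum_congr rfl fun j hj => ?_
    have hj' : j ≤ n := by simp at hj; omega
    rw [← integral_add (hi σ.1 σ.2 j hj') (hi τ.1 τ.2 j hj'), Submodule.coe_add,
      proj_add j (hd σ.1 σ.2) (hd τ.1 τ.2)]
    congr 1; funext z
    simp only [Pi.add_apply]; ring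
  · rw [RingHom.id_apply, smul_eq_mul, Finset.mul_sum]
    refine Finset.sum_congr rfl fun j _ => ?_
    rw [← integral_const_mul, Submodule.coe_smul, proj_smul]
    congr 1; funext z
    simp only [Pi.smul_apply, smul_eq_mul]; ring

/-- Two functionals represented by the same function agree on common arguments. -/
lemma Represents.apply_eq {n : ℕ} {S T : Submodule ℂ (ℂ → ℂ)} {F : ℂ → ℂ} {u : S →ₗ[ℂ] ℂ}
    {v : T →ₗ[ℂ] ℂ} (hu : Represents n F u) (hv : Represents n F v) {σ : ℂ → ℂ} (h₁ : σ ∈ S)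
    (h₂ : σ ∈ T) : u ⟨σ, h₁⟩ = v ⟨σ, h₂⟩ :=
  (hu ⟨σ, h₁⟩).2.trans (hv ⟨σ, h₂⟩).2.symm

lemma Represents.comp_inclusion {n : ℕ} {S T : Submodule ℂ (ℂ → ℂ)} {F : ℂ → ℂ} {u : S →ₗ[ℂ] ℂ}
    (hu : Represents n F u) (h : T ≤ S) : Represents n F (u ∘ₗ Submodule.inclusion h) :=
  fun σ => hu (Submodule.inclusion h σ)

/-- On `W^{q,n}_{6a,α}` every function in `W^{p,n}_{-a,α}` represents a continuous functional. -/
lemma exists_represents_continuous {α : ℝ} (hα : 1 / 2 ≤ α) (hα' : α ≤ 1) {a : ℝ} (ha : 0 < a)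
    {n : ℕ} {p : ℝ≥0∞} (q : ℝ≥0∞) [Fact (1 ≤ p)] [Fact (1 ≤ q)] {F : ℂ → ℂ}
    (hF : F ∈ W p n (-a) α) : ∃ v : W q n (6 * a) α →ₗ[ℂ] ℂ, Represents n F v ∧
      Continuous[wTopology q n (6 * a) α, inferInstance] v := by
  choose! C hC hb using fun j (hj : j ≤ n) => pairing_bound hα hα' ha p q hF hj
  obtain ⟨v, hv⟩ := exists_represents (n := n) (F := F) (S := W q n (6 * a) α)
    (fun σ hσ => hσ.1) fun σ hσ j hj => (hb j hj σ hσ).1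
  have hC' : ∀ j ∈ Finset.range (n + 1), 0 ≤ C j := fun j hj => hC j (by simp at hj; omega)
  refine ⟨v, hv, continuous_of_le_wSeminorm v (C := ∑ j ∈ Finset.range (n + 1), C j)
    (Finset.sum_nonneg hC') fun σ => ?_⟩
  rw [(hv σ).2]
  refine (norm_sum_le _ _).trans ?_
  change _ ≤ _ * ∑ j ∈ Finset.range (n + 1), _
  rw [Finset.mul_sum]
  refine Finset.sum_le_sum fun j hj => ((hb j (by simp at hj; omega) σ.1 σ.2).2).trans ?_
  exact mul_le_mul_of_nonneg_right (Finset.single_le_sum hC' hj) ENNReal.toReal_nonneg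

lemma exists_sum_eLpNorm_le {α : ℝ} (hα : 1 / 2 ≤ α) (hα' : α ≤ 1) {a : ℝ} (ha : 0 < a) (n : ℕ)
    (q : ℝ≥0∞) [Fact (1 ≤ q)] : ∃ D : ℝ, 0 ≤ D ∧ ∀ σ ∈ W 2 n (4 * a) α,
      ∑ j ∈ Finset.range (n + 1), (eLpNorm (weighted a α j σ) q volume).toReal ≤
        D * ∑ j ∈ Finset.range (n + 1), (eLpNorm (weighted (4 * a) α j σ) 2 volume).toReal := by
  choose C hC hb using fun j => eLpNorm_weighted_le hα hα' ha j q 2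
  refine ⟨∑ j ∈ Finset.range (n + 1), C j, Finset.sum_nonneg fun j _ => hC j, fun σ hσ => ?_⟩
  rw [Finset.mul_sum]
  refine Finset.sum_le_sum fun j hj =>
    (hb j σ hσ.1 (hσ.2 j (by simp at hj; omega))).trans ?_
  exact mul_le_mul_of_nonneg_right (Finset.single_le_sum (fun j _ => hC j) hj)
    ENNReal.toReal_nonneg

/-- A functional which is bounded by the seminorm of `W^{q,n}_{a,α}` is represented. -/
lemma exists_representing_of_le {α a : ℝ} (hα : 1 / 2 ≤ α) (hα' : α ≤ 1) (ha : 0 < a)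
    (hg : Good (8 * a) α) {n : ℕ} {q : ℝ≥0∞} [Fact (1 ≤ q)] {S : Submodule ℂ (ℂ → ℂ)}
    (hS : S ≤ W q n (96 * a) α) (u : S →ₗ[ℂ] ℂ) {C : ℝ} (hC : 0 ≤ C) (hu : ∀ σ : S, ‖u σ‖ ≤ C *
      ∑ j ∈ Finset.range (n + 1), (eLpNorm (weighted a α j σ.1) q volume).toReal) :
    ∃ F, IsPolyanalytic (n + 1) F ∧ Represents n F u ∧
      ∀ (p : ℝ≥0∞) [Fact (1 ≤ p)], F ∈ W p n (-(12 * a)) α := by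
  -- Exchanging L^q for L² costs a factor 4 in the bound on `u`, hence `4a` in
  -- `exists_representing`, and another 4 in this inclusion: `96 = 4·6·4`.
  have hS2 : S ≤ W 2 n (6 * (4 * a)) α := by
    refine hS.trans ?_
    have := W_le_pos hα hα' (a := 6 * (4 * a)) (by linarith) n 2 q
    rwa [show 4 * (6 * (4 * a)) = 96 * a by ring] at this
  obtain ⟨D, hD, hD'⟩ := exists_sum_eLpNorm_le hα hα' ha n q
  have := exists_representing hα hα' (a := 4 * a) (by linarith)
    (by rwa [show 2 * (4 * a) = 8 * a by ring]) hS2 u (C := C * D) (by positivity) fun σ =>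
      (hu σ).trans (by
        rw [mul_assoc]
        exact mul_le_mul_of_nonneg_left (hD' σ.1 (W_anti 2 n α (by linarith) (hS2 σ.2))) hC)
  rwa [show 3 * (4 * a) = 12 * a by ring] at this

/-! ### The spaces and their duals -/

lemma GBeurling_eq {α : ℝ} (hα : 1 / 2 ≤ α) (hα' : α ≤ 1) (n : ℕ) (p q : ℝ≥0∞)
    [Fact (1 ≤ p)] [Fact (1 ≤ q)] : (GBeurling q n α : Set (ℂ → ℂ)) =
      ⋂ (a : ℝ) (_ : 0 < a), (W p n a α : Set (ℂ → ℂ)) := by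
  ext σ
  simp only [Set.mem_iInter, SetLike.mem_coe]
  constructor
  · intro h a ha
    exact W_le_pos hα hα' ha n p q (h (4 * a) (by linarith))
  · intro h a ha
    exact W_le_pos hα hα' ha n q p (h (4 * a) (by linarith))

lemma GRoumieu_eq {α : ℝ} (hα : 1 / 2 ≤ α) (hα' : α ≤ 1) (n : ℕ) (p q : ℝ≥0∞)
    [Fact (1 ≤ p)] [Fact (1 ≤ q)] : (GRoumieu q n α : Set (ℂ → ℂ)) =
      ⋃ (a : ℝ) (_ : 0 < a), (W p n a α : Set (ℂ → ℂ)) := by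
  have key : ∀ (p q : ℝ≥0∞) [Fact (1 ≤ p)] [Fact (1 ≤ q)] (σ : ℂ → ℂ),
      (∃ a : ℝ, 0 < a ∧ σ ∈ W q n a α) → ∃ a : ℝ, 0 < a ∧ σ ∈ W p n a α := by
    rintro p q _ _ σ ⟨a, ha, h⟩
    refine ⟨a / 4, by linarith, W_le_pos hα hα' (by linarith) n p q ?_⟩
    rwa [mul_div_cancel₀ a (by norm_num : (4 : ℝ) ≠ 0)]
  ext σ
  simp only [Set.mem_iUnion, SetLike.mem_coe, exists_prop]
  exact ⟨key p q σ, key q p σ⟩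

section Beurling

variable {α : ℝ} {n : ℕ} {p q : ℝ≥0∞} [Fact (1 ≤ p)] [Fact (1 ≤ q)]

lemma exists_mem_beurlingDual (q : ℝ≥0∞) [Fact (1 ≤ q)] (hα : 1 / 2 ≤ α) (hα' : α ≤ 1)
    {a : ℝ} (ha : 0 < a) {F : ℂ → ℂ} (hF : F ∈ W p n (-a) α) :
    ∃ u ∈ beurlingDual q n α, Represents n F u := by
  obtain ⟨v, hv, hvc⟩ := exists_represents_continuous hα hα' ha q hF
  have h6 : 0 < 6 * a := by linarith
  exact ⟨_, mem_beurlingDual_of_comp h6 hvc, hv.comp_inclusion (GBeurling_le q n α h6)⟩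

lemma isPolyanalytic_zero (N : ℕ) : IsPolyanalytic N (0 : ℂ → ℂ) := by
  have := isPolyanalytic_sum_conj_pow (h := fun _ _ => 0) (fun _ => differentiable_const 0) N
  simpa using! this

lemma exists_representing_beurling (p : ℝ≥0∞) [Fact (1 ≤ p)] (hα : 1 / 2 ≤ α) (hα' : α ≤ 1)
    {u : GBeurling q n α →ₗ[ℂ] ℂ} (hu : u ∈ beurlingDual q n α) :
    ∃ a : ℝ, 0 < a ∧ ∃ F ∈ W p n (-a) α, IsPolyanalytic (n + 1) F ∧ Represents n F u := by
  obtain ⟨a, ha, C, hC, hb⟩ := exists_le_of_mem_beurlingDual hu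
  rcases hα.eq_or_lt with rfl | hα2
  -- For `α = 1/2` every component of every element vanishes, so the seminorm bound forces `u = 0`.
  · refine ⟨1, one_pos, 0, Submodule.zero_mem _, isPolyanalytic_zero _, fun σ => ?_⟩
    have h0 : ∀ j ≤ n, proj j σ.1 = 0 := fun j hj => proj_eq_zero_of_mem_GBeurling_half σ.2 hj
    refine ⟨fun j hj => by simp [h0 j hj], ?_⟩
    have h1 := hb σ
    rw [Finset.sum_eq_zero, mul_zero] at h1
    · rw [norm_le_zero_iff.mp h1, Finset.sum_eq_zero]
      intro j hj
      simp [h0 j (by simp at hj; omega)]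
    · intro j hj
      have : weighted a (1 / 2) j σ.1 = 0 := by
        funext z
        rw [weighted, h0 j (by simp at hj; omega)]
        simp
      rw [this]; simp
  · obtain ⟨F, hF, hr, hm⟩ := exists_representing_of_le hα hα' ha (good_of_half_lt hα2 _)
      (GBeurling_le q n α (by linarith)) u hC hb
    exact ⟨12 * a, by linarith, F, hm p, hF, hr⟩

lemma kernel_mem_GBeurling (hα : 1 / 2 < α) (hα' : α ≤ 1) (j : ℕ) (ζ : ℂ) :
    (fun z => kernel j z ζ) ∈ GBeurling q n α := fun a _ =>
  kernel_mem_W hα.le hα' (lt_add_one a) (good_of_half_lt hα _) q n j ζ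

end Beurling

section Roumieu

variable {α : ℝ} {n : ℕ} {p q : ℝ≥0∞} [Fact (1 ≤ p)] [Fact (1 ≤ q)]

lemma kernel_mem_GRoumieu (hα : 1 / 2 ≤ α) (hα' : α ≤ 1) (j : ℕ) (ζ : ℂ) :
    (fun z => kernel j z ζ) ∈ GRoumieu q n α :=
  ⟨1 / 2, by norm_num, kernel_mem_W hα hα' (b := 1) (by norm_num)
    (good_of_le_one hα (by norm_num) le_rfl) q n j ζ⟩

lemma exists_mem_roumieuDual (q : ℝ≥0∞) [Fact (1 ≤ q)] (hα : 1 / 2 ≤ α) (hα' : α ≤ 1)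
    {F : ℂ → ℂ} (hF : ∀ a : ℝ, 0 < a → F ∈ W p n (-a) α) :
    ∃ u ∈ roumieuDual q n α, Represents n F u := by
  have key : ∀ c : ℝ, 0 < c → ∃ v : W q n c α →ₗ[ℂ] ℂ, Represents n F v ∧
      Continuous[wTopology q n c α, inferInstance] v := by
    intro c hc
    have := exists_represents_continuous hα hα' (a := c / 6) (by linarith) q
      (hF (c / 6) (by linarith))
    rwa [mul_div_cancel₀ c (by norm_num : (6 : ℝ) ≠ 0)] at this
  obtain ⟨u, hu⟩ := exists_represents (n := n) (F := F) (S := GRoumieu q n α)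
    (fun σ ⟨a, _, hσ⟩ => hσ.1) fun σ ⟨a, ha, hσ⟩ j hj => by
      obtain ⟨v, hv, _⟩ := key a ha
      exact (hv ⟨σ, hσ⟩).1 j hj
  refine ⟨u, mem_roumieuDual_iff.mpr fun a ha => ?_, hu⟩
  obtain ⟨v, hv, hvc⟩ := key a ha
  have : u ∘ₗ Submodule.inclusion (le_GRoumieu q n α ha) = v := by
    refine LinearMap.ext fun σ => ?_
    exact hu.apply_eq hv (le_GRoumieu q n α ha σ.2) σ.2
  rw [this]; exact hvc

lemma exists_representing_roumieu (p : ℝ≥0∞) [Fact (1 ≤ p)] (hα : 1 / 2 ≤ α) (hα' : α ≤ 1)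
    {u : GRoumieu q n α →ₗ[ℂ] ℂ} (hu : u ∈ roumieuDual q n α) :
    ∃ F, (∀ a : ℝ, 0 < a → F ∈ W p n (-a) α) ∧ IsPolyanalytic (n + 1) F ∧
      Represents n F u := by
  have h96 : ∀ {a : ℝ}, 0 < a → W q n (96 * a) α ≤ GRoumieu q n α := fun ha =>
    le_GRoumieu q n α (by linarith)
  -- The bound `1/100` ensures `8a ≤ 1`, so Gaussian domination holds even at `α = 1/2`, and `96a <
  -- 1`, so the kernels lie in `W q n (96 * a) α`.
  have key : ∀ (a : ℝ) (ha : 0 < a), a ≤ 1 / 100 → ∃ F, IsPolyanalytic (n + 1) F ∧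
      Represents n F (u ∘ₗ Submodule.inclusion (h96 ha)) ∧ F ∈ W p n (-(12 * a)) α := by
    intro a ha ha'
    obtain ⟨C, hC, hb⟩ := exists_le_wSeminorm (mem_roumieuDual_iff.mp hu a ha)
    obtain ⟨F, hF, hr, hm⟩ := exists_representing_of_le hα hα' ha
      (good_of_le_one hα (by linarith) (by linarith)) le_rfl
      (u ∘ₗ Submodule.inclusion (h96 ha)) hC fun σ =>
        hb (Submodule.inclusion (W_anti q n α (by linarith : a ≤ 96 * a)) σ)
    exact ⟨F, hF, hr, hm p⟩
  have h100 : (0 : ℝ) < 1 / 100 := by norm_num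
  obtain ⟨F, hF, hr, hm⟩ := key (1 / 100) h100 le_rfl
  -- On the smallest space, with index `96/100`, all representatives give the same functional.
  -- Testing on kernels there identifies them, so one `F` serves every `a`.
  have hagree : ∀ (a : ℝ) (ha : 0 < a), a ≤ 1 / 100 → F ∈ W p n (-(12 * a)) α ∧
      Represents n F (u ∘ₗ Submodule.inclusion (h96 ha)) := by
    intro a ha ha'
    obtain ⟨G, hG, hGr, hGm⟩ := key a ha ha'
    have h1 : W q n (96 * (1 / 100)) α ≤ W q n (96 * a) α := W_anti q n α (by linarith)
    have h2 := proj_eq_of_represents hm.1 hGm.1 hr (hGr.comp_inclusion h1) fun j ζ =>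
      kernel_mem_W hα hα' (b := 1) (by norm_num) (good_of_le_one hα (by norm_num) le_rfl) q n j ζ
    rw [eq_of_proj_eq hm.1 hGm.1 h2 hF hG]
    exact ⟨hGm, hGr⟩
  refine ⟨F, fun a ha => ?_, hF, fun ⟨σ, c, hc, hσ⟩ => ?_⟩
  · have h1 : 0 < min (a / 12) (1 / 100) := lt_min (by linarith) h100
    refine W_anti p n α ?_ (hagree _ h1 (min_le_right _ _)).1
    have := min_le_left (a / 12) (1 / 100)
    linarith
  · have h1 : 0 < min (c / 96) (1 / 100) := lt_min (by linarith) h100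
    have h2 : σ ∈ W q n (96 * min (c / 96) (1 / 100)) α := by
      refine W_anti q n α ?_ hσ
      have := min_le_left (c / 96) (1 / 100)
      linarith
    exact (hagree _ h1 (min_le_right _ _)).2 ⟨σ, h2⟩

end Roumieu

end PolyFock

theorem proposition4p3 (n : ℕ) (α : ℝ) (hα : 1 / 2 ≤ α) (hα' : α ≤ 1)
    (p q : ℝ≥0∞) [Fact (1 ≤ p)] [Fact (1 ≤ q)] :
    -- the two spaces themselves
    ((PolyFock.GBeurling q n α : Set (ℂ → ℂ)) =
      ⋂ (a : ℝ) (_ : 0 < a), (PolyFock.W p n a α : Set (ℂ → ℂ))) ∧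
    ((PolyFock.GRoumieu q n α : Set (ℂ → ℂ)) =
      ⋃ (a : ℝ) (_ : 0 < a), (PolyFock.W p n a α : Set (ℂ → ℂ))) ∧
    -- the dual of the first space is the union of the `W^{p,n}_{-a,α}`
    ((∀ F ∈ ⋃ (a : ℝ) (_ : 0 < a), (PolyFock.W p n (-a) α : Set (ℂ → ℂ)),
        ∃ u ∈ PolyFock.beurlingDual q n α, PolyFock.Represents n F u) ∧
      (∀ u ∈ PolyFock.beurlingDual q n α,
        ∃ F ∈ ⋃ (a : ℝ) (_ : 0 < a), (PolyFock.W p n (-a) α : Set (ℂ → ℂ)),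
          PolyFock.IsPolyanalytic (n + 1) F ∧ PolyFock.Represents n F u) ∧
      (1 / 2 < α →
        ∀ F₁ ∈ ⋃ (a : ℝ) (_ : 0 < a), (PolyFock.W p n (-a) α : Set (ℂ → ℂ)),
        ∀ F₂ ∈ ⋃ (a : ℝ) (_ : 0 < a), (PolyFock.W p n (-a) α : Set (ℂ → ℂ)),
        ∀ u : PolyFock.GBeurling q n α →ₗ[ℂ] ℂ,
          PolyFock.Represents n F₁ u → PolyFock.Represents n F₂ u →
            (∀ j ≤ n, PolyFock.proj j F₁ = PolyFock.proj j F₂) ∧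
            (PolyFock.IsPolyanalytic (n + 1) F₁ → PolyFock.IsPolyanalytic (n + 1) F₂ →
              F₁ = F₂))) ∧
    -- the dual of the second space is the intersection of the `W^{p,n}_{-a,α}`
    ((∀ F ∈ ⋂ (a : ℝ) (_ : 0 < a), (PolyFock.W p n (-a) α : Set (ℂ → ℂ)),
        ∃ u ∈ PolyFock.roumieuDual q n α, PolyFock.Represents n F u) ∧
      (∀ u ∈ PolyFock.roumieuDual q n α,
        ∃ F ∈ ⋂ (a : ℝ) (_ : 0 < a), (PolyFock.W p n (-a) α : Set (ℂ → ℂ)),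
          PolyFock.IsPolyanalytic (n + 1) F ∧ PolyFock.Represents n F u) ∧
      (∀ F₁ ∈ ⋂ (a : ℝ) (_ : 0 < a), (PolyFock.W p n (-a) α : Set (ℂ → ℂ)),
        ∀ F₂ ∈ ⋂ (a : ℝ) (_ : 0 < a), (PolyFock.W p n (-a) α : Set (ℂ → ℂ)),
        ∀ u : PolyFock.GRoumieu q n α →ₗ[ℂ] ℂ,
          PolyFock.Represents n F₁ u → PolyFock.Represents n F₂ u →
            (∀ j ≤ n, PolyFock.proj j F₁ = PolyFock.proj j F₂) ∧
            (PolyFock.IsPolyanalytic (n + 1) F₁ → PolyFock.IsPolyanalytic (n + 1) F₂ →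
              F₁ = F₂))) := by
  simp only [Set.mem_iUnion, Set.mem_iInter, SetLike.mem_coe, exists_prop]
  refine ⟨PolyFock.GBeurling_eq hα hα' n p q, PolyFock.GRoumieu_eq hα hα' n p q,
    ⟨fun F ⟨a, ha, hF⟩ => PolyFock.exists_mem_beurlingDual q hα hα' ha hF, fun u hu => ?_,
      fun hα2 F₁ ⟨a₁, _, h₁⟩ F₂ ⟨a₂, _, h₂⟩ u hr₁ hr₂ => ?_⟩,
    ⟨fun F hF => PolyFock.exists_mem_roumieuDual q hα hα' hF, fun u hu =>
      PolyFock.exists_representing_roumieu p hα hα' hu, fun F₁ h₁ F₂ h₂ u hr₁ hr₂ => ?_⟩⟩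
  · obtain ⟨a, ha, F, hm, hF, hr⟩ := PolyFock.exists_representing_beurling p hα hα' hu
    exact ⟨F, ⟨a, ha, hm⟩, hF, hr⟩
  · have h := PolyFock.proj_eq_of_represents h₁.1 h₂.1 hr₁ hr₂ fun j ζ =>
      PolyFock.kernel_mem_GBeurling hα2 hα' j ζ
    exact ⟨h, PolyFock.eq_of_proj_eq h₁.1 h₂.1 h⟩
  · have d₁ := (h₁ 1 one_pos).1
    have d₂ := (h₂ 1 one_pos).1
    have h := PolyFock.proj_eq_of_represents d₁ d₂ hr₁ hr₂ fun j ζ =>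
      PolyFock.kernel_mem_GRoumieu hα hα' j ζ
    exact ⟨h, PolyFock.eq_of_proj_eq d₁ d₂ h⟩
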